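/- A labelled degree-$d$ graph ($d\ge 1$) has, for each node $v$ and each label $i\in\{1,\dots,d\}$, exactly one edge labelled $i$ out of $v$; inputs have a start node and a target node. A nondeterministic jumping automaton (nd-jag) has a finite set of states and a finite set of pebbles, and works on labelled graphs of all degrees: its pebbles stand on edges, and in one step, depending only on the state and on which pebbles coincide, it nondeterministically changes its state and moves each pebble from its edge to the (cyclically) next edge out of the same source, or to the first edge out of the target of its edge, or to the old position of another pebble. Initially a pebble $t$ is on the first edge out of the target node and all other pebbles are on the first edge out of the start node. An input is accepted if some finite computation reaches the accept state; such a computation is called accepting. The automaton is deterministic (a jag) if there is exactly one transition for each state and each coincidence relation of the pebbles. An automaton traverses a family of inputs with a dedicated pebble $\mathit{curr}$ if it accepts each of them and every accepting computation places $\mathit{curr}$ on every node reachable from the start node; it orders the family if moreover, on each input, the sequence of nodes visited by $\mathit{curr}$ is the same in all accepting computations. For $d,\ell\ge 1$ let $C_{d,\ell}$ be the Cayley graph of $(\mathbb{Z}/\ell\mathbb{Z})^d$ with the standard generators $m_1,\dots,m_d$ and with the neutral element as start node. Let $\mathcal{F}$ be the family of all inputs in which the part reachable from the start node is isomorphic to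 some $C_{d,\ell}$; the target node may lie in this part or elsewhere. In particular $\mathcal F$ contains every $C_{d,\ell}$ with an arbitrary target node. Then: 1. On each member of $\mathcal{F}$, every node reachable from the start node is the end of exactly one canonical path $m_1^{i_1}\cdots m_d^{i_d}$ with $0\le i_j<\ell$ from the start node. 2. $\mathcal F$ is orderable: a single nd-jag orders all members of $\mathcal F$ (for all $d$ and $\ell$), and in every accepting computation the pebble $\mathit{curr}$ visits the nodes reachable from the start node exactly in the lexicographic order of the exponents $(i_1,\dots,i_d)$ of their canonical paths. 3. nd-jags can run any NLOGSPACE algorithm on these graphs: for every nondeterministic logarithmic-space Turing machine $M$ there is an nd-jag that, for all $d$ and $\ell$, accepts a member $G$ of $\mathcal F$ if and only if $M$ accepts the encoding, as a word, of the part of $G$ reachable from the start node, with its nodes numbered in the above lexicographic order, together with the numbers of the start node and of the target node (or the information that the target node is not in this part). 4. In particular co-st-connectivity can be decided: there is an nd-jag that accepts a member of $\mathcal F$ if and only if its target node is not reachable from its start node. 5. No deterministic jag traverses the family of all $C_{d,\ell}$ with arbitrary target nodes. Indeed, for every deterministic jag there are $d,\ell\ge 1$ such that on $C_{d,\ell}$,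 for every position of the target node and every choice of the pebble $\mathit{curr}$, this pebble never visits some node of $C_{d,\ell}$. -/

import Mathlib

namespace NDJag

/-! ### Labelled graphs -/

/-- A labelled degree-`d` graph: every vertex has, for each label `i`, one outgoing edge labelled `i`,
leading to `edge v i`. The labels are `0, …, d - 1`. -/
structure LabelledGraph (V : Type) (d : ℕ) where
  edge : V → Fin d → V

namespace LabelledGraph

variable {V : Type} {d : ℕ}

/-- The vertex `v.w` reached from `v` by following the sequence of labels `w`. -/
def walk (G : LabelledGraph V d) (v : V) (w : List (Fin d)) : V :=
  w.foldl G.edge v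

/-- There is a path from `u` to `v`. -/
def Reachable (G : LabelledGraph V d) (u v : V) : Prop :=
  ∃ w : List (Fin d), G.walk u w = v

/-- The graph on which the pebbles of a degree-independent automaton travel. Its vertices are the
edges `(v, i)` of `G` (the edge labelled `i` out of `v`). Label `0` is the move *next*: go to the
next edge (cyclically) out of the same source. Label `1` is the move *first*: go to the first edge
out of the target of the current edge. -/
def edgeGraph [NeZero d] (G : LabelledGraph V d) : LabelledGraph (V × Fin d) 2 where
  edge e a := if a = 0 then (e.1, e.2 + 1) else (G.edge e.1 e.2, 0)

end LabelledGraph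

/-- The Cayley graph of a group with respect to the generators `m`: the edge labelled `i` leads from
`v` to `m i * v`. -/
def cayleyGraph {Γ : Type} [Group Γ] {d : ℕ} (m : Fin d → Γ) : LabelledGraph Γ d where
  edge v i := m i * v

/-- The group `(ℤ/ℓℤ)^d`, written multiplicatively. -/
abbrev Grid (d ℓ : ℕ) : Type := Multiplicative (Fin d → ZMod ℓ)

/-- The standard generators of `(ℤ/ℓℤ)^d`. -/
def gridGen (d ℓ : ℕ) (i : Fin d) : Grid d ℓ :=
  Multiplicative.ofAdd (Pi.single i 1)

/-! ### Jumping automata on graphs -/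

/-- A move of one pebble of a `d`-JAG with set of pebbles `P`. -/
inductive Move (d : ℕ) (P : Type) : Type
  | move (i : Fin d) : Move d P
  | jump (j : P) : Move d P

/-- The new position of pebble `p`, when the old positions are given by `node`. -/
def Move.apply {V P : Type} {d : ℕ} (G : LabelledGraph V d) (node : P → V) (p : P) :
    Move d P → V
  | .move i => G.edge (node p) i
  | .jump j => node j

/-- A (nondeterministic) jumping automaton for labelled graphs of degree `d`. The transition function
`δ` sees the state and the incidence relation of the pebbles, and gives a set of pairs consisting of
a new state and one move for each pebble. -/
structure JAG (d : ℕ) where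
  Q : Type
  P : Type
  [finQ : Finite Q]
  [finP : Finite P]
  q₀ : Q
  qₐ : Q
  s : P
  t : P
  s_ne_t : s ≠ t
  δ : Q → Setoid P → Set (Q × (P → Move d P))

namespace JAG

variable {d : ℕ}

/-- Exactly one transition for each state and each incidence relation. -/
def IsDeterministic (J : JAG d) : Prop :=
  ∀ q π, ∃! m, m ∈ J.δ q π

/-- Instantaneous descriptions: a state and the positions of the pebbles. -/
abbrev Id (J : JAG d) (V : Type) : Type := J.Q × (J.P → V)

/-- One legal move of `J` on `G`. -/
def Step {V : Type} (J : JAG d) (G : LabelledGraph V d) (x y : J.Id V) : Prop :=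
  ∃ m ∈ J.δ x.1 (Setoid.ker x.2), y = (m.1, fun p => (m.2 p).apply G x.2 p)

open Classical in
/-- The initial instantaneous description: `t` is on the target node and all other pebbles are on the
start node. -/
noncomputable def initial {V : Type} (J : JAG d) (start target : V) : J.Id V :=
  (J.q₀, fun p => if p = J.t then target else start)

/-- A finite computation beginning with the initial instantaneous description. -/
def IsComputation {V : Type} (J : JAG d) (G : LabelledGraph V d) (start target : V)
    (c : List (J.Id V)) : Prop :=
  c.head? = some (J.initial start target) ∧ c.IsChain (J.Step G)

/-- A finite computation beginning with the initial instantaneous description and ending in the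
accept state. -/
def IsAcceptingComputation {V : Type} (J : JAG d) (G : LabelledGraph V d) (start target : V)
    (c : List (J.Id V)) : Prop :=
  J.IsComputation G start target c ∧ ∃ x ∈ c.getLast?, x.1 = J.qₐ

end JAG

/-! ### Inputs of arbitrary degree, traversal and ordering -/

/-- A labelled graph of some degree `d ≥ 1` with a start node and a target node. -/
structure Input where
  d : ℕ
  [d_ne : NeZero d]
  V : Type
  graph : LabelledGraph V d
  start : V
  target : V

attribute [instance] Input.d_ne

/-- A jumping automaton that runs on graphs of all degrees: its pebbles are placed on edges, and are
moved by *next* and *first* (see `LabelledGraph.edgeGraph`) or by jumps. -/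
abbrev EdgeJAG : Type 1 := JAG 2

namespace EdgeJAG

/-- Instantaneous descriptions of `J` on the input `G`. -/
abbrev IdOn (J : EdgeJAG) (G : Input) : Type := JAG.Id J (G.V × Fin G.d)

/-- A finite computation of `J` on the input `G`; a pebble that is put on a node initially is put on
the first edge out of this node. -/
def IsComputation (J : EdgeJAG) (G : Input) (c : List (IdOn J G)) : Prop :=
  JAG.IsComputation J G.graph.edgeGraph (G.start, 0) (G.target, 0) c

/-- A finite accepting computation of `J` on the input `G`. -/
def IsAcceptingComputation (J : EdgeJAG) (G : Input) (c : List (IdOn J G)) : Prop :=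
  JAG.IsAcceptingComputation J G.graph.edgeGraph (G.start, 0) (G.target, 0) c

/-- `J` accepts `G` if it has some accepting computation on `G`. -/
def Accepts (J : EdgeJAG) (G : Input) : Prop :=
  ∃ c, IsAcceptingComputation J G c

open Classical in
/-- The ordered sequence of nodes on which the pebble `curr` is placed along a computation. A pebble
is placed on the source of its edge; a node is listed once for each time the pebble comes to it,
not once for each step that it spends there. -/
noncomputable def visits {J : EdgeJAG} {G : Input} (curr : J.P) (c : List (IdOn J G)) :
    List G.V :=
  (c.map fun x => (x.2 curr).1).destutter (· ≠ ·)

/-- `J` traverses the family `𝓕` with the pebble `curr`. -/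
def Traverses (J : EdgeJAG) (curr : J.P) (𝓕 : Set Input) : Prop :=
  ∀ G ∈ 𝓕, Accepts J G ∧
    ∀ c, IsAcceptingComputation J G c → ∀ v, G.graph.Reachable G.start v → v ∈ visits curr c

/-- `J` orders the family `𝓕` with the pebble `curr`: it traverses the family, and on each graph of
the family the ordered sequence of visited nodes is the same in all accepting computations. -/
def Orders (J : EdgeJAG) (curr : J.P) (𝓕 : Set Input) : Prop :=
  Traverses J curr 𝓕 ∧
    ∀ G ∈ 𝓕, ∃ σ : List G.V, ∀ c, IsAcceptingComputation J G c → visits curr c = σ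

end EdgeJAG

/-! ### Grid graphs -/

/-- The Cayley graph of `(ℤ/ℓℤ)^d` with the standard generators, the neutral element as the start
node, and an arbitrary target node. -/
def gridInput (d ℓ : ℕ) [NeZero d] (target : Grid d ℓ) : Input where
  d := d
  V := Grid d ℓ
  graph := cayleyGraph (gridGen d ℓ)
  start := 1
  target := target

/-- The component of the start node of `G` is, up to an isomorphism of labelled graphs with start
node, the Cayley graph of `(ℤ/ℓℤ)^d` with the standard generators. (That Cayley graph is connected,
so the image of `φ` is exactly the set of nodes reachable from the start node.) The target node may
lie in the same component or elsewhere. -/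
def IsGridInput (ℓ : ℕ) (G : Input) : Prop :=
  ∃ φ : Grid G.d ℓ → G.V, Function.Injective φ ∧ φ 1 = G.start ∧
    ∀ v i, φ ((cayleyGraph (gridGen G.d ℓ)).edge v i) = G.graph.edge (φ v) i

/-- The Cayley graphs of `(ℤ/ℓℤ)^d`, `d, ℓ ≥ 1`, themselves. -/
def gridCayleyGraphs : Set Input :=
  {G | ∃ (d ℓ : ℕ) (_ : NeZero d) (target : Grid d ℓ), 1 ≤ ℓ ∧ G = gridInput d ℓ target}

/-- The graphs in which the component of the start node is the Cayley graph of some `(ℤ/ℓℤ)^d`,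
`d, ℓ ≥ 1`. -/
def gridInputs : Set Input :=
  {G | ∃ ℓ, 1 ≤ ℓ ∧ IsGridInput ℓ G}

theorem isGridInput_gridInput (d ℓ : ℕ) [NeZero d] (target : Grid d ℓ) :
    IsGridInput ℓ (gridInput d ℓ target) :=
  ⟨id, Function.injective_id, rfl, fun _ _ => rfl⟩

theorem gridCayleyGraphs_subset_gridInputs : gridCayleyGraphs ⊆ gridInputs := by
  rintro G ⟨d, ℓ, _, target, hℓ, rfl⟩
  exact ⟨ℓ, hℓ, isGridInput_gridInput d ℓ target⟩

/-- The path `m_1^{e_1} ⋯ m_d^{e_d}`. -/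
def canonicalPath {d ℓ : ℕ} (e : Fin d → Fin ℓ) : List (Fin d) :=
  (List.finRange d).flatMap fun j => List.replicate (e j : ℕ) j

/-- The node of `G` to which the canonical path with exponents `e` leads from the start node. -/
def canonicalNode {ℓ : ℕ} (G : Input) (e : Fin G.d → Fin ℓ) : G.V :=
  G.graph.walk G.start (canonicalPath e)

/-- The end nodes of all canonical paths, in the lexicographic order of the exponents
`(e_1, …, e_d)`, the exponent of the first generator being the most significant one. -/
noncomputable def lexNodes (G : Input) (ℓ : ℕ) : List G.V :=
  ((Finset.univ : Finset (Fin G.d → Fin ℓ)).map (toLex (α := Fin G.d → Fin ℓ)).toEmbedding |>.sort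
    (· ≤ ·)).map fun e => canonicalNode G (ofLex e)

/-! ### Encodings and nondeterministic logarithmic space -/

/-- `k` in unary, with an end marker. -/
def unary (k : ℕ) : List Bool := List.replicate k true ++ [false]

open Classical in
/-- The encoding of the part of `G` spanned by the list of nodes `σ`: the number of nodes, the degree,
the numbers of the start node and the target node, and then the list of all edge targets. A node is
represented by its position in `σ` (counted from `0`), and a node outside `σ` by the length of `σ`.
The code has length polynomial in (number of nodes) · (degree), as for the usual adjacency lists and
adjacency matrices. -/
noncomputable def encode (G : Input) (σ : List G.V) : List Bool :=
  unary σ.length ++ unary G.d ++ unary (σ.idxOf G.start) ++ unary (σ.idxOf G.target) ++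
    σ.flatMap fun v => (List.finRange G.d).flatMap fun i => unary (σ.idxOf (G.graph.edge v i))

/-- Symbols on the input tape: the two end markers and the bits. -/
inductive InSym : Type
  | left : InSym
  | right : InSym
  | bit (b : Bool) : InSym

/-- Head movements. -/
inductive Dir : Type
  | left : Dir
  | stay : Dir
  | right : Dir

/-- Head movement on a one-sided tape; the head does not leave the tape at the left end. -/
def Dir.apply : Dir → ℕ → ℕ
  | .left, i => i - 1
  | .stay, i => i
  | .right, i => i + 1

/-- A nondeterministic Turing machine with a two-way read-only input tape and a work tape. -/
structure NTM where
  Q : Type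
  Γ : Type
  [finQ : Finite Q]
  [finΓ : Finite Γ]
  blank : Γ
  q₀ : Q
  qₐ : Q
  δ : Q → InSym → Γ → Set (Q × Γ × Dir × Dir)

namespace NTM

/-- A configuration: state, position on the input tape, position on the work tape, work tape. -/
structure Config (M : NTM) where
  state : M.Q
  inPos : ℕ
  workPos : ℕ
  work : ℕ → M.Γ

/-- The contents of the input tape: the left end marker in cell `0`, the word in the cells
`1, …, |w|`, and the right end marker afterwards. -/
def inputSymbol (w : List Bool) (i : ℕ) : InSym :=
  if i = 0 then .left else (w[i - 1]?).elim .right .bit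

/-- The initial configuration, with the input head on the first input cell and a blank work tape. -/
def initial (M : NTM) : M.Config := ⟨M.q₀, 1, 0, fun _ => M.blank⟩

/-- One step on input `w`. The input head stays in the cells `0, …, |w| + 1`. -/
def Step (M : NTM) (w : List Bool) (x y : M.Config) : Prop :=
  ∃ m ∈ M.δ x.state (inputSymbol w x.inPos) (x.work x.workPos),
    y = ⟨m.1, min (m.2.2.1.apply x.inPos) (w.length + 1), m.2.2.2.apply x.workPos,
      Function.update x.work x.workPos m.2.1⟩

/-- The configurations that `M` can reach on input `w`. -/
def ReachableConfig (M : NTM) (w : List Bool) (x : M.Config) : Prop :=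
  Relation.ReflTransGen (M.Step w) M.initial x

/-- Some computation of `M` on `w` reaches the accept state. -/
def Accepts (M : NTM) (w : List Bool) : Prop :=
  ∃ x, M.ReachableConfig w x ∧ x.state = M.qₐ

/-- On every input of length `n`, no computation of `M` visits more than `O(log n)` work cells. -/
def IsLogSpace (M : NTM) : Prop :=
  ∃ k : ℕ, ∀ w x, M.ReachableConfig w x → x.workPos < k * (Nat.log 2 w.length + 1)

end NTM

end NDJag

open NDJag

/-! ### Closure properties of regular languages -/

namespace Language

open Computability

variable {α β : Type}

/-! Positive part. A program is a regular language whose letters are guarded moves (a condition on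
the coincidences of the pebbles and one move for each pebble). An nd-jag runs it by guessing a word
letter by letter and feeding it to a finite automaton (`jagOf`). Call a relation between pebble
positions recognisable if some program, which never moves the argument pebbles, has a successful run
exactly when the relation holds. Such relations are closed under conjunction, disjunction,
existential quantification and transitive closure (`Recog.and_of`, `Recog.or`, `Recog.ex`,
`Recog.tc`): a pebble can be guessed onto any reachable edge, and a guess that is wrong is caught by
a later test. Negation is not among these operations, so each negated relation that is needed has
its own construction.

On grids, the relation "same label" and the lexicographic successor are recognisable
(`Def.same_label`, `Def.node_succ`): the successor adds one to a final segment of the exponents, and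
the carry can be tested by walks from the start node. Repeatedly guessing the successor and
verifying it gives a sweep in which every successful run visits the nodes in the same order
(`exists_sweep`). This orders the family. Co-st-connectivity follows by forbidding, at every step of
the sweep, that `curr` meets the target pebble (`decides_not_targetReachable`).

Since the edges are linearly ordered with recognisable successor, a tuple of pebbles is a number
below a power of the number of edges, and addition and multiplication are transitive closures of
successor steps. The letters of the encoding become recognisable (`WDef`). So does a step of a
Turing machine, whose logarithmically long work tape is a number of polynomial size
(`NTM.numStep_code`). Acceptance is then one more transitive closure (`NDef.numAccepts`). Programs
for grids run unchanged on the embedded component of an input (`Def.onInputs`).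

Negative part. Take `ℓ = 2` and divide the pebbles into clusters. As long as different clusters do
not meet, the automaton does not notice if each cluster is translated on its own
(`Clustered.step_shift`). By downward induction on the number of clusters, within a time polynomial
in `d` some configuration becomes a translate, cluster by cluster, of an earlier one
(`repeatsWithin_of_succ`). With all pebbles in a single cluster no meeting is possible, so this
always happens; as every translation is an involution, soon afterwards a configuration is repeated
exactly. Hence only polynomially many of the `2 ^ d` nodes are visited. -/

theorem IsRegular.of_leftQuotient_mem {L : Language α} {F : Set (Language α)} (hF : F.Finite)
    (h : ∀ w, L.leftQuotient w ∈ F) : L.IsRegular :=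
  .of_finite_range_leftQuotient (hF.subset (by rintro _ ⟨w, rfl⟩; exact h w))

/-- The quotient by `w` is `(L₁/w)L₂` together with all `L₂/v` for splittings `w = uv` with `u ∈
L₁`. It is determined by one quotient of `L₁` and a set of quotients of `L₂`, so only finitely many
occur. -/
theorem IsRegular.mul {L₁ L₂ : Language α} (h₁ : L₁.IsRegular) (h₂ : L₂.IsRegular) :
    (L₁ * L₂).IsRegular := by
  have f₁ := h₁.finite_range_leftQuotient
  have f₂ := h₂.finite_range_leftQuotient
  refine .of_leftQuotient_mem ((f₁.prod f₂.powerset).image fun p : Language α × Set (Language α) =>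
    (({y | y ∈ p.1 * L₂ ∨ ∃ B ∈ p.2, y ∈ B} : Set (List α)) : Language α)) fun w => ?_
  refine ⟨(L₁.leftQuotient w, {B | ∃ u v, u ∈ L₁ ∧ w = u ++ v ∧ B = L₂.leftQuotient v}),
    ⟨⟨w, rfl⟩, ?_⟩, ?_⟩
  · rintro _ ⟨u, v, -, -, rfl⟩
    exact ⟨v, rfl⟩
  · ext y
    change (y ∈ L₁.leftQuotient w * L₂ ∨ ∃ B, (∃ u v, u ∈ L₁ ∧ w = u ++ v ∧
      B = L₂.leftQuotient v) ∧ y ∈ B) ↔ w ++ y ∈ L₁ * L₂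
    simp only [Language.mem_mul]
    constructor
    · rintro (⟨a, ha, b, hb, rfl⟩ | ⟨_, ⟨u, v, hu, rfl, rfl⟩, hy⟩)
      · exact ⟨w ++ a, ha, b, hb, by simp⟩
      · exact ⟨u, hu, v ++ y, hy, by simp⟩
    · rintro ⟨a, ha, b, hb, h⟩
      rcases List.append_eq_append_iff.1 h with ⟨c, rfl, rfl⟩ | ⟨c, rfl, rfl⟩
      · exact .inr ⟨_, ⟨a, c, ha, rfl, rfl⟩, hb⟩
      · exact .inl ⟨c, ha, b, hb, rfl⟩

theorem append_mem_kstar {L : Language α} {a b : List α} (ha : a ∈ L∗) (hb : b ∈ L∗) :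
    a ++ b ∈ L∗ := by
  obtain ⟨A, rfl, hA⟩ := Language.mem_kstar.1 ha
  obtain ⟨B, rfl, hB⟩ := Language.mem_kstar.1 hb
  refine Language.mem_kstar.2 ⟨A ++ B, by simp, fun y hy => ?_⟩
  rcases List.mem_append.1 hy with h | h
  exacts [hA y h, hB y h]

theorem mem_kstar_of_mem {L : Language α} {a : List α} (ha : a ∈ L) : a ∈ L∗ :=
  Language.mem_kstar.2 ⟨[a], by simp, by simpa using ha⟩

theorem kstar_induction {L : Language α} {p : List α → Prop} (nil : p [])
    (cons : ∀ a b, a ∈ L → b ∈ L∗ → p b → p (a ++ b)) {w : List α} (hw : w ∈ L∗) : p w := by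
  obtain ⟨A, rfl, hA⟩ := Language.mem_kstar.1 hw
  clear hw
  induction A with
  | nil => exact nil
  | cons l A ih =>
    have hA' := fun y hy => hA y (List.mem_cons_of_mem _ hy)
    exact cons l _ (hA l (by simp)) (Language.join_mem_kstar hA')
      (ih hA')

/-- The cut between `w` and `y` lies inside or at the end of one factor `v ++ a`. Without `w ≠ []`
there might be no factor at all. -/
theorem exists_split_of_append_mem_kstar {L : Language α} {s : List α} (hs : s ∈ L∗) :
    ∀ w y, s = w ++ y → w ≠ [] → ∃ u v a b, u ∈ L∗ ∧ w = u ++ v ∧ v ++ a ∈ L ∧ b ∈ L∗ ∧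
      y = a ++ b := by
  refine Language.kstar_induction (p := fun s => ∀ w y, s = w ++ y → w ≠ [] →
    ∃ u v a b, u ∈ L∗ ∧ w = u ++ v ∧ v ++ a ∈ L ∧ b ∈ L∗ ∧ y = a ++ b) ?_ ?_ hs
  · intro w y h hw
    simp_all
  · intro l r hl hr ih w y h hw
    rcases List.append_eq_append_iff.1 h with ⟨c, rfl, rfl⟩ | ⟨c, rfl, rfl⟩
    · by_cases hc : c = []
      · subst hc
        exact ⟨[], l, [], y, Language.nil_mem_kstar _, by simp, by simpa using hl, hr, by simp⟩
      · obtain ⟨u, v, a, b, hu, rfl, ha, hb, rfl⟩ := ih c y rfl hc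
        exact ⟨l ++ u, v, a, b, append_mem_kstar (mem_kstar_of_mem hl) hu, by simp, ha, hb, rfl⟩
    · exact ⟨[], w, c, r, Language.nil_mem_kstar _, rfl, hl, hr, rfl⟩

/-- For nonempty `w` the quotient is the union of the `(L/v)L∗` over splittings `w = uv` with `u ∈
L∗`; the empty word contributes the one further quotient `L∗`. -/
theorem IsRegular.kstar {L : Language α} (h : L.IsRegular) : (L∗).IsRegular := by
  have f := h.finite_range_leftQuotient
  refine .of_leftQuotient_mem ((f.powerset.image fun S : Set (Language α) =>
    (({y | ∃ B ∈ S, y ∈ B * L∗} : Set (List α)) : Language α)).insert (L∗)) fun w => ?_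
  by_cases hw : w = []
  · subst hw
    exact .inl rfl
  refine .inr ⟨{B | ∃ u v, u ∈ L∗ ∧ w = u ++ v ∧ B = L.leftQuotient v}, ?_, ?_⟩
  · rintro _ ⟨u, v, -, -, rfl⟩
    exact ⟨v, rfl⟩
  · ext y
    change (∃ B, (∃ u v, u ∈ L∗ ∧ w = u ++ v ∧ B = L.leftQuotient v) ∧ y ∈ B * L∗) ↔ w ++ y ∈ L∗
    simp only [Language.mem_mul]
    constructor
    · rintro ⟨_, ⟨u, v, hu, rfl, rfl⟩, a, ha, b, hb, rfl⟩
      have := append_mem_kstar hu (append_mem_kstar (mem_kstar_of_mem ha) hb)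
      simpa using this
    · intro h
      obtain ⟨u, v, a, b, hu, rfl, ha, hb, rfl⟩ := exists_split_of_append_mem_kstar h w y rfl hw
      exact ⟨_, ⟨u, v, hu, rfl, rfl⟩, a, ha, b, hb, rfl⟩

/-- The quotient by `w` is the union of the images of the quotients of `L` by the preimages of `w`.
-/
theorem IsRegular.map {L : Language α} (h : L.IsRegular) (f : α → β) :
    (Language.map f L).IsRegular := by
  have hf := h.finite_range_leftQuotient
  refine .of_leftQuotient_mem (hf.powerset.image fun S : Set (Language α) =>
    (({y | ∃ B ∈ S, y ∈ Language.map f B} : Set (List β)) : Language β)) fun w => ?_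
  refine ⟨{B | ∃ v : List α, v.map f = w ∧ B = L.leftQuotient v}, ?_, ?_⟩
  · rintro _ ⟨v, -, rfl⟩
    exact ⟨v, rfl⟩
  · ext y
    change (∃ B, (∃ v : List α, v.map f = w ∧ B = L.leftQuotient v) ∧ ∃ z ∈ B, z.map f = y) ↔
      ∃ z ∈ L, z.map f = w ++ y
    constructor
    · rintro ⟨_, ⟨v, rfl, rfl⟩, z, hz, rfl⟩
      exact ⟨v ++ z, hz, by simp⟩
    · rintro ⟨z, hz, h⟩
      obtain ⟨u, v, rfl, rfl, rfl⟩ := List.map_eq_append_iff.1 h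
      exact ⟨_, ⟨u, rfl, rfl⟩, v, hz, rfl⟩

/-- The words of length one with letter in `A`. -/
def letters (A : Set α) : Language α := ({w | ∃ a ∈ A, w = [a]} : Set (List α))

theorem mem_letters {A : Set α} {w : List α} : w ∈ letters A ↔ ∃ a ∈ A, w = [a] := Iff.rfl

theorem isRegular_letters (A : Set α) : (letters A).IsRegular := by
  refine .of_leftQuotient_mem (F := {letters A, 1, 0}) (by simp) fun w => ?_
  rcases w with _ | ⟨a, _ | ⟨b, w⟩⟩
  · exact .inl rfl
  · by_cases ha : a ∈ A
    · right; left
      ext y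
      rw [mem_leftQuotient, mem_letters, mem_one]
      simp only [List.cons_append, List.nil_append, List.cons.injEq]
      exact ⟨by rintro ⟨_, _, rfl, h⟩; exact h, fun h => ⟨a, ha, rfl, h⟩⟩
    · right; right
      ext y
      rw [mem_leftQuotient, mem_letters]
      simp only [List.cons_append, List.nil_append, List.cons.injEq]
      exact ⟨by rintro ⟨_, h, rfl, _⟩; exact ha h, fun h => (notMem_zero _ h).elim⟩
  · right; right
    ext y
    rw [mem_leftQuotient, mem_letters]
    simp only [List.cons_append, List.cons.injEq]
    exact ⟨by rintro ⟨_, _, _, h⟩; simp at h, fun h => (notMem_zero _ h).elim⟩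

end Language

/-! ### Words of guarded moves -/

namespace NDJag

/-- Rename the pebbles in a move. -/
def Move.map {d : ℕ} {P₁ P₂ : Type} (e : P₁ → P₂) : Move d P₁ → Move d P₂
  | .move i => .move i
  | .jump j => .jump (e j)

/-- A guarded move: a condition on the incidence relation, and a move for each pebble. -/
abbrev Atom (P : Type) : Type := (Setoid P → Prop) × (P → Move 2 P)

namespace Atom

variable {U W P P₁ P₂ : Type} (H : LabelledGraph U 2)

/-- The pebble positions after the moves of `a`. -/
def step (a : Atom P) (x : P → U) : P → U := fun p => (a.2 p).apply H x p

/-- All guards of the word `w` are satisfied when it is executed from `x`. -/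
def ok : List (Atom P) → (P → U) → Prop
  | [], _ => True
  | a :: w, x => a.1 (Setoid.ker x) ∧ ok w (step H a x)

/-- The pebble positions after all moves of the word `w`. -/
def exec : List (Atom P) → (P → U) → (P → U)
  | [], x => x
  | a :: w, x => exec w (step H a x)

/-- The pebble positions before each of the moves of the word `w`. -/
def trace : List (Atom P) → (P → U) → List (P → U)
  | [], _ => []
  | a :: w, x => x :: trace w (step H a x)

/-- `y` can be reached from `x` by a word of the language `L`. -/
def Sem (L : Language (Atom P)) (x y : P → U) : Prop :=
  ∃ w ∈ L, ok H w x ∧ exec H w x = y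

@[simp] theorem ok_append (v w : List (Atom P)) (x : P → U) :
    ok H (v ++ w) x ↔ ok H v x ∧ ok H w (exec H v x) := by
  induction v generalizing x with
  | nil => simp [ok, exec]
  | cons a v ih => simp [ok, exec, ih, and_assoc]

@[simp] theorem exec_append (v w : List (Atom P)) (x : P → U) :
    exec H (v ++ w) x = exec H w (exec H v x) := by
  induction v generalizing x with
  | nil => simp [exec]
  | cons a v ih => simp [exec, ih]

@[simp] theorem trace_append (v w : List (Atom P)) (x : P → U) :
    trace H (v ++ w) x = trace H v x ++ trace H w (exec H v x) := by
  induction v generalizing x with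
  | nil => simp [exec, trace]
  | cons a v ih => simp [exec, trace, ih]

theorem sem_add {L₁ L₂ : Language (Atom P)} {x y : P → U} :
    Sem H (L₁ + L₂) x y ↔ Sem H L₁ x y ∨ Sem H L₂ x y := by
  simp only [Sem, Language.mem_add]
  constructor
  · rintro ⟨w, h | h, hw⟩
    exacts [.inl ⟨w, h, hw⟩, .inr ⟨w, h, hw⟩]
  · rintro (⟨w, h, hw⟩ | ⟨w, h, hw⟩)
    exacts [⟨w, .inl h, hw⟩, ⟨w, .inr h, hw⟩]

theorem sem_mul {L₁ L₂ : Language (Atom P)} {x y : P → U} :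
    Sem H (L₁ * L₂) x y ↔ ∃ z, Sem H L₁ x z ∧ Sem H L₂ z y := by
  simp only [Sem, Language.mem_mul]
  constructor
  · rintro ⟨_, ⟨u, hu, v, hv, rfl⟩, hw, rfl⟩
    rw [ok_append] at hw
    exact ⟨_, ⟨u, hu, hw.1, rfl⟩, v, hv, hw.2, by simp⟩
  · rintro ⟨_, ⟨u, hu, h₁, rfl⟩, v, hv, h₂, rfl⟩
    exact ⟨_, ⟨u, hu, v, hv, rfl⟩, by simp [h₁, h₂]⟩

open Computability in
theorem sem_kstar {L : Language (Atom P)} {x y : P → U} :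
    Sem H (L∗) x y ↔ Relation.ReflTransGen (Sem H L) x y := by
  constructor
  · rintro ⟨w, hw, h, rfl⟩
    revert x
    refine @(Language.kstar_induction (p := fun w => ∀ x, ok H w x →
      Relation.ReflTransGen (Sem H L) x (exec H w x)) ?_ ?_ hw)
    · exact fun x _ => .refl
    · intro a b ha _ ih x h
      rw [ok_append] at h
      rw [exec_append]
      exact .head ⟨a, ha, h.1, rfl⟩ (ih _ h.2)
  · intro h
    induction h using Relation.ReflTransGen.head_induction_on with
    | refl => exact ⟨[], Language.nil_mem_kstar _, trivial, rfl⟩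
    | head h _ ih =>
      obtain ⟨u, hu, h₁, rfl⟩ := h
      obtain ⟨v, hv, h₂, rfl⟩ := ih
      exact ⟨u ++ v, Language.append_mem_kstar (Language.mem_kstar_of_mem hu) hv,
        by simp [h₁, h₂]⟩

theorem sem_letters {A : Set (Atom P)} {x y : P → U} :
    Sem H (Language.letters A) x y ↔ ∃ a ∈ A, a.1 (Setoid.ker x) ∧ y = step H a x := by
  constructor
  · rintro ⟨_, ⟨a, ha, rfl⟩, h, rfl⟩
    exact ⟨a, ha, h.1, rfl⟩
  · rintro ⟨a, ha, h, rfl⟩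
    exact ⟨[a], ⟨a, ha, rfl⟩, ⟨h, trivial⟩, rfl⟩

open Classical in
/-- Execute the guarded move `a` on pebbles that are renamed by `e`; only the pebbles in `M` may
move. -/
noncomputable def relabel (e : P₁ → P₂) (M : Set P₁) (a : Atom P₁) : Atom P₂ :=
  (fun π => a.1 (π.comap e),
    fun p => if h : ∃ q ∈ M, e q = p then (a.2 h.choose).map e else .jump p)

/-! ### Programs with renamed pebbles -/

section relabel

variable {H} {e : P₁ → P₂} {M : Set P₁}

/-- By `hM`, a pebble that may move shares its new name with no other pebble. Pebbles outside `M`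
may be identified by `e`; this does no harm because they stay where they are. -/
theorem step_relabel_comp (hM : ∀ q ∈ M, ∀ q', e q' = e q → q' = q) {a : Atom P₁}
    (ha : ∀ q ∉ M, a.2 q = .jump q) (x : P₂ → U) :
    step H (relabel e M a) x ∘ e = step H a (x ∘ e) := by
  funext q
  simp only [Function.comp, step, relabel]
  by_cases hq : q ∈ M
  · have h : ∃ q' ∈ M, e q' = e q := ⟨q, hq, rfl⟩
    have h' : h.choose = q := hM q hq _ h.choose_spec.2
    rw [dif_pos h, h']
    cases a.2 q <;> rfl
  · rw [dif_neg, ha q hq]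
    · rfl
    · rintro ⟨q', hq', h⟩
      exact hq (hM q' hq' q h.symm ▸ hq')

theorem exec_relabel_comp (hM : ∀ q ∈ M, ∀ q', e q' = e q → q' = q) {w : List (Atom P₁)}
    (hw : ∀ a ∈ w, ∀ q ∉ M, a.2 q = .jump q) (x : P₂ → U) :
    exec H (w.map (relabel e M)) x ∘ e = exec H w (x ∘ e) := by
  induction w generalizing x with
  | nil => rfl
  | cons a w ih =>
    rw [List.map_cons, exec, exec, ih (fun b hb => hw b (by simp [hb])),
      step_relabel_comp hM (hw a (by simp))]

theorem ok_relabel (hM : ∀ q ∈ M, ∀ q', e q' = e q → q' = q) {w : List (Atom P₁)}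
    (hw : ∀ a ∈ w, ∀ q ∉ M, a.2 q = .jump q) (x : P₂ → U) :
    ok H (w.map (relabel e M)) x ↔ ok H w (x ∘ e) := by
  induction w generalizing x with
  | nil => rfl
  | cons a w ih =>
    rw [List.map_cons, ok, ok, ih (fun b hb => hw b (by simp [hb])),
      step_relabel_comp hM (hw a (by simp))]
    rfl

theorem trace_relabel (hM : ∀ q ∈ M, ∀ q', e q' = e q → q' = q) {w : List (Atom P₁)}
    (hw : ∀ a ∈ w, ∀ q ∉ M, a.2 q = .jump q) (x : P₂ → U) :
    (trace H (w.map (relabel e M)) x).map (· ∘ e) = trace H w (x ∘ e) := by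
  induction w generalizing x with
  | nil => rfl
  | cons a w ih =>
    rw [List.map_cons, trace, trace, List.map_cons, ih (fun b hb => hw b (by simp [hb])),
      step_relabel_comp hM (hw a (by simp))]

end relabel

/-! ### Transport of programs along embeddings of graphs -/

section hom

variable {H} {H' : LabelledGraph W 2} {ψ : U → W}

theorem step_hom (hψ : ∀ u a, ψ (H.edge u a) = H'.edge (ψ u) a) (a : Atom P) (x : P → U) :
    step H' a (ψ ∘ x) = ψ ∘ step H a x := by
  funext p
  simp only [Function.comp, step]
  cases a.2 p
  · exact (hψ _ _).symm
  · rfl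

theorem exec_hom (hψ : ∀ u a, ψ (H.edge u a) = H'.edge (ψ u) a) (w : List (Atom P)) (x : P → U) :
    exec H' w (ψ ∘ x) = ψ ∘ exec H w x := by
  induction w generalizing x with
  | nil => rfl
  | cons a w ih => rw [exec, exec, step_hom hψ, ih]

theorem trace_hom (hψ : ∀ u a, ψ (H.edge u a) = H'.edge (ψ u) a) (w : List (Atom P)) (x : P → U) :
    trace H' w (ψ ∘ x) = (trace H w x).map (ψ ∘ ·) := by
  induction w generalizing x with
  | nil => rfl
  | cons a w ih => rw [trace, trace, step_hom hψ, ih, List.map_cons]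

/-- Guards see only coincidences, and an injective map preserves and reflects them. The moves alone
are transported by any homomorphism. -/
theorem ok_hom (hψ : ∀ u a, ψ (H.edge u a) = H'.edge (ψ u) a) (hinj : ψ.Injective)
    (w : List (Atom P)) (x : P → U) : ok H' w (ψ ∘ x) ↔ ok H w x := by
  induction w generalizing x with
  | nil => rfl
  | cons a w ih =>
    rw [ok, ok, step_hom hψ, ih]
    have : Setoid.ker (ψ ∘ x) = Setoid.ker x := by
      ext p q
      simp [Setoid.ker_def, hinj.eq_iff]
    rw [this]

end hom

end Atom

/-! ### Automata from regular languages -/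

/-- The automaton that executes the words accepted by `M`. -/
abbrev jagOfDFA {σ P : Type} [Finite σ] [Finite P] (M : DFA (Atom P) σ) (s t : P) (hst : s ≠ t) :
    JAG 2 where
  Q := Option σ
  P := P
  q₀ := some M.start
  qₐ := none
  s := s
  t := t
  s_ne_t := hst
  δ q π := {m | ∃ q', q = some q' ∧ ((∃ a : Atom P, a.1 π ∧ m = (some (M.step q' a), a.2)) ∨
    (q' ∈ M.accept ∧ m = (none, .jump)))}

/-- The automaton that executes the words of a regular language. -/
noncomputable def jagOf {P : Type} [Finite P] {L : Language (Atom P)} (hL : L.IsRegular) (s t : P)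
    (hst : s ≠ t) : JAG 2 :=
  haveI := hL.choose_spec.choose
  jagOfDFA hL.choose_spec.choose_spec.choose s t hst

section jagOfDFA

variable {σ P U : Type} [Finite σ] [Finite P] {M : DFA (Atom P) σ} {s t : P} {hst : s ≠ t}
  {H : LabelledGraph U 2}

/-- The word consists of the letters guessed along the computation. The step into the accept state
keeps all pebbles in place, so the final positions are listed twice. -/
theorem exists_word_of_isChain (c : List ((jagOfDFA M s t hst).Id U)) (q : σ) (x : P → U)
    (h₀ : c.head? = some (some q, x)) (hc : c.IsChain ((jagOfDFA M s t hst).Step H))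
    (he : ∃ y ∈ c.getLast?, y.1 = none) :
    ∃ w, M.evalFrom q w ∈ M.accept ∧ Atom.ok H w x ∧
      c.map Prod.snd = Atom.trace H w x ++ [Atom.exec H w x, Atom.exec H w x] := by
  induction c generalizing q x with
  | nil => simp at h₀
  | cons y c ih =>
    obtain rfl : y = (some q, x) := Option.some.inj h₀
    rcases c with _ | ⟨z, c⟩
    · obtain ⟨y, hy, hy'⟩ := he
      simp only [List.getLast?_singleton, Option.mem_some_iff] at hy
      subst hy
      simp at hy'
    · rw [List.isChain_cons_cons] at hc
      obtain ⟨⟨m, ⟨q', hq, h⟩, rfl⟩, hc⟩ := hc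
      obtain rfl : q = q' := by simpa using hq
      rcases h with ⟨a, ha, rfl⟩ | ⟨hq, rfl⟩
      · obtain ⟨w, h₁, h₂, h₃⟩ := ih _ _ rfl hc (by simpa using he)
        exact ⟨a :: w, h₁, ⟨ha, h₂⟩, by rw [List.map_cons, h₃]; rfl⟩
      · rcases c with _ | ⟨z, c⟩
        · exact ⟨[], hq, trivial, rfl⟩
        · rw [List.isChain_cons_cons] at hc
          obtain ⟨⟨m, ⟨q', hq', h⟩, rfl⟩, hc⟩ := hc
          simp at hq'

theorem exists_chain_of_word (w : List (Atom P)) (q : σ) (x : P → U)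
    (hw : M.evalFrom q w ∈ M.accept) (h : Atom.ok H w x) :
    ∃ c : List ((jagOfDFA M s t hst).Id U), c.head? = some (some q, x) ∧
      c.IsChain ((jagOfDFA M s t hst).Step H) ∧ ∃ y ∈ c.getLast?, y.1 = none := by
  induction w generalizing q x with
  | nil =>
    refine ⟨[(some q, x), (none, x)], rfl, ?_, (none, x), by simp, rfl⟩
    rw [List.isChain_pair]
    exact ⟨(none, .jump), ⟨q, rfl, .inr ⟨hw, rfl⟩⟩, rfl⟩
  | cons a w ih =>
    obtain ⟨c, h₁, h₂, h₃⟩ := ih (M.step q a) _ hw h.2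
    rcases c with _ | ⟨z, c⟩
    · simp at h₁
    obtain rfl : z = _ := Option.some.inj h₁
    refine ⟨(some q, x) :: _, rfl, List.IsChain.cons_cons ?_ h₂, by simpa using h₃⟩
    exact ⟨(some (M.step q a), a.2), ⟨q, rfl, .inl ⟨a, h.1, rfl⟩⟩, rfl⟩

end jagOfDFA

section jagOf

variable {P U : Type} [Finite P] {L : Language (Atom P)} (hL : L.IsRegular) {s t : P} {hst : s ≠ t}
  {H : LabelledGraph U 2} {start target : U}

theorem exists_word_of_isAcceptingComputation {c : List ((jagOf hL s t hst).Id U)}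
    (h : (jagOf hL s t hst).IsAcceptingComputation H start target c) :
    let x := ((jagOf hL s t hst).initial start target).2
    ∃ w ∈ L, Atom.ok H w x ∧
      c.map Prod.snd = Atom.trace H w x ++ [Atom.exec H w x, Atom.exec H w x] := by
  have := hL.choose_spec.choose
  obtain ⟨w, h₁, h₂, h₃⟩ := exists_word_of_isChain c _ _ h.1.1 h.1.2 h.2
  exact ⟨w, by rw [← hL.choose_spec.choose_spec.choose_spec]; exact h₁, h₂, h₃⟩

theorem exists_isAcceptingComputation {w : List (Atom P)} (hw : w ∈ L)
    (h : Atom.ok H w ((jagOf hL s t hst).initial start target).2) :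
    ∃ c, (jagOf hL s t hst).IsAcceptingComputation H start target c := by
  have := hL.choose_spec.choose
  obtain ⟨c, h₁, h₂, h₃⟩ := exists_chain_of_word (hst := hst) (s := s) (t := t)
    (M := hL.choose_spec.choose_spec.choose) w
    (hL.choose_spec.choose_spec.choose.start) _
    (by rw [← hL.choose_spec.choose_spec.choose_spec] at hw; exact hw) h
  exact ⟨c, ⟨h₁, h₂⟩, h₃⟩

end jagOf

end NDJag

namespace NDJag

/-! ### Basic programs -/

namespace Atom

variable {U P : Type} {H : LabelledGraph U 2}

/-- Every letter of every word of `L` leaves the pebbles in `F` where they are. -/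
def Fixes (L : Language (Atom P)) (F : Set P) : Prop :=
  ∀ w ∈ L, ∀ a ∈ w, ∀ p ∈ F, a.2 p = .jump p

theorem exec_apply_of_fixed {w : List (Atom P)} {p : P} (hw : ∀ a ∈ w, a.2 p = .jump p)
    (x : P → U) : exec H w x p = x p := by
  induction w generalizing x with
  | nil => rfl
  | cons a w ih =>
    rw [exec, ih (fun b hb => hw b (by simp [hb])), step, hw a (by simp), Move.apply]

theorem Fixes.sem {L : Language (Atom P)} {F : Set P} (h : Fixes L F) {x y : P → U}
    (hs : Sem H L x y) {p : P} (hp : p ∈ F) : y p = x p := by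
  obtain ⟨w, hw, -, rfl⟩ := hs
  exact exec_apply_of_fixed (fun a ha => h w hw a ha p hp) x

theorem Fixes.mono {L : Language (Atom P)} {F F' : Set P} (h : Fixes L F) (hF : F' ⊆ F) :
    Fixes L F' := fun w hw a ha p hp => h w hw a ha p (hF hp)

theorem Fixes.add {L₁ L₂ : Language (Atom P)} {F : Set P} (h₁ : Fixes L₁ F) (h₂ : Fixes L₂ F) :
    Fixes (L₁ + L₂) F := by
  rintro w (hw | hw)
  exacts [h₁ w hw, h₂ w hw]

theorem Fixes.mul {L₁ L₂ : Language (Atom P)} {F : Set P} (h₁ : Fixes L₁ F) (h₂ : Fixes L₂ F) :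
    Fixes (L₁ * L₂) F := by
  rintro w hw a ha
  obtain ⟨u, hu, v, hv, rfl⟩ := Language.mem_mul.1 hw
  rcases List.mem_append.1 ha with ha | ha
  exacts [h₁ u hu a ha, h₂ v hv a ha]

open Computability in
theorem Fixes.kstar {L : Language (Atom P)} {F : Set P} (h : Fixes L F) : Fixes (L∗) F := by
  rintro w hw a ha
  obtain ⟨A, rfl, hA⟩ := Language.mem_kstar.1 hw
  obtain ⟨u, hu, ha⟩ := List.mem_flatten.1 ha
  exact h u (hA u hu) a ha

theorem fixes_letters {A : Set (Atom P)} {F : Set P} (h : ∀ a ∈ A, ∀ p ∈ F, a.2 p = .jump p) :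
    Fixes (Language.letters A) F := by
  rintro _ ⟨a, ha, rfl⟩ b hb
  obtain rfl := List.mem_singleton.1 hb
  exact h _ ha

/-- Put each pebble `p` on the old position of pebble `σ p`. -/
def assign (σ : P → P) : Language (Atom P) := Language.letters {(fun _ => True, fun p => .jump (σ p))}

theorem sem_assign {σ : P → P} {x y : P → U} : Sem H (assign σ) x y ↔ y = x ∘ σ := by
  rw [assign, sem_letters]
  constructor
  · rintro ⟨_, rfl, -, rfl⟩
    rfl
  · rintro rfl
    exact ⟨_, rfl, trivial, rfl⟩

theorem fixes_assign {σ : P → P} {F : Set P} (h : ∀ p ∈ F, σ p = p) : Fixes (assign σ) F :=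
  fixes_letters (by rintro _ rfl p hp; exact congrArg _ (h p hp))

/-- Test the incidence relation. -/
def test (g : Setoid P → Prop) : Language (Atom P) := Language.letters {(g, fun p => .jump p)}

theorem sem_test {g : Setoid P → Prop} {x y : P → U} :
    Sem H (test g) x y ↔ g (Setoid.ker x) ∧ y = x := by
  rw [test, sem_letters]
  constructor
  · rintro ⟨_, rfl, h, rfl⟩
    exact ⟨h, rfl⟩
  · rintro ⟨h, rfl⟩
    exact ⟨_, rfl, h, rfl⟩

theorem fixes_test {g : Setoid P → Prop} {F : Set P} : Fixes (test g) F :=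
  fixes_letters (by rintro _ rfl p hp; rfl)

open Classical in
/-- Move the single pebble `p` along the edge labelled `i`. -/
noncomputable def moveOne (p : P) (i : Fin 2) : Atom P :=
  (fun _ => True, Function.update (fun q => .jump q) p (.move i))

theorem step_moveOne [DecidableEq P] (p : P) (i : Fin 2) (x : P → U) :
    step H (moveOne p i) x = Function.update x p (H.edge (x p) i) := by
  funext q
  by_cases h : q = p
  · subst h
    simp [step, moveOne, Move.apply]
  · simp [step, moveOne, Move.apply, h]

open Classical Computability in
/-- Put the pebbles in `N` on arbitrary positions reachable from pebble `b`. -/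
noncomputable def guess (b : P) (N : Set P) : Language (Atom P) :=
  assign (fun p => if p ∈ N then b else p) *
    (Language.letters {a | ∃ p ∈ N, ∃ i, a = moveOne p i})∗

theorem isRegular_guess (b : P) (N : Set P) : (guess b N).IsRegular :=
  (Language.isRegular_letters _).mul (Language.isRegular_letters _).kstar

theorem fixes_guess (b : P) (N : Set P) : Fixes (guess b N) Nᶜ := by
  refine (fixes_assign fun p hp => if_neg hp).mul (fixes_letters ?_).kstar
  rintro _ ⟨p, hp, i, rfl⟩ q hq
  have : q ≠ p := by rintro rfl; exact hq hp
  simp [moveOne, this]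

theorem reflTransGen_moves_walk [DecidableEq P] {N : Set P} {p : P} (hp : p ∈ N) (w : List (Fin 2)) (x : P → U) :
    Relation.ReflTransGen (Sem H (Language.letters {a | ∃ p ∈ N, ∃ i, a = moveOne p i})) x
      (Function.update x p (H.walk (x p) w)) := by
  induction w generalizing x with
  | nil => simp [LabelledGraph.walk, Relation.ReflTransGen.refl]
  | cons i w ih =>
    have h := ih (Function.update x p (H.edge (x p) i))
    rw [Function.update_self, Function.update_idem] at h
    refine .head ?_ h
    rw [sem_letters]
    exact ⟨_, ⟨p, hp, i, rfl⟩, trivial, (step_moveOne p i x).symm⟩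

/-- This direction says that every placement can be guessed. For the soundness of programs
`fixes_guess` is enough, since guessed positions are verified afterwards. -/
theorem sem_guess [Finite P] {b : P} {N : Set P} {x y : P → U}
    (hx : ∀ u, H.Reachable (x b) u) (hy : ∀ p ∉ N, y p = x p) : Sem H (guess b N) x y := by
  classical
  rw [guess, sem_mul]
  set z : P → U := x ∘ fun p => if p ∈ N then b else p with hz
  refine ⟨z, sem_assign.2 rfl, (sem_kstar H).2 ?_⟩
  -- The pebbles of `N` walk to their destinations one after the other.
  have key : ∀ S : Set P, S.Finite → S ⊆ N → Relation.ReflTransGen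
      (Sem H (Language.letters {a | ∃ p ∈ N, ∃ i, a = moveOne p i})) z
      (fun p => if p ∈ S then y p else z p) := by
    intro S hS
    induction S, hS using Set.Finite.induction_on with
    | empty =>
      intro _
      simpa using Relation.ReflTransGen.refl
    | @insert p S hp _ ih =>
      intro hSN
      have hpN : p ∈ N := hSN (Set.mem_insert _ _)
      refine (ih fun q hq => hSN (Set.mem_insert_of_mem _ hq)).trans ?_
      obtain ⟨w, hw⟩ := hx (y p)
      have h := reflTransGen_moves_walk (H := H) hpN w (fun p => if p ∈ S then y p else z p)
      convert h using 1
      funext q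
      by_cases hq : q = p
      · subst hq
        simp [hp, hz, hpN, hw]
      · simp [hq]
  have := key N N.toFinite subset_rfl
  convert this using 1
  funext p
  by_cases hp : p ∈ N
  · simp [hp]
  · simp [hp, hz, hy]

end Atom

open Atom

/-! ### Recognisable relations -/

universe u

variable {J : Type u} {U : J → Type} (H : ∀ j, LabelledGraph (U j) 2)

/-- The relation `R` on tuples in `D` is recognised, uniformly in `j`, by a program with further
pebbles `T`, whose initial positions do not matter. -/
def Recog {β : Type} (D R : ∀ j, (β → U j) → Prop) : Prop :=
  ∃ (T : Type) (_ : Finite T) (L : Language (Atom (β ⊕ T))), L.IsRegular ∧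
    Fixes L (Set.range Sum.inl) ∧
    ∀ j (x : β ⊕ T → U j), D j (x ∘ Sum.inl) →
      (R j (x ∘ Sum.inl) ↔ ∃ y, Sem (H j) L x y)

namespace Recog

variable {H} {β γ κ : Type} {D R R₁ R₂ : ∀ j, (β → U j) → Prop}

/-- The program as a subroutine in a larger set of pebbles: `f` may pass the same pebble for several
arguments, whereas the auxiliary pebbles must be distinct and different from the arguments. -/
theorem exists_embed (h : Recog H D R) : ∃ (T : Type) (_ : Finite T),
    ∀ {P : Type} (f : β → P) (g : T → P), g.Injective → (∀ b t, f b ≠ g t) →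
      ∃ L : Language (Atom P), L.IsRegular ∧ Fixes L (Set.range g)ᶜ ∧
        ∀ j (x : P → U j), D j (x ∘ f) → (R j (x ∘ f) ↔ ∃ y, Sem (H j) L x y) := by
  obtain ⟨T, hT, L, hL, hF, h⟩ := h
  refine ⟨T, hT, fun {P} f g hg hfg => ?_⟩
  set e : β ⊕ T → P := Sum.elim f g
  set M : Set (β ⊕ T) := Set.range Sum.inr
  have hM : ∀ q ∈ M, ∀ q', e q' = e q → q' = q := by
    rintro _ ⟨t, rfl⟩ (b | t') h
    · exact (hfg b t h).elim
    · exact congrArg _ (hg h)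
  have hw : ∀ w ∈ L, ∀ a ∈ w, ∀ q ∉ M, a.2 q = .jump q := by
    rintro w hw a ha (b | t) hq
    · exact hF w hw a ha _ ⟨b, rfl⟩
    · exact (hq ⟨t, rfl⟩).elim
  refine ⟨Language.map (relabel e M) L, hL.map _, ?_, fun j x hx => ?_⟩
  · rintro _ ⟨w, hw, rfl⟩ a ha p hp
    obtain ⟨a, ha, rfl⟩ := List.mem_map.1 ha
    refine dif_neg ?_
    rintro ⟨_, ⟨t, rfl⟩, h⟩
    exact hp ⟨t, h⟩
  · rw [show x ∘ f = (x ∘ e) ∘ Sum.inl from rfl, h j (x ∘ e) hx]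
    constructor
    · rintro ⟨_, w, hwL, hok, rfl⟩
      exact ⟨_, _, ⟨w, hwL, rfl⟩, (ok_relabel hM (hw w hwL) x).2 hok, rfl⟩
    · rintro ⟨_, _, ⟨w, hwL, rfl⟩, hok, rfl⟩
      exact ⟨_, w, hwL, (ok_relabel hM (hw w hwL) x).1 hok, rfl⟩

theorem congr (h : Recog H D R₁) (e : ∀ j x, D j x → (R₂ j x ↔ R₁ j x)) : Recog H D R₂ := by
  obtain ⟨T, hT, L, hL, hF, h⟩ := h
  exact ⟨T, hT, L, hL, hF, fun j x hx => (e j _ hx).trans (h j x hx)⟩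

theorem mono {D' : ∀ j, (β → U j) → Prop} (h : Recog H D R) (hD : ∀ j x, D' j x → D j x) :
    Recog H D' R := by
  obtain ⟨T, hT, L, hL, hF, h⟩ := h
  exact ⟨T, hT, L, hL, hF, fun j x hx => h j x (hD j _ hx)⟩

/-- The first program leaves the arguments in place and has its own auxiliary pebbles, so the second
one can run after it. The second one needs to be correct only where `R₁` holds, because otherwise no
run gets that far. -/
theorem and_of (h₁ : Recog H D R₁) (h₂ : Recog H (fun j x => D j x ∧ R₁ j x) R₂) :
    Recog H D (fun j x => R₁ j x ∧ R₂ j x) := by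
  obtain ⟨T₁, _, h₁⟩ := h₁.exists_embed
  obtain ⟨T₂, _, h₂⟩ := h₂.exists_embed
  obtain ⟨L₁, r₁, f₁, h₁⟩ := h₁ (P := β ⊕ (T₁ ⊕ T₂)) Sum.inl (Sum.inr ∘ Sum.inl)
    (Sum.inr_injective.comp Sum.inl_injective) (by simp)
  obtain ⟨L₂, r₂, f₂, h₂⟩ := h₂ (P := β ⊕ (T₁ ⊕ T₂)) Sum.inl (Sum.inr ∘ Sum.inr)
    (Sum.inr_injective.comp Sum.inr_injective) (by simp)
  refine ⟨T₁ ⊕ T₂, inferInstance, L₁ * L₂, r₁.mul r₂, (f₁.mono ?_).mul (f₂.mono ?_), ?_⟩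
  · rintro _ ⟨b, rfl⟩
    simp
  · rintro _ ⟨b, rfl⟩
    simp
  · intro j x hx
    have key : ∀ z, Sem (H j) L₁ x z → z ∘ Sum.inl = x ∘ Sum.inl := fun z hz => by
      funext b
      exact f₁.sem hz (p := Sum.inl b) (by simp)
    simp only [sem_mul]
    constructor
    · rintro ⟨hR, h⟩
      obtain ⟨z, hz⟩ := (h₁ j x hx).1 hR
      rw [← key z hz] at h hx hR
      obtain ⟨y, hy⟩ := (h₂ j z ⟨hx, hR⟩).1 h
      exact ⟨y, z, hz, hy⟩
    · rintro ⟨y, z, hz, hy⟩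
      have hR := (h₁ j x hx).2 ⟨z, hz⟩
      refine ⟨hR, ?_⟩
      rw [← key z hz] at hx hR ⊢
      exact (h₂ j z ⟨hx, hR⟩).2 ⟨y, hy⟩

theorem and (h₁ : Recog H D R₁) (h₂ : Recog H D R₂) :
    Recog H D (fun j x => R₁ j x ∧ R₂ j x) := h₁.and_of (h₂.mono fun _ _ h => h.1)

theorem or (h₁ : Recog H D R₁) (h₂ : Recog H D R₂) :
    Recog H D (fun j x => R₁ j x ∨ R₂ j x) := by
  obtain ⟨T₁, _, h₁⟩ := h₁.exists_embed
  obtain ⟨T₂, _, h₂⟩ := h₂.exists_embed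
  obtain ⟨L₁, r₁, f₁, h₁⟩ := h₁ (P := β ⊕ (T₁ ⊕ T₂)) Sum.inl (Sum.inr ∘ Sum.inl)
    (Sum.inr_injective.comp Sum.inl_injective) (by simp)
  obtain ⟨L₂, r₂, f₂, h₂⟩ := h₂ (P := β ⊕ (T₁ ⊕ T₂)) Sum.inl (Sum.inr ∘ Sum.inr)
    (Sum.inr_injective.comp Sum.inr_injective) (by simp)
  refine ⟨T₁ ⊕ T₂, inferInstance, L₁ + L₂, r₁.add r₂, (f₁.mono ?_).add (f₂.mono ?_), ?_⟩
  · rintro _ ⟨b, rfl⟩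
    simp
  · rintro _ ⟨b, rfl⟩
    simp
  · intro j x hx
    simp only [sem_add, exists_or, h₁ j x hx, h₂ j x hx]

/-- Coincidences can be tested negatively as well as positively. For other relations negation is not
available in general. -/
theorem guard (g : Setoid β → Prop) : Recog H D (fun _ x => g (Setoid.ker x)) := by
  refine ⟨Empty, inferInstance, test fun π => g (π.comap Sum.inl), Language.isRegular_letters _,
    fixes_test, fun j x _ => ?_⟩
  simp only [sem_test, exists_and_left, exists_eq, and_true]
  rfl

theorem eq (a b : β) : Recog H D (fun _ x => x a = x b) := guard fun π => π a b

theorem ne (a b : β) : Recog H D (fun _ x => x a ≠ x b) := guard fun π => ¬π a b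

theorem const (p : Prop) : Recog H D (fun _ _ => p) := guard fun _ => p

theorem rename {D' : ∀ j, (γ → U j) → Prop} (h : Recog H D R) (f : β → γ)
    (hD : ∀ j x, D' j x → D j (x ∘ f)) : Recog H D' (fun j x => R j (x ∘ f)) := by
  obtain ⟨T, _, h⟩ := h.exists_embed
  obtain ⟨L, r, F, h⟩ := h (P := γ ⊕ T) (Sum.inl ∘ f) Sum.inr Sum.inr_injective (by simp)
  refine ⟨T, inferInstance, L, r, F.mono ?_, fun j x hx => h j x (hD j _ hx)⟩
  rintro _ ⟨b, rfl⟩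
  simp

theorem edge (i : Fin 2) (a b : β) : Recog H D (fun j x => (H j).edge (x a) i = x b) := by
  classical
  refine ⟨Unit, inferInstance, assign (fun p => if p = .inr () then .inl a else p) *
    (Language.letters {moveOne (.inr ()) i} * test fun π => π (.inr ()) (.inl b)),
    (Language.isRegular_letters _).mul ((Language.isRegular_letters _).mul
      (Language.isRegular_letters _)), (fixes_assign ?_).mul ((fixes_letters ?_).mul fixes_test),
    fun j x _ => ?_⟩
  · rintro _ ⟨c, rfl⟩
    simp
  · rintro _ rfl _ ⟨c, rfl⟩
    simp [moveOne]
  · simp only [sem_mul, sem_assign, exists_eq_left, sem_letters, Set.mem_singleton_iff, sem_test,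
      step_moveOne]
    simp [moveOne, Setoid.ker_def]

/-- The witnesses are guessed and then checked. By `hb` every position can be guessed, so the
quantifier is unrestricted. -/
theorem ex [Finite β] [Finite κ] {R : ∀ j, (β → U j) → (κ → U j) → Prop} (b : β)
    (hb : ∀ j x, D j x → ∀ u, (H j).Reachable (x b) u)
    (h : Recog H (fun j (x : β ⊕ κ → U j) => D j (x ∘ Sum.inl))
      (fun j x => R j (x ∘ Sum.inl) (x ∘ Sum.inr))) :
    Recog H D (fun j x => ∃ y, R j x y) := by
  obtain ⟨T, _, h⟩ := h.exists_embed
  obtain ⟨L, r, F, h⟩ := h (P := β ⊕ (κ ⊕ T)) (Sum.elim Sum.inl (Sum.inr ∘ Sum.inl))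
    (Sum.inr ∘ Sum.inr) (Sum.inr_injective.comp Sum.inr_injective) (by simp)
  refine ⟨κ ⊕ T, inferInstance, guess (Sum.inl b) (Set.range (Sum.inr ∘ Sum.inl)) * L,
    (isRegular_guess _ _).mul r, ((fixes_guess _ _).mono ?_).mul (F.mono ?_), fun j x hx => ?_⟩
  · rintro _ ⟨c, rfl⟩
    simp
  · rintro _ ⟨c, rfl⟩
    simp
  simp only [sem_mul]
  constructor
  · rintro ⟨y, hy⟩
    have hs : Sem (H j) (guess (Sum.inl b) (Set.range (Sum.inr ∘ Sum.inl))) x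
        (Sum.elim (x ∘ Sum.inl) (Sum.elim y (x ∘ Sum.inr ∘ Sum.inr))) := by
      refine sem_guess (hb j _ hx) ?_
      rintro (c | c | c) hc
      · rfl
      · simp at hc
      · rfl
    obtain ⟨z, hz⟩ := (h j (Sum.elim (x ∘ Sum.inl) (Sum.elim y (x ∘ Sum.inr ∘ Sum.inr))) hx).1 hy
    exact ⟨z, _, hs, hz⟩
  · rintro ⟨y, z, hz, hy⟩
    have hzx : z ∘ Sum.inl = x ∘ Sum.inl := by
      funext c
      exact (fixes_guess _ _).sem hz (p := Sum.inl c) (by simp)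
    have hR := (h j z (by
      rw [← hzx] at hx
      exact hx)).2 ⟨y, hy⟩
    refine ⟨z ∘ Sum.inr ∘ Sum.inl, ?_⟩
    rw [← hzx]
    exact hR

-- The pebbles `cur` mark the current tuple and `new` a guess for the next one; the subroutine
-- checks `R`, and then `cur` jumps to `new`. Two copies of the tuple suffice for paths of any
-- length, as the subroutine may start with its auxiliary pebbles anywhere.
open Computability in
theorem tc [Finite β] [Finite κ] {R : ∀ j, (β → U j) → (κ → U j) → (κ → U j) → Prop} (b : β)
    (hb : ∀ j x, D j x → ∀ u, (H j).Reachable (x b) u)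
    (h : Recog H (fun j (x : β ⊕ (κ ⊕ κ) → U j) => D j (x ∘ Sum.inl))
      (fun j x => R j (x ∘ Sum.inl) (x ∘ Sum.inr ∘ Sum.inl) (x ∘ Sum.inr ∘ Sum.inr)))
    (f g : κ → β) :
    Recog H D (fun j x => Relation.ReflTransGen (R j x) (x ∘ f) (x ∘ g)) := by
  obtain ⟨T, _, h⟩ := h.exists_embed
  obtain ⟨L, r, F, h⟩ := h (P := β ⊕ ((κ ⊕ κ) ⊕ T)) (Sum.elim Sum.inl (Sum.inr ∘ Sum.inl))
    (Sum.inr ∘ Sum.inr) (Sum.inr_injective.comp Sum.inr_injective) (by simp)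
  let P := β ⊕ ((κ ⊕ κ) ⊕ T)
  let cur : κ → P := fun k => .inr (.inl (.inl k))
  let new : κ → P := fun k => .inr (.inl (.inr k))
  let init : P → P := Sum.elim .inl (Sum.elim (Sum.elim (Sum.inl ∘ f) new) (Sum.inr ∘ Sum.inr))
  let commit : P → P := Sum.elim .inl (Sum.elim (Sum.elim new new) (Sum.inr ∘ Sum.inr))
  set body := guess (Sum.inl b) (Set.range new) * (L * assign commit) with hbody
  have fguess : Fixes (guess (Sum.inl b) (Set.range new)) (Set.range Sum.inl) :=
    (fixes_guess _ _).mono (by rintro _ ⟨c, rfl⟩; simp [new])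
  have fL : Fixes L (Set.range Sum.inl) := F.mono (by rintro _ ⟨c, rfl⟩; simp)
  have fcommit : Fixes (assign commit) (Set.range Sum.inl) :=
    fixes_assign (by rintro _ ⟨c, rfl⟩; rfl)
  have fbody : Fixes body (Set.range Sum.inl) := fguess.mul (fL.mul fcommit)
  refine ⟨(κ ⊕ κ) ⊕ T, inferInstance, assign init * (body∗ * test fun π => ∀ k, π (cur k) (.inl (g k))),
    (Language.isRegular_letters _).mul (((isRegular_guess _ _).mul (r.mul
      (Language.isRegular_letters _))).kstar.mul (Language.isRegular_letters _)),
    (fixes_assign (by rintro _ ⟨c, rfl⟩; rfl)).mul (fbody.kstar.mul fixes_test), fun j x hx => ?_⟩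
  -- Soundness of one round: if it succeeds, the old and new positions of `cur` are related.
  have hbs : ∀ z z' : P → U j, z ∘ Sum.inl = x ∘ Sum.inl → Sem (H j) body z z' →
      z' ∘ Sum.inl = x ∘ Sum.inl ∧ R j (x ∘ Sum.inl) (z ∘ cur) (z' ∘ cur) := by
    intro z z' hz hs
    have hz' : z' ∘ Sum.inl = x ∘ Sum.inl := by
      rw [← hz]
      funext c
      exact fbody.sem hs (p := Sum.inl c) ⟨c, rfl⟩
    refine ⟨hz', ?_⟩
    rw [hbody, sem_mul] at hs
    obtain ⟨y, hy, hs⟩ := hs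
    rw [sem_mul] at hs
    obtain ⟨y', hy', hs⟩ := hs
    rw [sem_assign] at hs
    have e₁ : y ∘ Sum.inl = x ∘ Sum.inl := by
      rw [← hz]
      funext c
      exact fguess.sem hy (p := Sum.inl c) ⟨c, rfl⟩
    have e₂ : y ∘ cur = z ∘ cur := by
      funext c
      exact (fixes_guess _ _).sem hy (p := cur c) (by simp [new, cur])
    have e₃ : z' ∘ cur = y ∘ new := by
      rw [hs]
      funext c
      exact F.sem hy' (p := new c) (by simp [new])
    have := (h j y (by
      rw [← e₁] at hx
      exact hx)).2 ⟨y', hy'⟩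
    rw [← e₁, ← e₂, e₃]
    exact this
  -- Completeness of one round: each related tuple can be guessed, verified and committed.
  have hbc : ∀ (z : P → U j) (v : κ → U j), z ∘ Sum.inl = x ∘ Sum.inl →
      R j (x ∘ Sum.inl) (z ∘ cur) v →
      ∃ z', Sem (H j) body z z' ∧ z' ∘ Sum.inl = x ∘ Sum.inl ∧ z' ∘ cur = v := by
    intro z v hz hR
    let y : P → U j := Sum.elim (x ∘ Sum.inl) (Sum.elim (Sum.elim (z ∘ cur) v)
      (z ∘ Sum.inr ∘ Sum.inr))
    have hy : Sem (H j) (guess (Sum.inl b) (Set.range new)) z y := by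
      refine sem_guess ?_ ?_
      · rw [show z (Sum.inl b) = x (Sum.inl b) from congrFun hz b]
        exact hb j _ hx
      · rintro (c | (c | c) | c) hc
        · exact (congrFun hz c).symm
        · rfl
        · simp [new] at hc
        · rfl
    obtain ⟨y', hy'⟩ := (h j y hx).1 hR
    have hs : Sem (H j) body z (y' ∘ commit) := by
      rw [hbody, sem_mul]
      refine ⟨y, hy, ?_⟩
      rw [sem_mul]
      exact ⟨y', hy', sem_assign.2 rfl⟩
    refine ⟨_, hs, (hbs z _ hz hs).1, ?_⟩
    funext c
    exact F.sem hy' (p := new c) (by simp [new])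
  simp only [sem_mul, sem_assign, exists_eq_left, sem_test, sem_kstar]
  constructor
  · intro hR
    have : ∀ v, Relation.ReflTransGen (R j (x ∘ Sum.inl)) ((x ∘ Sum.inl) ∘ f) v →
        ∃ z, Relation.ReflTransGen (Sem (H j) body) (x ∘ init) z ∧
          z ∘ Sum.inl = x ∘ Sum.inl ∧ z ∘ cur = v := by
      intro v hv
      induction hv with
      | refl => exact ⟨_, .refl, rfl, rfl⟩
      | tail _ hR ih =>
        obtain ⟨z, h₁, h₂, rfl⟩ := ih
        obtain ⟨z', h₃, h₄⟩ := hbc z _ h₂ hR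
        exact ⟨z', h₁.tail h₃, h₄⟩
    obtain ⟨z, h₁, h₂, h₃⟩ := this _ hR
    refine ⟨z, z, h₁, fun k => ?_, rfl⟩
    have := congrFun h₃ k
    rw [← h₂] at this
    exact this
  · rintro ⟨y, z, hz, ht, rfl⟩
    have : y ∘ Sum.inl = x ∘ Sum.inl ∧
        Relation.ReflTransGen (R j (x ∘ Sum.inl)) ((x ∘ Sum.inl) ∘ f) (y ∘ cur) := by
      clear ht
      induction hz with
      | refl => exact ⟨rfl, .refl⟩
      | tail _ hs ih =>
        obtain ⟨h₁, h₂⟩ := hbs _ _ ih.1 hs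
        exact ⟨h₁, ih.2.tail h₂⟩
    have e : y ∘ cur = (x ∘ Sum.inl) ∘ g := by
      rw [← this.1]
      funext k
      exact ht k
    rw [← e]
    exact this.2

theorem exists_finite {ι : Type} [Finite ι] {R : ι → ∀ j, (β → U j) → Prop}
    (h : ∀ i, Recog H D (R i)) : Recog H D (fun j x => ∃ i, R i j x) := by
  have key : ∀ S : Set ι, S.Finite → Recog H D (fun j x => ∃ i ∈ S, R i j x) := by
    intro S hS
    induction S, hS using Set.Finite.induction_on with
    | empty => exact (const False).congr (by simp)
    | @insert i S _ _ ih => exact ((h i).or ih).congr (by simp)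
  exact (key Set.univ Set.finite_univ).congr (by simp)

end Recog

end NDJag

namespace NDJag

/-! ### Relations on grids that can be recognised -/

/-- The parameters of a grid graph. -/
structure GridIx where
  d : ℕ
  ℓ : ℕ
  [d_ne : NeZero d]
  [ℓ_ne : NeZero ℓ]

attribute [instance] GridIx.d_ne GridIx.ℓ_ne

/-- The positions of pebbles on a grid graph, written additively: a node and a label. -/
abbrev GridIx.Pos (g : GridIx) : Type := (Fin g.d → ZMod g.ℓ) × Fin g.d

/-- The graph on which the pebbles travel. -/
def gridEdges (g : GridIx) : LabelledGraph g.Pos 2 where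
  edge e a := if a = 0 then (e.1, e.2 + 1) else (e.1 + Pi.single e.2 1, 0)

theorem gridEdges_zero (g : GridIx) (e : g.Pos) : (gridEdges g).edge e 0 = (e.1, e.2 + 1) := rfl

theorem gridEdges_one (g : GridIx) (e : g.Pos) :
    (gridEdges g).edge e 1 = (e.1 + Pi.single e.2 1, 0) := rfl

namespace LabelledGraph

variable {V : Type} {d : ℕ} {G : LabelledGraph V d}

theorem walk_append (v : V) (w w' : List (Fin d)) :
    G.walk v (w ++ w') = G.walk (G.walk v w) w' := List.foldl_append ..

theorem Reachable.refl (v : V) : G.Reachable v v := ⟨[], rfl⟩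

theorem Reachable.trans {u v w : V} (h₁ : G.Reachable u v) (h₂ : G.Reachable v w) :
    G.Reachable u w := by
  obtain ⟨a, rfl⟩ := h₁
  obtain ⟨b, rfl⟩ := h₂
  exact ⟨a ++ b, walk_append ..⟩

theorem Reachable.edge {u v : V} (h₁ : G.Reachable u v) (i : Fin d) :
    G.Reachable u (G.edge v i) := h₁.trans ⟨[i], rfl⟩

end LabelledGraph

theorem Fin.add_one_cases {d : ℕ} [NeZero d] (i : Fin d) :
    (i + 1 = 0 ∧ i.val + 1 = d) ∨ (i + 1 ≠ 0 ∧ (i + 1).val = i.val + 1 ∧ i.val + 1 < d) := by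
  have h : (i + 1).val = (i.val + 1) % d := by
    obtain ⟨n, rfl⟩ := Nat.exists_eq_succ_of_ne_zero (NeZero.ne d)
    rw [Fin.val_add, Fin.val_one', Nat.add_mod_mod]
  rcases (Nat.succ_le_of_lt i.isLt).lt_or_eq with hlt | heq
  · right
    rw [Nat.mod_eq_of_lt hlt] at h
    exact ⟨fun h0 => by simp [h0] at h, h, hlt⟩
  · left
    refine ⟨Fin.ext ?_, heq⟩
    rw [h, show i.val + 1 = d from heq]
    simp

theorem Fin.add_one_induction {d : ℕ} [NeZero d] {p : Fin d → Prop} (zero : p 0)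
    (succ : ∀ i, p i → i + 1 ≠ 0 → p (i + 1)) (i : Fin d) : p i := by
  obtain ⟨n, hn⟩ := i
  induction n with
  | zero => exact zero
  | succ n ih =>
    have hn' : n < d := by omega
    have h := ih hn'
    rcases Fin.add_one_cases (⟨n, hn'⟩ : Fin d) with ⟨-, h'⟩ | ⟨h₁, h₂, -⟩
    · exact absurd h' (by simp only; omega)
    · have := succ _ h h₁
      convert this
      exact h₂.symm

variable {g : GridIx}

theorem reachable_label (v : Fin g.d → ZMod g.ℓ) (i j : Fin g.d) :
    (gridEdges g).Reachable (v, i) (v, j) := by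
  have key : ∀ j, (gridEdges g).Reachable (v, i) (v, i + j) := fun j => by
    induction j using Fin.add_one_induction with
    | zero => simpa using LabelledGraph.Reachable.refl _
    | succ j h _ =>
      have := h.edge 0
      rwa [gridEdges_zero, add_assoc] at this
  simpa using key (j - i)

theorem pi_induction {d ℓ : ℕ} [NeZero ℓ] {p : (Fin d → ZMod ℓ) → Prop} (zero : p 0)
    (add : ∀ v i, p v → p (v + Pi.single i 1)) (v : Fin d → ZMod ℓ) : p v := by
  have key : ∀ (i : Fin d) (n : ℕ) v, p v → p (v + Pi.single i (n : ZMod ℓ)) := by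
    intro i n v hv
    induction n with
    | zero => simpa using hv
    | succ n ih =>
      rw [Nat.cast_succ, Pi.single_add, ← add_assoc]
      exact add _ _ ih
  have : ∀ S : Finset (Fin d), p (∑ i ∈ S, Pi.single i (v i)) := by
    intro S
    induction S using Finset.induction_on with
    | empty => simpa using zero
    | insert i S hi ih =>
      rw [Finset.sum_insert hi, add_comm]
      have := key i (v i).val _ ih
      rwa [ZMod.natCast_zmod_val] at this
  have h := this Finset.univ
  rwa [Finset.univ_sum_single] at h

theorem reachable_gridEdges (u : g.Pos) : (gridEdges g).Reachable (0, 0) u := by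
  obtain ⟨v, i⟩ := u
  refine LabelledGraph.Reachable.trans ?_ (reachable_label v 0 i)
  refine pi_induction (p := fun v => (gridEdges g).Reachable (0, 0) (v, 0)) (.refl _) ?_ v
  intro v i h
  have := (h.trans (reachable_label v 0 i)).edge 1
  rwa [gridEdges_one] at this

/-- The relation `R` on positions is recognised, uniformly in the grid, by programs that have one
additional pebble on the first edge out of the start node. -/
def Def {α : Type} (R : ∀ g : GridIx, (α → g.Pos) → Prop) : Prop :=
  Recog gridEdges (β := Option α) (fun _ y => y none = (0, 0)) (fun g x => R g (x ∘ some))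

theorem reflTransGen_equiv {α β : Type} (e : α ≃ β) {R : β → β → Prop} {a b : α} :
    Relation.ReflTransGen (fun a b => R (e a) (e b)) a b ↔ Relation.ReflTransGen R (e a) (e b) := by
  constructor
  · exact fun h => h.lift e fun _ _ h => h
  · intro h
    have := h.lift (p := fun a b => R (e a) (e b)) e.symm fun _ _ h => by
      simpa [Function.onFun] using h
    simpa [Function.onFun] using this

namespace Def

variable {α β κ : Type} {R R₁ R₂ : ∀ g : GridIx, (α → g.Pos) → Prop}

theorem congr (h : Def R₁) (e : ∀ g x, R₂ g x ↔ R₁ g x) : Def R₂ :=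
  Recog.congr h fun g _ _ => e g _

theorem and (h₁ : Def R₁) (h₂ : Def R₂) : Def fun g x => R₁ g x ∧ R₂ g x := Recog.and h₁ h₂

theorem or (h₁ : Def R₁) (h₂ : Def R₂) : Def fun g x => R₁ g x ∨ R₂ g x := Recog.or h₁ h₂

theorem const (p : Prop) : Def (α := α) fun _ _ => p := Recog.const p

theorem eq (a b : α) : Def fun _ x => x a = x b := Recog.eq (some a) (some b)

theorem ne (a b : α) : Def fun _ x => x a ≠ x b := Recog.ne (some a) (some b)

theorem eq_base (a : α) : Def fun _ x => x a = (0, 0) :=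
  (Recog.eq (some a) none).congr fun _ x hx => by rw [show x none = _ from hx]; rfl

theorem ne_base (a : α) : Def fun _ x => x a ≠ (0, 0) :=
  (Recog.ne (some a) none).congr fun _ x hx => by rw [show x none = _ from hx]; rfl

theorem next (a b : α) : Def fun _ x => ((x a).1, (x a).2 + 1) = x b :=
  Recog.edge 0 (some a) (some b)

theorem first (a b : α) : Def fun _ x => ((x a).1 + Pi.single (x a).2 1, 0) = x b :=
  Recog.edge 1 (some a) (some b)

theorem rename (h : Def R) (f : α → β) : Def fun g x => R g (x ∘ f) :=
  Recog.rename (γ := Option β) h (Option.map f) fun _ _ hx => hx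

theorem exists_finite {ι : Type} [Finite ι] {R : ι → ∀ g : GridIx, (α → g.Pos) → Prop}
    (h : ∀ i, Def (R i)) : Def fun g x => ∃ i, R i g x := Recog.exists_finite h

variable [Finite α] [Finite κ]

theorem exT {R : ∀ g : GridIx, (α → g.Pos) → (κ → g.Pos) → Prop}
    (h : Def fun g (z : α ⊕ κ → g.Pos) => R g (z ∘ Sum.inl) (z ∘ Sum.inr)) :
    Def fun g x => ∃ y, R g x y := by
  refine Recog.ex (β := Option α) (κ := κ) (R := fun g x y => R g (x ∘ some) y) none
    (fun g x hx u => by rw [hx]; exact reachable_gridEdges u) ?_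
  exact Recog.rename (γ := Option α ⊕ κ) h
    (fun o => o.elim (Sum.inl none) (Sum.map some id)) fun _ _ hx => hx

theorem tcT {R : ∀ g : GridIx, (α → g.Pos) → (κ → g.Pos) → (κ → g.Pos) → Prop}
    (h : Def fun g (z : α ⊕ (κ ⊕ κ) → g.Pos) =>
      R g (z ∘ Sum.inl) (z ∘ Sum.inr ∘ Sum.inl) (z ∘ Sum.inr ∘ Sum.inr)) (f f' : κ → α) :
    Def fun g x => Relation.ReflTransGen (R g x) (x ∘ f) (x ∘ f') := by
  refine Recog.tc (β := Option α) (κ := κ) (R := fun g x y => R g (x ∘ some) y) none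
    (fun g x hx u => by rw [hx]; exact reachable_gridEdges u) ?_ (some ∘ f) (some ∘ f')
  exact Recog.rename (γ := Option α ⊕ (κ ⊕ κ)) h
    (fun o => o.elim (Sum.inl none) (Sum.map some id)) fun _ _ hx => hx

theorem ex {R : ∀ g : GridIx, (α → g.Pos) → g.Pos → Prop}
    (h : Def fun g (z : Option α → g.Pos) => R g (fun a => z (some a)) (z none)) :
    Def fun g x => ∃ y, R g x y := by
  have := exT (κ := Unit) (R := fun g x y => R g x (y ()))
    (h.rename (β := α ⊕ Unit) fun o => o.elim (Sum.inr ()) Sum.inl)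
  exact this.congr fun g x => ⟨fun ⟨y, hy⟩ => ⟨fun _ => y, hy⟩, fun ⟨y, hy⟩ => ⟨y (), hy⟩⟩

theorem tc {R : ∀ g : GridIx, (α → g.Pos) → g.Pos → g.Pos → Prop}
    (h : Def fun g (z : Option (Option α) → g.Pos) =>
      R g (fun a => z (some (some a))) (z (some none)) (z none)) (a b : α) :
    Def fun g x => Relation.ReflTransGen (R g x) (x a) (x b) := by
  have := tcT (κ := Unit) (R := fun g x y y' => R g x (y ()) (y' ()))
    (h.rename (β := α ⊕ (Unit ⊕ Unit)) fun o =>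
      o.elim (Sum.inr (Sum.inr ())) fun o => o.elim (Sum.inr (Sum.inl ())) Sum.inl)
    (fun _ => a) (fun _ => b)
  exact this.congr fun g x =>
    (reflTransGen_equiv (Equiv.funUnique Unit g.Pos) (R := R g x)
      (a := fun _ => x a) (b := fun _ => x b)).symm

theorem tc₂ {R : ∀ g : GridIx, (α → g.Pos) → g.Pos × g.Pos → g.Pos × g.Pos → Prop}
    (h : Def fun g (z : Option (Option (Option (Option α))) → g.Pos) =>
      R g (fun a => z (some (some (some (some a))))) (z (some (some (some none))),
        z (some (some none))) (z (some none), z none)) (a b a' b' : α) :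
    Def fun g x => Relation.ReflTransGen (R g x) (x a, x b) (x a', x b') := by
  have := tcT (κ := Fin 2) (R := fun g x y y' => R g x (y 0, y 1) (y' 0, y' 1))
    (h.rename (β := α ⊕ (Fin 2 ⊕ Fin 2)) fun o =>
      o.elim (Sum.inr (Sum.inr 1)) fun o => o.elim (Sum.inr (Sum.inr 0)) fun o =>
        o.elim (Sum.inr (Sum.inl 1)) fun o => o.elim (Sum.inr (Sum.inl 0)) Sum.inl)
    ![a, b] ![a', b']
  exact this.congr fun g x =>
    (reflTransGen_equiv (finTwoArrowEquiv g.Pos) (R := R g x)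
      (a := x ∘ ![a, b]) (b := x ∘ ![a', b'])).symm

end Def

/-! ### Labels, nodes and moves on grids -/

namespace Def

variable {α : Type} [Finite α]

/-- The label `0` is what a `first` move produces, and in a group each node has a predecessor along
the generator `0`. -/
theorem lab_zero (a : α) : Def fun _ x => (x a).2 = 0 := by
  have : Def fun g (x : α → g.Pos) => ∃ y : g.Pos, (y.1 + Pi.single y.2 1, 0) = x a :=
    ex (first _ _)
  refine this.congr fun g x => ⟨fun h => ⟨((x a).1 - Pi.single 0 1, 0), ?_⟩, ?_⟩
  · ext <;> simp [h]
  · rintro ⟨y, h⟩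
    rw [← h]

theorem same_node (a b : α) : Def fun _ x => (x a).1 = (x b).1 := by
  have : Def fun g (x : α → g.Pos) => Relation.ReflTransGen
      (fun y z : g.Pos => (y.1, y.2 + 1) = z) (x a) (x b) := tc (next _ _) _ _
  refine this.congr fun g x => ⟨fun h => ?_, fun h => ?_⟩
  · have key : ∀ (y : g.Pos) (j : Fin g.d), Relation.ReflTransGen
        (fun y z : g.Pos => (y.1, y.2 + 1) = z) y (y.1, y.2 + j) := by
      intro y j
      induction j using Fin.add_one_induction with
      | zero => simpa using .refl
      | succ j ih _ => exact ih.tail (by simp [add_assoc])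
    have := key (x a) ((x b).2 - (x a).2)
    rwa [show ((x a).1, (x a).2 + ((x b).2 - (x a).2)) = x b from
      Prod.ext h (add_sub_cancel _ _)] at this
  · have key : ∀ y z : g.Pos, Relation.ReflTransGen
        (fun y z : g.Pos => (y.1, y.2 + 1) = z) y z → y.1 = z.1 := by
      intro y z h
      induction h with
      | refl => rfl
      | tail _ h ih => rw [ih, ← h]
    exact key _ _ h

/-- Two pebbles run through the labels in parallel, both starting from label `0`. -/
theorem same_label (a b : α) : Def fun _ x => (x a).2 = (x b).2 := by
  have : Def fun g (x : α → g.Pos) => ∃ y z : g.Pos, y.2 = 0 ∧ z.2 = 0 ∧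
      Relation.ReflTransGen (fun p q : g.Pos × g.Pos =>
        (p.1.1, p.1.2 + 1) = q.1 ∧ (p.2.1, p.2.2 + 1) = q.2) (y, z) (x a, x b) :=
    ex (ex (.and (lab_zero _) (.and (lab_zero _) (tc₂ (.and (next _ _) (next _ _)) _ _ _ _))))
  refine this.congr fun g x => ⟨fun h => ⟨((x a).1, 0), ((x b).1, 0), rfl, rfl, ?_⟩, ?_⟩
  · have key : ∀ (u v : Fin g.d → ZMod g.ℓ) (j : Fin g.d), Relation.ReflTransGen
        (fun p q : g.Pos × g.Pos => (p.1.1, p.1.2 + 1) = q.1 ∧ (p.2.1, p.2.2 + 1) = q.2)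
        ((u, 0), (v, 0)) ((u, j), (v, j)) := by
      intro u v j
      induction j using Fin.add_one_induction with
      | zero => exact .refl
      | succ j ih _ => exact ih.tail (by simp)
    have := key (x a).1 (x b).1 (x a).2
    rwa [show ((x b).1, (x a).2) = x b from Prod.ext rfl h] at this
  · rintro ⟨y, z, hy, hz, h⟩
    have key : ∀ p : g.Pos × g.Pos, Relation.ReflTransGen (fun p q : g.Pos × g.Pos =>
        (p.1.1, p.1.2 + 1) = q.1 ∧ (p.2.1, p.2.2 + 1) = q.2) (y, z) p → p.1.2 = p.2.2 := by
      intro p hp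
      induction hp with
      | refl => rw [hy, hz]
      | tail _ h ih => rw [← h.1, ← h.2, ih]
    exact key _ h

/-- In place of a negation, the label is copied to the start node, where label `0` belongs to a
known position, and the two positions are tested for being different. -/
theorem lab_ne_zero (a : α) : Def fun _ x => (x a).2 ≠ 0 := by
  have : Def fun g (x : α → g.Pos) => ∃ y z : g.Pos, z = (0, 0) ∧ y.1 = z.1 ∧ y.2 = (x a).2 ∧
      y ≠ z := ex (ex (.and (eq_base _) (.and (same_node _ _) (.and (same_label _ _) (ne _ _)))))
  refine this.congr fun g x => ⟨fun h => ⟨(0, (x a).2), (0, 0), rfl, rfl, rfl, by simpa using h⟩, ?_⟩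
  rintro ⟨y, _, rfl, h₁, h₂, h₃⟩ h
  exact h₃ (Prod.ext h₁ (h₂.trans h))

/-- A `first` move loses the label; it is recovered by comparison with the old position. -/
theorem move (a b : α) : Def fun _ x => ((x a).1 + Pi.single (x a).2 1, (x a).2) = x b := by
  have : Def fun g (x : α → g.Pos) => ∃ z : g.Pos, ((x a).1 + Pi.single (x a).2 1, 0) = z ∧
      z.1 = (x b).1 ∧ (x a).2 = (x b).2 :=
    ex (.and (first _ _) (.and (same_node _ _) (same_label _ _)))
  refine this.congr fun g x => ?_
  rw [exists_eq_left', Prod.ext_iff]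

theorem advance (a b : α) :
    Def fun _ x => ((x a).1 + Pi.single (x a).2 1, (x a).2 + 1) = x b := by
  have : Def fun g (x : α → g.Pos) => ∃ z : g.Pos,
      ((x a).1 + Pi.single (x a).2 1, (x a).2) = z ∧ (z.1, z.2 + 1) = x b :=
    ex (.and (move _ _) (next _ _))
  exact this.congr fun g x => by rw [exists_eq_left']

end Def

end NDJag

namespace NDJag

/-! ### The lexicographic successor -/

/-- `v'` is the successor of `v` in the lexicographic order: one is added to the last entry that can
be increased, and to all later entries. -/
def NodeSucc {d ℓ : ℕ} (v v' : Fin d → ZMod ℓ) : Prop :=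
  ∃ j, (∀ k, v' k = v k + if j ≤ k then 1 else 0) ∧ (∀ k, j < k → v' k = 0) ∧ v' j ≠ 0

theorem lt_add_one_iff_of_ne_zero {d : ℕ} [NeZero d] {i k : Fin d} (hi : i + 1 ≠ 0) :
    k < i + 1 ↔ k ≤ i := by
  rcases Fin.add_one_cases i with ⟨h, -⟩ | ⟨-, h, -⟩
  · exact absurd h hi
  · rw [Fin.lt_def, Fin.le_def, h]
    omega

theorem add_one_le_iff_of_ne_zero {d : ℕ} [NeZero d] {i k : Fin d} (hi : i + 1 ≠ 0) :
    i + 1 ≤ k ↔ i < k := by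
  rw [← not_lt, lt_add_one_iff_of_ne_zero hi, not_le]

theorem le_of_add_one_eq_zero {d : ℕ} [NeZero d] {i k : Fin d} (hi : i + 1 = 0) : k ≤ i := by
  rcases Fin.add_one_cases i with ⟨-, h⟩ | ⟨h, -⟩
  · rw [Fin.le_def]
    omega
  · exact absurd hi h

namespace Def

variable {α : Type} [Finite α] {g : GridIx}

theorem reflTransGen_move_iff {x y : g.Pos} : Relation.ReflTransGen
    (fun y z : g.Pos => (y.1 + Pi.single y.2 1, y.2) = z) x y ↔
      ∃ a, y = (x.1 + Pi.single x.2 a, x.2) := by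
  constructor
  · intro h
    induction h with
    | refl => exact ⟨0, by simp⟩
    | tail _ h ih =>
      obtain ⟨a, rfl⟩ := ih
      exact ⟨a + 1, by rw [← h]; simp [Pi.single_add, add_assoc]⟩
  · rintro ⟨a, rfl⟩
    rw [← ZMod.natCast_zmod_val a]
    induction a.val with
    | zero => simpa using .refl
    | succ n ih => exact ih.tail (by simp [Pi.single_add, add_assoc])

/-- Such positions are built from the origin by moving along the labels in increasing order, each
any number of times. The condition `z.2 ≠ 0` prevents the labels from wrapping around. -/
theorem support_le (a : α) : Def fun _ x => ∀ k, (x a).2 < k → (x a).1 k = 0 := by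
  have : Def fun g (x : α → g.Pos) => ∃ o : g.Pos, o = (0, 0) ∧ Relation.ReflTransGen
      (fun y z : g.Pos => (y.1 + Pi.single y.2 1, y.2) = z ∨ ((y.1, y.2 + 1) = z ∧ z.2 ≠ 0))
      o (x a) :=
    ex (.and (eq_base _) (tc (.or (move _ _) (.and (next _ _) (lab_ne_zero _))) _ _))
  refine this.congr fun g x => ?_
  rw [exists_eq_left]
  constructor
  · have key : ∀ (i : Fin g.d) (v : Fin g.d → ZMod g.ℓ), (∀ k, i < k → v k = 0) →
        Relation.ReflTransGen (fun y z : g.Pos => (y.1 + Pi.single y.2 1, y.2) = z ∨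
          ((y.1, y.2 + 1) = z ∧ z.2 ≠ 0)) (0, 0) (v, i) := by
      intro i
      induction i using Fin.add_one_induction with
      | zero =>
        intro v hv
        refine Relation.ReflTransGen.mono (fun _ _ => .inl) _ _
          (reflTransGen_move_iff.2 ⟨v 0, ?_⟩)
        ext k
        · by_cases hk : k = 0
          · subst hk
            simp
          · simp [hk, hv k (lt_of_le_of_ne (Fin.zero_le _) (Ne.symm hk))]
        · rfl
      | succ i ih hi =>
        intro v hv
        have h := (ih (Function.update v (i + 1) 0) ?_).tail (.inr ⟨rfl, hi⟩)
        · refine h.trans (Relation.ReflTransGen.mono (fun _ _ => .inl) _ _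
            (reflTransGen_move_iff.2 ⟨v (i + 1), ?_⟩))
          ext k
          · by_cases hk : k = i + 1
            · subst hk
              simp
            · simp [hk]
          · rfl
        · intro k hk
          by_cases hk' : k = i + 1
          · simp [hk']
          · rw [Function.update_of_ne hk']
            exact hv k (lt_of_le_of_ne ((add_one_le_iff_of_ne_zero hi).2 hk) (Ne.symm hk'))
    exact fun h => key _ _ h
  · have key : ∀ y : g.Pos, Relation.ReflTransGen (fun y z : g.Pos =>
        (y.1 + Pi.single y.2 1, y.2) = z ∨ ((y.1, y.2 + 1) = z ∧ z.2 ≠ 0)) (0, 0) y →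
        ∀ k, y.2 < k → y.1 k = 0 := by
      intro y h
      induction h with
      | refl => simp
      | tail _ h ih =>
        rcases h with rfl | ⟨rfl, h⟩
        · intro k hk
          simp [ih k hk, hk.ne']
        · exact fun k hk => ih k (((lt_add_one_iff_of_ne_zero h).2 le_rfl).trans hk)
    exact fun h => key _ h

/-- The strict version is one `next` move after the non-strict one; label `0` has no predecessor and
leaves only the origin. -/
theorem support_lt (a : α) : Def fun _ x => ∀ k, (x a).2 ≤ k → (x a).1 k = 0 := by
  have : Def fun g (x : α → g.Pos) => x a = (0, 0) ∨ ∃ y : g.Pos,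
      (∀ k, y.2 < k → y.1 k = 0) ∧ (y.1, y.2 + 1) = x a ∧ (x a).2 ≠ 0 :=
    (eq_base _).or (ex (.and (support_le _) (.and (next _ _) (lab_ne_zero _))))
  refine this.congr fun g x => ⟨fun h => ?_, ?_⟩
  · by_cases h0 : (x a).2 = 0
    · left
      ext k
      · exact h k (h0 ▸ Fin.zero_le _)
      · rw [h0]
    · have e : (x a).2 - 1 + 1 = (x a).2 := sub_add_cancel _ _
      refine .inr ⟨((x a).1, (x a).2 - 1), fun k hk => h k ?_, by simp, h0⟩
      rw [← e] at h0 ⊢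
      exact (add_one_le_iff_of_ne_zero h0).2 hk
  · rintro (h | ⟨y, h₁, h₂, h₃⟩) k hk
    · simp [h]
    · rw [← h₂] at h₃ hk ⊢
      exact h₁ k ((add_one_le_iff_of_ne_zero h₃).1 hk)

/-- Each step adds one to the entry of the current label and passes to the next label, without
wrapping around. The labels at the two ends therefore delimit the interval of entries that have been
increased. -/
theorem reflTransGen_advance_iff {x y : g.Pos} : Relation.ReflTransGen
    (fun y z : g.Pos => (y.1 + Pi.single y.2 1, y.2 + 1) = z ∧ z.2 ≠ 0) x y ↔
      x.2 ≤ y.2 ∧ y.1 = fun k => x.1 k + if x.2 ≤ k ∧ k < y.2 then 1 else 0 := by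
  constructor
  · intro h
    induction h with
    | refl => exact ⟨le_rfl, by ext k; rw [if_neg (by simp +contextual), add_zero]⟩
    | @tail y z _ h ih =>
      obtain ⟨rfl, h⟩ := h
      change y.2 + 1 ≠ 0 at h
      refine ⟨ih.1.trans ((lt_add_one_iff_of_ne_zero h).2 le_rfl).le, ?_⟩
      ext k
      change y.1 k + (Pi.single y.2 1 : Fin g.d → ZMod g.ℓ) k = _
      rw [ih.2]
      simp only [lt_add_one_iff_of_ne_zero h]
      rcases lt_trichotomy k y.2 with hk | rfl | hk
      · simp [hk, hk.le, hk.ne]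
      · simp [ih.1]
      · simp [hk.not_gt, hk.not_ge, hk.ne']
  · obtain ⟨v, i⟩ := x
    obtain ⟨u, j⟩ := y
    rintro ⟨h, hu⟩
    change i ≤ j at h
    change u = fun k => v k + if i ≤ k ∧ k < j then 1 else 0 at hu
    subst hu
    change Relation.ReflTransGen _ (v, i) (fun k => v k + if i ≤ k ∧ k < j then 1 else 0, j)
    induction j using Fin.add_one_induction with
    | zero =>
      obtain rfl : i = 0 := le_antisymm h (Fin.zero_le _)
      simpa using .refl
    | succ j ih hj =>
      rcases h.lt_or_eq with hij | rfl
      · rw [lt_add_one_iff_of_ne_zero hj] at hij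
        refine (ih hij).tail ⟨?_, hj⟩
        ext k
        · change v k + _ + (Pi.single j 1 : Fin g.d → ZMod g.ℓ) k = _
          simp only [lt_add_one_iff_of_ne_zero hj]
          rcases lt_trichotomy k j with hk | rfl | hk
          · simp [hk, hk.le, hk.ne]
          · simp [hij]
          · simp [hk.not_gt, hk.not_ge, hk.ne']
        · rfl
      · rw [show (fun k => v k + if j + 1 ≤ k ∧ k < j + 1 then (1 : ZMod g.ℓ) else 0) = v by
          ext k
          rw [if_neg (by simp +contextual), add_zero]]

/-- A label `j` is guessed, with `x'` on the node of `a`. Advancing from there to the last label `z`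
and once more to `w` adds one to all entries from `j` on. The carry is tested on the result: it must
be reached by moves along `j` from some `p` whose entries from `j` on vanish, which makes the later
entries zero, and it must differ from `p`, which makes entry `j` nonzero. -/
theorem node_succ (a b : α) : Def fun _ x => NodeSucc (x a).1 (x b).1 := by
  have : Def fun g (x : α → g.Pos) => ∃ x' z w y' p : g.Pos, x'.1 = (x a).1 ∧
      Relation.ReflTransGen
        (fun y z : g.Pos => (y.1 + Pi.single y.2 1, y.2 + 1) = z ∧ z.2 ≠ 0) x' z ∧
      (z.1 + Pi.single z.2 1, z.2 + 1) = w ∧ w.2 = 0 ∧ w.1 = (x b).1 ∧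
      y'.1 = (x b).1 ∧ y'.2 = x'.2 ∧ (∀ k, p.2 ≤ k → p.1 k = 0) ∧ Relation.ReflTransGen
        (fun y z : g.Pos => (y.1 + Pi.single y.2 1, y.2) = z) p y' ∧ p ≠ y' :=
    ex (ex (ex (ex (ex (.and (same_node _ _) (.and (tc (.and (advance _ _) (lab_ne_zero _)) _ _)
      (.and (advance _ _) (.and (lab_zero _) (.and (same_node _ _) (.and (same_node _ _)
      (.and (same_label _ _) (.and (support_lt _) (.and (tc (move _ _) _ _) (ne _ _))))))))))))))
  refine this.congr fun g x => ?_
  simp only [reflTransGen_advance_iff, reflTransGen_move_iff]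
  constructor
  · rintro ⟨j, h₁, h₂, h₃⟩
    -- The last label is `-1`, as labels are counted cyclically.
    have hz : (-1 : Fin g.d) + 1 = 0 := by simp
    refine ⟨((x a).1, j), (fun k => (x a).1 k + if j ≤ k ∧ k < -1 then 1 else 0, -1),
      ((x b).1, 0), ((x b).1, j), (fun k => if k < j then (x b).1 k else 0, j), rfl,
      ⟨le_of_add_one_eq_zero hz, rfl⟩, ?_, rfl, rfl, rfl, rfl, ?_, ⟨(x b).1 j, ?_⟩, ?_⟩
    · ext k
      · change (x a).1 k + _ + (Pi.single (-1) 1 : Fin g.d → ZMod g.ℓ) k = _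
        rw [h₁ k]
        rcases (le_of_add_one_eq_zero hz : k ≤ -1).lt_or_eq with hk | rfl
        · simp [hk, hk.ne]
        · simp [le_of_add_one_eq_zero hz]
      · simp
    · exact fun k hk => if_neg hk.not_gt
    · ext k
      · change _ = (if k < j then (x b).1 k else 0) +
          (Pi.single j ((x b).1 j) : Fin g.d → ZMod g.ℓ) k
        rcases lt_trichotomy k j with hk | rfl | hk
        · simp [hk, hk.ne]
        · simp
        · simp [hk.not_gt, hk.ne', h₂ k hk]
      · rfl
    · intro h
      have := congrFun (congrArg Prod.fst h) j
      simp only [lt_self_iff_false, if_false] at this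
      exact h₃ this.symm
  · rintro ⟨x', z, w, y', p, h₁, ⟨h₂, h₃⟩, rfl, h₅, h₆, h₇, h₈, h₉, ⟨c, rfl⟩, h₁₁⟩
    change z.2 + 1 = 0 at h₅
    change p.2 = x'.2 at h₈
    change p.1 + Pi.single p.2 c = _ at h₇
    refine ⟨x'.2, fun k => ?_, fun k hk => ?_, fun h => h₁₁ ?_⟩
    · rw [← h₆, ← h₁]
      change z.1 k + (Pi.single z.2 1 : Fin g.d → ZMod g.ℓ) k = _
      rw [h₃]
      rcases (le_of_add_one_eq_zero h₅ : k ≤ z.2).lt_or_eq with hk | rfl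
      · simp [hk, hk.ne]
      · simp [h₂]
    · rw [← h₇, ← h₈] at *
      simp [h₉ k hk.le, hk.ne']
    · rw [← h₇, ← h₈] at h
      simp only [Pi.add_apply, Pi.single_eq_same, h₉ _ le_rfl, zero_add] at h
      simp [h]

end Def

/-! ### Numbering nodes and positions -/

section order

variable {d ℓ : ℕ}

theorem card_exponents (d ℓ : ℕ) : Fintype.card (Lex (Fin d → Fin ℓ)) = ℓ ^ d := by
  change Fintype.card (Fin d → Fin ℓ) = _
  simp

/-- The exponents in lexicographic order. -/
noncomputable def lexIso (d ℓ : ℕ) : Fin (ℓ ^ d) ≃o Lex (Fin d → Fin ℓ) :=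
  Fintype.orderIsoFinOfCardEq _ (card_exponents d ℓ)

theorem sort_exponents (d ℓ : ℕ) :
    ((Finset.univ : Finset (Fin d → Fin ℓ)).map (toLex (α := Fin d → Fin ℓ)).toEmbedding).sort
      (· ≤ ·) = (List.finRange (ℓ ^ d)).map (lexIso d ℓ) := by
  have h : ((Finset.univ : Finset (Fin d → Fin ℓ)).map
      (toLex (α := Fin d → Fin ℓ)).toEmbedding).card = ℓ ^ d := by simp
  rw [← Finset.listMap_orderEmbOfFin_finRange _ h]
  congr 1
  have := Finset.orderEmbOfFin_unique' h (f := (lexIso d ℓ).toOrderEmbedding) (by simp)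
  rw [← this]
  rfl

theorem exists_nodeSucc {v : Fin d → ZMod ℓ} (h : ∃ k, v k + 1 ≠ 0) : ∃ v', NodeSucc v v' := by
  classical
  have hne : (Finset.univ.filter fun k => v k + 1 ≠ 0).Nonempty := by
    obtain ⟨k, hk⟩ := h
    exact ⟨k, by simpa using hk⟩
  -- The last entry that does not overflow when one is added.
  set j := (Finset.univ.filter fun k => v k + 1 ≠ 0).max' hne with hjdef
  have hj := Finset.max'_mem _ hne
  refine ⟨fun k => v k + if j ≤ k then 1 else 0, j, fun _ => rfl, fun k hk => ?_, ?_⟩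
  · simp only [hk.le, if_true]
    by_contra hk'
    exact absurd (Finset.le_max' _ k (by simpa using hk')) hk.not_ge
  · simpa using hj

variable [NeZero ℓ]

/-- The exponents of a node. -/
def exponents (v : Fin d → ZMod ℓ) : Fin d → Fin ℓ := fun k => ⟨(v k).val, ZMod.val_lt _⟩

theorem exponents_injective : (exponents (d := d) (ℓ := ℓ)).Injective := by
  intro v w h
  ext k
  exact ZMod.val_injective _ (congrArg Fin.val (congrFun h k))

theorem exponents_natCast (e : Fin d → Fin ℓ) : exponents (fun k => ((e k : ℕ) : ZMod ℓ)) = e := by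
  ext k
  exact ZMod.val_cast_of_lt (e k).isLt

theorem zmod_add_one_cases (z : ZMod ℓ) :
    (z + 1 = 0 ∧ z.val + 1 = ℓ) ∨ (z + 1 ≠ 0 ∧ (z + 1).val = z.val + 1 ∧ z.val + 1 < ℓ) := by
  obtain ⟨n, rfl⟩ := Nat.exists_eq_succ_of_ne_zero (NeZero.ne ℓ)
  exact Fin.add_one_cases (d := n + 1) z

/-- The number of a node in the lexicographic order. -/
noncomputable def nodeIdx (v : Fin d → ZMod ℓ) : ℕ := ((lexIso d ℓ).symm (toLex (exponents v))).val

theorem nodeIdx_lt (v : Fin d → ZMod ℓ) : nodeIdx v < ℓ ^ d := Fin.isLt _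

theorem nodeIdx_injective : (nodeIdx (d := d) (ℓ := ℓ)).Injective := fun _ _ h =>
  exponents_injective (toLex.injective ((lexIso d ℓ).symm.injective (Fin.ext h)))

theorem exists_nodeIdx_eq {n : ℕ} (hn : n < ℓ ^ d) : ∃ v : Fin d → ZMod ℓ, nodeIdx v = n := by
  refine ⟨fun k => (((ofLex (lexIso d ℓ ⟨n, hn⟩) k : Fin ℓ) : ℕ) : ZMod ℓ), ?_⟩
  rw [nodeIdx, exponents_natCast]
  simp

theorem nodeIdx_zero : nodeIdx (0 : Fin d → ZMod ℓ) = 0 := by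
  have hpos : 0 < ℓ ^ d := pow_pos (NeZero.pos ℓ) _
  have : (lexIso d ℓ).symm (toLex (exponents 0)) ≤ ⟨0, hpos⟩ := by
    rw [OrderIso.symm_apply_le, ← not_lt]
    rintro ⟨i, -, h⟩
    exact absurd (Fin.lt_def.1 h) (by
      change ¬_ < (0 : ZMod ℓ).val
      simp)
  exact Nat.le_zero.1 this

/-- After position `j`, all entries of `v` are maximal and all those of `v'` are zero: each is
extreme among the tuples with its prefix, and the prefixes up to `j` differ by one in their last
entry. The proof compares the first places `i`, `i'` where a tuple strictly in between would differ
from `v` and from `v'`. -/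
theorem NodeSucc.covBy {v v' : Fin d → ZMod ℓ} (h : NodeSucc v v') :
    toLex (exponents v) ⋖ toLex (exponents v') := by
  obtain ⟨j, h₁, h₂, h₃⟩ := h
  have hlt : ∀ k < j, exponents v k = exponents v' k := by
    intro k hk
    ext
    simp [exponents, h₁ k, hk.not_ge]
  have hj : (exponents v' j).val = (exponents v j).val + 1 := by
    have e := h₁ j
    rw [if_pos le_rfl] at e
    rw [e] at h₃
    rcases zmod_add_one_cases (v j) with ⟨h, -⟩ | ⟨-, h, -⟩
    · exact absurd h h₃
    · simpa [exponents, e] using h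
  refine ⟨⟨j, hlt, by simp [Fin.lt_def, hj]⟩, ?_⟩
  rintro f ⟨i, hi, hi'⟩ ⟨i', hi₂, hi₂'⟩
  change ∀ k < i, exponents v k = f k at hi
  change exponents v i < f i at hi'
  change ∀ k < i', f k = exponents v' k at hi₂
  change f i' < exponents v' i' at hi₂'
  rcases lt_trichotomy i' j with h | rfl | h
  · rw [← hlt _ h] at hi₂'
    rcases lt_trichotomy i i' with h' | rfl | h'
    · rw [hi₂ i h', ← hlt i (h'.trans h)] at hi'
      exact lt_irrefl _ hi'
    · exact lt_irrefl _ (hi'.trans hi₂')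
    · rw [hi _ h'] at hi₂'
      exact lt_irrefl _ hi₂'
  · rcases lt_trichotomy i i' with h' | rfl | h'
    · rw [hi₂ i h', ← hlt i h'] at hi'
      exact lt_irrefl _ hi'
    · rw [Fin.lt_def] at hi' hi₂'
      omega
    · have e := h₁ i
      rw [if_pos h'.le, h₂ i h'] at e
      rcases zmod_add_one_cases (v i) with ⟨-, h⟩ | ⟨h, -⟩
      · have := (f i).isLt
        rw [Fin.lt_def] at hi'
        change (v i).val < _ at hi'
        omega
      · exact h e.symm
  · rw [Fin.lt_def] at hi₂'
    change _ < (v' i').val at hi₂'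
    rw [h₂ i' h] at hi₂'
    simp at hi₂'

/-- The order isomorphism turns covering pairs into consecutive numbers. Conversely, a node with a
cover has an entry that can be increased, hence a successor in the sense of `NodeSucc`, and covers
in a linear order are unique. -/
theorem nodeSucc_iff {v v' : Fin d → ZMod ℓ} : NodeSucc v v' ↔ nodeIdx v' = nodeIdx v + 1 := by
  have key : toLex (exponents v) ⋖ toLex (exponents v') ↔ nodeIdx v' = nodeIdx v + 1 := by
    have h := apply_covBy_apply_iff (lexIso d ℓ).symm (a := toLex (exponents v))
      (b := toLex (exponents v'))
    refine h.symm.trans ?_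
    rw [nodeIdx, nodeIdx, Fin.covBy_iff,
      Nat.covBy_iff_add_one_eq, eq_comm]
  rw [← key]
  refine ⟨NodeSucc.covBy, fun h => ?_⟩
  have hk : ∃ k, v k + 1 ≠ 0 := by
    obtain ⟨i, -, hi⟩ := h.1
    refine ⟨i, fun h0 => ?_⟩
    rcases zmod_add_one_cases (v i) with ⟨-, h⟩ | ⟨h, -⟩
    · have h₁ : (v i).val < (v' i).val := hi
      have := ZMod.val_lt (v' i)
      omega
    · exact h h0
  obtain ⟨w, hw⟩ := exists_nodeSucc hk
  obtain rfl : w = v' := exponents_injective (toLex.injective (hw.covBy.unique_right h))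
  exact hw

end order

variable {g : GridIx}

/-- The number of positions. -/
def GridIx.size (g : GridIx) : ℕ := g.ℓ ^ g.d * g.d

/-- The number of a position. -/
noncomputable def posIdx (x : g.Pos) : ℕ := nodeIdx x.1 * g.d + x.2.val

theorem posIdx_lt (x : g.Pos) : posIdx x < g.size := by
  have h₁ := nodeIdx_lt x.1
  have h₂ := x.2.isLt
  unfold posIdx GridIx.size
  nlinarith [Nat.mul_le_mul_right g.d (Nat.succ_le_of_lt h₁)]

theorem posIdx_div (x : g.Pos) : posIdx x / g.d = nodeIdx x.1 := by
  rw [posIdx, mul_comm, Nat.mul_add_div (NeZero.pos _), Nat.div_eq_of_lt x.2.isLt, add_zero]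

theorem posIdx_mod (x : g.Pos) : posIdx x % g.d = x.2.val := by
  rw [posIdx, mul_comm, Nat.mul_add_mod, Nat.mod_eq_of_lt x.2.isLt]

theorem posIdx_injective : (posIdx (g := g)).Injective := by
  intro x y h
  refine Prod.ext (nodeIdx_injective ?_) (Fin.ext ?_)
  · rw [← posIdx_div, ← posIdx_div, h]
  · rw [← posIdx_mod, ← posIdx_mod, h]

theorem exists_posIdx_eq {n : ℕ} (hn : n < g.size) : ∃ x : g.Pos, posIdx x = n := by
  obtain ⟨v, hv⟩ := exists_nodeIdx_eq (d := g.d) (ℓ := g.ℓ) (n := n / g.d)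
    (Nat.div_lt_of_lt_mul (by rw [mul_comm]; exact hn))
  refine ⟨(v, ⟨n % g.d, Nat.mod_lt _ (NeZero.pos _)⟩), ?_⟩
  rw [posIdx, hv, mul_comm]
  exact Nat.div_add_mod _ _

theorem posIdx_zero : posIdx ((0, 0) : g.Pos) = 0 := by
  simp [posIdx, nodeIdx_zero]

/-- The label is the fast digit: the next position is on the same node unless the label returns to
`0`, and then it is on the successor node. -/
theorem Def.pos_succ {α : Type} [Finite α] (a b : α) :
    Def fun _ x => posIdx (x b) = posIdx (x a) + 1 := by
  have : Def fun g (x : α → g.Pos) => ((x b).2 ≠ 0 ∧ ((x a).1, (x a).2 + 1) = x b) ∨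
      ((x b).2 = 0 ∧ ∃ z : g.Pos, ((x a).1, (x a).2 + 1) = z ∧ z.2 = 0 ∧
        NodeSucc (x a).1 (x b).1) :=
    .or (.and (lab_ne_zero _) (next _ _)) (.and (lab_zero _)
      (ex (.and (next _ _) (.and (lab_zero _) (node_succ _ _)))))
  refine this.congr fun g x => ?_
  simp only [exists_eq_left', nodeSucc_iff]
  generalize x a = p
  generalize x b = q
  rcases Fin.add_one_cases p.2 with ⟨h₁, h₂⟩ | ⟨h₁, h₂, h₃⟩
  · constructor
    · intro h
      have e₁ := congrArg (· / g.d) h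
      have e₂ := congrArg (· % g.d) h
      simp only [posIdx_div, posIdx_mod] at e₁ e₂
      rw [posIdx, add_assoc, h₂] at e₁ e₂
      simp only [Nat.add_mod_right, Nat.mul_mod_left] at e₂
      rw [← Nat.succ_mul, Nat.mul_div_cancel _ (NeZero.pos _)] at e₁
      exact .inr ⟨Fin.ext e₂, h₁, e₁⟩
    · rintro (⟨h, rfl⟩ | ⟨h, -, h'⟩)
      · exact absurd h₁ h
      · rw [posIdx, h', h, posIdx, add_assoc, h₂, Fin.val_zero, add_zero, Nat.succ_mul]
  · have e : posIdx ((p.1, p.2 + 1) : g.Pos) = posIdx p + 1 := by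
      simp only [posIdx, h₂, add_assoc]
    rw [← e, posIdx_injective.eq_iff]
    constructor
    · rintro rfl
      exact .inl ⟨h₁, rfl⟩
    · rintro (⟨-, h⟩ | ⟨-, h, -⟩)
      · exact h.symm
      · exact absurd h h₁

end NDJag

namespace NDJag

/-! ### Numbers as tuples of positions -/

namespace Def

variable {α : Type}

theorem forall_finite {ι : Type} [Finite ι] {R : ι → ∀ g : GridIx, (α → g.Pos) → Prop}
    (h : ∀ i, Def (R i)) : Def fun g x => ∀ i, R i g x := by
  have key : ∀ S : Set ι, S.Finite → Def fun g x => ∀ i ∈ S, R i g x := by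
    intro S hS
    induction S, hS using Set.Finite.induction_on with
    | empty => exact (const True).congr (by simp)
    | @insert i S _ _ ih => exact ((h i).and ih).congr (by simp)
  exact (key Set.univ Set.finite_univ).congr (by simp)

variable [Finite α]

/-- The last node has all entries equal to `-1`; equivalently, adding one to every entry, by a full
round of advances, leads to the origin. -/
theorem node_last (a : α) : Def fun g x => nodeIdx (x a).1 + 1 = g.ℓ ^ g.d := by
  have : Def fun g (x : α → g.Pos) => ∃ x' z w : g.Pos, x'.1 = (x a).1 ∧ x'.2 = 0 ∧
      Relation.ReflTransGen
        (fun y z : g.Pos => (y.1 + Pi.single y.2 1, y.2 + 1) = z ∧ z.2 ≠ 0) x' z ∧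
      (z.1 + Pi.single z.2 1, z.2 + 1) = w ∧ w = (0, 0) :=
    ex (ex (ex (.and (same_node _ _) (.and (lab_zero _) (.and (tc (.and (advance _ _)
      (lab_ne_zero _)) _ _) (.and (advance _ _) (eq_base _)))))))
  refine this.congr fun g x => ?_
  generalize x a = p
  simp only [reflTransGen_advance_iff]
  have h₁ : nodeIdx p.1 + 1 = g.ℓ ^ g.d ↔ ∀ k, p.1 k + 1 = 0 := by
    constructor
    · intro h
      by_contra! hk
      obtain ⟨v', hv'⟩ := exists_nodeSucc hk
      have := nodeIdx_lt v'
      rw [nodeSucc_iff.1 hv', h] at this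
      exact lt_irrefl _ this
    · intro hk
      by_contra h
      obtain ⟨v', hv'⟩ := exists_nodeIdx_eq (d := g.d) (ℓ := g.ℓ) (n := nodeIdx p.1 + 1)
        (lt_of_le_of_ne (nodeIdx_lt _) h)
      obtain ⟨j, h₁, -, h₃⟩ := nodeSucc_iff.2 hv'
      rw [h₁ j, if_pos le_rfl] at h₃
      exact h₃ (hk j)
  rw [h₁]
  have hz : (-1 : Fin g.d) + 1 = 0 := by simp
  constructor
  · intro hk
    refine ⟨(p.1, 0), (fun k => p.1 k + if 0 ≤ k ∧ k < -1 then 1 else 0, -1), (0, 0), rfl, rfl,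
      ⟨le_of_add_one_eq_zero hz, rfl⟩, ?_, rfl⟩
    ext k
    · change p.1 k + _ + (Pi.single (-1) 1 : Fin g.d → ZMod g.ℓ) k = 0
      rcases (le_of_add_one_eq_zero hz : k ≤ -1).lt_or_eq with h | rfl
      · simp [h, h.ne, hk]
      · simp [hk]
    · simp
  · rintro ⟨x', z, w, e₁, e₂, ⟨e₃, e₄⟩, rfl, e₅⟩ k
    have e₆ := congrArg Prod.snd e₅
    have e₇ := congrFun (congrArg Prod.fst e₅) k
    simp only [Pi.add_apply, e₄, e₁, e₂, Fin.zero_le, true_and, Pi.zero_apply] at e₆ e₇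
    rcases (le_of_add_one_eq_zero e₆ : k ≤ z.2).lt_or_eq with h | rfl
    · simpa [h, h.ne] using e₇
    · simpa using e₇

theorem pos_last (a : α) : Def fun g x => posIdx (x a) + 1 = g.size := by
  have : Def fun g (x : α → g.Pos) => nodeIdx (x a).1 + 1 = g.ℓ ^ g.d ∧
      ∃ z : g.Pos, ((x a).1, (x a).2 + 1) = z ∧ z.2 = 0 :=
    .and (node_last _) (ex (.and (next _ _) (lab_zero _)))
  refine this.congr fun g x => ?_
  generalize x a = p
  rw [exists_eq_left', GridIx.size, posIdx]
  have h₁ := nodeIdx_lt p.1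
  have h₂ := NeZero.pos g.d
  rcases Fin.add_one_cases p.2 with ⟨h, h'⟩ | ⟨h, -, h'⟩
  · rw [add_assoc, h', ← Nat.succ_mul, Nat.mul_left_inj h₂.ne']
    simp [h]
  · simp only [h, and_false, iff_false]
    have := Nat.mul_le_mul_right g.d (Nat.succ_le_of_lt h₁)
    rw [Nat.succ_mul] at this
    omega

theorem two_le_size : Def fun g (_ : α → g.Pos) => 2 ≤ g.size := by
  have : Def fun g (_ : α → g.Pos) => ∃ y : g.Pos, y ≠ (0, 0) := ex (ne_base _)
  refine this.congr fun g x => ?_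
  constructor
  · intro h
    obtain ⟨y, hy⟩ := exists_posIdx_eq (g := g) (n := 1) (by omega)
    refine ⟨y, ?_⟩
    rintro rfl
    rw [posIdx_zero] at hy
    exact zero_ne_one hy
  · rintro ⟨y, hy⟩
    have := posIdx_lt y
    have h0 : posIdx y ≠ 0 := fun h => hy (posIdx_injective (h.trans posIdx_zero.symm))
    omega

end Def

variable {g : GridIx}

theorem GridIx.size_pos (g : GridIx) : 0 < g.size :=
  Nat.mul_pos (pow_pos (NeZero.pos _) _) (NeZero.pos _)

/-- The number represented by a tuple of positions, the least significant digit first. -/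
noncomputable def num : (c : ℕ) → (Fin c → g.Pos) → ℕ
  | 0, _ => 0
  | c + 1, x => posIdx (x 0) + g.size * num c fun i => x i.succ

theorem num_lt {c : ℕ} (x : Fin c → g.Pos) : num c x < g.size ^ c := by
  induction c with
  | zero => simp [num]
  | succ c ih =>
    have h₁ := posIdx_lt (x 0)
    have h₂ := Nat.mul_le_mul_left g.size (Nat.succ_le_of_lt (ih fun i => x i.succ))
    rw [Nat.mul_succ] at h₂
    rw [num, pow_succ']
    omega

theorem num_succ_mod {c : ℕ} (x : Fin (c + 1) → g.Pos) : num (c + 1) x % g.size = posIdx (x 0) := by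
  rw [num, Nat.add_mul_mod_self_left, Nat.mod_eq_of_lt (posIdx_lt _)]

theorem num_succ_div {c : ℕ} (x : Fin (c + 1) → g.Pos) :
    num (c + 1) x / g.size = num c fun i => x i.succ := by
  rw [num, Nat.add_mul_div_left _ _ g.size_pos, Nat.div_eq_of_lt (posIdx_lt _), zero_add]

theorem num_injective {c : ℕ} : (num (g := g) c).Injective := by
  induction c with
  | zero => exact fun x y _ => Subsingleton.elim x y
  | succ c ih =>
    intro x y h
    funext i
    refine Fin.cases ?_ (fun i => ?_) i
    · refine posIdx_injective ?_
      rw [← num_succ_mod, ← num_succ_mod, h]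
    · refine congrFun (ih (a₁ := fun i => x i.succ) (a₂ := fun i => y i.succ) ?_) i
      rw [← num_succ_div, ← num_succ_div, h]

theorem exists_num_eq {c n : ℕ} (hn : n < g.size ^ c) : ∃ x : Fin c → g.Pos, num c x = n := by
  induction c generalizing n with
  | zero =>
    obtain rfl : n = 0 := by simpa using hn
    exact ⟨Fin.elim0, rfl⟩
  | succ c ih =>
    obtain ⟨y, hy⟩ := ih (n := n / g.size)
      (Nat.div_lt_of_lt_mul (by rwa [pow_succ'] at hn))
    obtain ⟨u, hu⟩ := exists_posIdx_eq (Nat.mod_lt n g.size_pos)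
    refine ⟨Fin.cons u y, ?_⟩
    rw [num]
    simp only [Fin.cons_zero, Fin.cons_succ]
    rw [hu, hy, Nat.mod_add_div]

theorem num_eq_posIdx_iff {c : ℕ} {x : Fin (c + 1) → g.Pos} {u : g.Pos} :
    num (c + 1) x = posIdx u ↔ x 0 = u ∧ ∀ i : Fin c, x i.succ = (0, 0) := by
  have h0 : num (g := g) c (fun _ => (0, 0)) = 0 := by
    clear x u
    induction c with
    | zero => rfl
    | succ c ih => rw [num, ih, posIdx_zero, mul_zero, zero_add]
  have : posIdx u = num (c + 1) (Fin.cons u fun _ => (0, 0)) := by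
    rw [num]
    simp only [Fin.cons_zero, Fin.cons_succ, h0, mul_zero, add_zero]
  rw [this, num_injective.eq_iff]
  constructor
  · rintro rfl
    simp
  · rintro ⟨h₁, h₂⟩
    funext i
    refine Fin.cases ?_ (fun i => ?_) i
    · simpa using h₁
    · simpa using h₂ i

/-- Increment with carry: the lowest digit increases and the others are unchanged, or it is the last
position, returns to the origin and passes the carry on. -/
theorem Def.num_succ {α : Type} [Finite α] {c : ℕ} (f f' : Fin c → α) :
    Def fun _ x => num c (fun i => x (f' i)) = num c (fun i => x (f i)) + 1 := by
  induction c with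
  | zero => exact (const False).congr fun g x => by simp [num]
  | succ c ih =>
    have : Def fun g (x : α → g.Pos) => (posIdx (x (f' 0)) = posIdx (x (f 0)) + 1 ∧
        ∀ i : Fin c, x (f' i.succ) = x (f i.succ)) ∨ (posIdx (x (f 0)) + 1 = g.size ∧
        x (f' 0) = (0, 0) ∧ num c (fun i => x (f' i.succ)) = num c (fun i => x (f i.succ)) + 1) :=
      .or (.and (pos_succ _ _) (forall_finite fun i => .eq _ _))
        (.and (pos_last _) (.and (eq_base _) (ih _ _)))
    refine this.congr fun g x => ?_
    have e : (∀ i : Fin c, x (f' i.succ) = x (f i.succ)) ↔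
        num c (fun i => x (f' i.succ)) = num c (fun i => x (f i.succ)) := by
      rw [num_injective.eq_iff, funext_iff]
    have e' : x (f' 0) = (0, 0) ↔ posIdx (x (f' 0)) = 0 := 
      ⟨fun h => by rw [h, posIdx_zero], fun h => posIdx_injective (h.trans posIdx_zero.symm)⟩
    rw [e, e', num, num]
    have h₁ := posIdx_lt (x (f 0))
    have h₂ := posIdx_lt (x (f' 0))
    generalize posIdx (x (f 0)) = p at *
    generalize posIdx (x (f' 0)) = q at *
    generalize (num c fun i => x (f i.succ)) = m at *
    generalize (num c fun i => x (f' i.succ)) = n at *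
    constructor
    · intro h
      rcases Nat.lt_or_ge (p + 1) g.size with hp | hp
      · left
        have hm := congrArg (· % g.size) h
        simp only [add_right_comm p, Nat.add_mul_mod_self_left, Nat.mod_eq_of_lt hp,
          Nat.mod_eq_of_lt h₂] at hm
        refine ⟨hm, Nat.eq_of_mul_eq_mul_left g.size_pos (by omega)⟩
      · right
        have hp : p + 1 = g.size := le_antisymm h₁ hp
        have h : q + g.size * n = g.size * (m + 1) := by rw [Nat.mul_succ]; omega
        have hm := congrArg (· % g.size) h
        simp only [Nat.add_mul_mod_self_left, Nat.mul_mod_right, Nat.mod_eq_of_lt h₂] at hm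
        subst hm
        exact ⟨hp, rfl, Nat.eq_of_mul_eq_mul_left g.size_pos (by omega)⟩
    · rintro (⟨rfl, rfl⟩ | ⟨h, rfl, rfl⟩)
      · omega
      · rw [Nat.mul_succ]
        omega

end NDJag

namespace NDJag

/-! ### Relations on numbers that can be recognised -/

/-- The number of values of a variable for numbers. -/
def GridIx.bound (g : GridIx) (c : ℕ) : ℕ := g.size ^ (c + 1)

/-- The relation `R` on numbers below `g.bound c` is recognised, uniformly in all grids with at least
two positions. -/
def NDef (c : ℕ) {α : Type} (R : ∀ _ : GridIx, (α → ℕ) → Prop) : Prop :=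
  ∃ R' : ∀ g : GridIx, (α × Fin (c + 1) → g.Pos) → Prop, Def R' ∧
    ∀ g, 2 ≤ g.size → ∀ x, R' g x ↔ R g fun a => num (c + 1) fun i => x (a, i)

/-- A path on the right starts in the image of `f`, so it suffices that the target of each step
satisfies `p`; the path can then be pulled back step by step. -/
theorem reflTransGen_preimage {α β : Type} {f : α → β} {p : β → Prop} (hf : ∀ a, p (f a))
    (hs : ∀ b, p b → ∃ a, f a = b) (hi : f.Injective) {R : β → β → Prop} {a b : α} :
    Relation.ReflTransGen (fun a b => R (f a) (f b)) a b ↔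
      Relation.ReflTransGen (fun u v => p v ∧ R u v) (f a) (f b) := by
  constructor
  · exact fun h => h.lift f fun _ _ h => ⟨hf _, h⟩
  · intro h
    have key : ∀ v, Relation.ReflTransGen (fun u v => p v ∧ R u v) (f a) v →
        ∃ c, f c = v ∧ Relation.ReflTransGen (fun a b => R (f a) (f b)) a c := by
      intro v hv
      induction hv with
      | refl => exact ⟨a, rfl, .refl⟩
      | tail _ h ih =>
        obtain ⟨c, rfl, hc⟩ := ih
        obtain ⟨e, rfl⟩ := hs _ h.1
        exact ⟨e, rfl, hc.tail h.2⟩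
    obtain ⟨c, hc, h⟩ := key _ h
    rwa [← hi hc]

namespace NDef

variable {c : ℕ} {α β κ : Type} {R R₁ R₂ : ∀ _ : GridIx, (α → ℕ) → Prop}

theorem congr (h : NDef c R₁)
    (e : ∀ g x, 2 ≤ g.size → (∀ a, x a < g.bound c) → (R₂ g x ↔ R₁ g x)) : NDef c R₂ := by
  obtain ⟨R', h, h'⟩ := h
  exact ⟨R', h, fun g hg x => (h' g hg x).trans (e g _ hg fun a => num_lt _).symm⟩

theorem and (h₁ : NDef c R₁) (h₂ : NDef c R₂) : NDef c fun g x => R₁ g x ∧ R₂ g x := by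
  obtain ⟨R₁', h₁, h₁'⟩ := h₁
  obtain ⟨R₂', h₂, h₂'⟩ := h₂
  exact ⟨_, h₁.and h₂, fun g hg x => and_congr (h₁' g hg x) (h₂' g hg x)⟩

theorem or (h₁ : NDef c R₁) (h₂ : NDef c R₂) : NDef c fun g x => R₁ g x ∨ R₂ g x := by
  obtain ⟨R₁', h₁, h₁'⟩ := h₁
  obtain ⟨R₂', h₂, h₂'⟩ := h₂
  exact ⟨_, h₁.or h₂, fun g hg x => or_congr (h₁' g hg x) (h₂' g hg x)⟩

theorem const (p : Prop) : NDef (α := α) c fun _ _ => p := ⟨_, .const p, fun _ _ _ => Iff.rfl⟩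

theorem exists_finite {ι : Type} [Finite ι] {R : ι → ∀ _ : GridIx, (α → ℕ) → Prop}
    (h : ∀ i, NDef c (R i)) : NDef c fun g x => ∃ i, R i g x := by
  choose R' h h' using h
  exact ⟨_, .exists_finite h, fun g hg x => exists_congr fun i => h' i g hg x⟩

theorem rename (h : NDef c R) (f : α → β) : NDef c fun g x => R g fun a => x (f a) := by
  obtain ⟨R', h, h'⟩ := h
  exact ⟨_, h.rename (Prod.map f id), fun g hg x => h' g hg _⟩

theorem eq (a b : α) : NDef c fun _ x => x a = x b :=
  ⟨_, .forall_finite fun i : Fin (c + 1) => .eq (a, i) (b, i), fun _ _ _ => by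
    change _ ↔ num _ _ = num _ _
    rw [num_injective.eq_iff, funext_iff]⟩

theorem zero (a : α) : NDef c fun _ x => x a = 0 := by
  refine ⟨_, .and (.eq_base (a, 0)) (.forall_finite fun i : Fin c => .eq_base (a, i.succ)),
    fun g _ x => ?_⟩
  have h := num_eq_posIdx_iff (x := fun i => x (a, i)) (u := (0, 0))
  rw [posIdx_zero] at h
  exact h.symm

variable [Finite α] [Finite κ]

theorem ex {R : ∀ _ : GridIx, (α → ℕ) → ℕ → Prop}
    (h : NDef c fun g (z : Option α → ℕ) => R g (fun a => z (some a)) (z none)) :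
    NDef c fun g x => ∃ n < g.bound c, R g x n := by
  obtain ⟨R', h, h'⟩ := h
  have := Def.exT (α := α × Fin (c + 1)) (κ := Fin (c + 1))
    (R := fun g x y => R' g fun p => p.1.elim (y p.2) fun a => x (a, p.2))
    ((h.rename (β := (α × Fin (c + 1)) ⊕ Fin (c + 1))
      fun p => p.1.elim (Sum.inr p.2) fun a => Sum.inl (a, p.2)).congr fun g x => by
        refine iff_of_eq (congrArg _ (funext ?_))
        rintro ⟨_ | a, i⟩ <;> rfl)
  refine ⟨_, this, fun g hg x => ?_⟩
  simp only [h' g hg]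
  constructor
  · rintro ⟨y, hy⟩
    exact ⟨_, num_lt y, hy⟩
  · rintro ⟨n, hn, hy⟩
    obtain ⟨y, rfl⟩ := exists_num_eq hn
    exact ⟨y, hy⟩

theorem tcT {R : ∀ _ : GridIx, (α → ℕ) → (κ → ℕ) → (κ → ℕ) → Prop}
    (h : NDef c fun g (z : α ⊕ (κ ⊕ κ) → ℕ) => R g (fun a => z (.inl a))
      (fun k => z (.inr (.inl k))) (fun k => z (.inr (.inr k)))) (f f' : κ → α) :
    NDef c fun g x => Relation.ReflTransGen (fun u v => (∀ k, v k < g.bound c) ∧ R g x u v)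
      (fun k => x (f k)) (fun k => x (f' k)) := by
  obtain ⟨R', h, h'⟩ := h
  have := Def.tcT (α := α × Fin (c + 1)) (κ := κ × Fin (c + 1))
    (R := fun g x y z => R' g fun p => Sum.elim (fun a => x (a, p.2)) (Sum.elim
      (fun k => y (k, p.2)) fun k => z (k, p.2)) p.1)
    ((h.rename (β := (α × Fin (c + 1)) ⊕ ((κ × Fin (c + 1)) ⊕ (κ × Fin (c + 1))))
      fun p => Sum.elim (fun a => Sum.inl (a, p.2)) (Sum.elim
      (fun k => Sum.inr (Sum.inl (k, p.2))) fun k => Sum.inr (Sum.inr (k, p.2))) p.1).congr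
      fun g x => by
        refine iff_of_eq (congrArg _ (funext ?_))
        rintro ⟨a | k | k, i⟩ <;> rfl) (Prod.map f id) (Prod.map f' id)
  refine ⟨_, this, fun g hg x => ?_⟩
  simp only [h' g hg]
  refine reflTransGen_preimage
    (f := fun (y : κ × Fin (c + 1) → g.Pos) k => num (c + 1) fun i => y (k, i))
    (p := fun v => ∀ k, v k < g.bound c)
    (R := fun u v => R g (fun a => num (c + 1) fun i => x (a, i)) u v)
    (fun y k => num_lt _) (fun v hv => ?_) (fun y z hyz => ?_)
  · choose y hy using fun k => exists_num_eq (hv k)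
    exact ⟨fun p => y p.1 p.2, funext hy⟩
  · funext p
    exact congrFun (num_injective (congrFun hyz p.1)) p.2

theorem tc₂ {R : ∀ _ : GridIx, (α → ℕ) → ℕ × ℕ → ℕ × ℕ → Prop}
    (h : NDef c fun g (z : Option (Option (Option (Option α))) → ℕ) =>
      R g (fun a => z (some (some (some (some a))))) (z (some (some (some none))),
        z (some (some none))) (z (some none), z none)) (a b a' b' : α) :
    NDef c fun g x => Relation.ReflTransGen
      (fun u v => (v.1 < g.bound c ∧ v.2 < g.bound c) ∧ R g x u v) (x a, x b) (x a', x b') := by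
  have := tcT (κ := Fin 2) (R := fun g x y y' => R g x (y 0, y 1) (y' 0, y' 1))
    (h.rename (β := α ⊕ (Fin 2 ⊕ Fin 2)) fun o =>
      o.elim (Sum.inr (Sum.inr 1)) fun o => o.elim (Sum.inr (Sum.inr 0)) fun o =>
        o.elim (Sum.inr (Sum.inl 1)) fun o => o.elim (Sum.inr (Sum.inl 0)) Sum.inl)
    ![a, b] ![a', b']
  refine this.congr fun g x _ _ => ?_
  rw [show (fun k : Fin 2 => x (![a, b] k)) = ![x a, x b] by ext k; fin_cases k <;> rfl,
    show (fun k : Fin 2 => x (![a', b'] k)) = ![x a', x b'] by ext k; fin_cases k <;> rfl]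
  simp only [Fin.forall_fin_two]
  exact (reflTransGen_equiv (finTwoArrowEquiv ℕ)
    (R := fun u v => (v.1 < g.bound c ∧ v.2 < g.bound c) ∧ R g x u v)
    (a := ![x a, x b]) (b := ![x a', x b'])).symm

/-! #### Arithmetic -/

theorem succ (a b : α) : NDef c fun _ x => x b = x a + 1 :=
  ⟨_, .num_succ (fun i => (a, i)) (fun i => (b, i)), fun _ _ _ => Iff.rfl⟩

theorem nat_const (n : ℕ) (a : α) : NDef c fun _ x => x a = n := by
  induction n generalizing α with
  | zero => exact zero a
  | succ n ih =>
    have : NDef c fun g (x : α → ℕ) => ∃ m < g.bound c, m = n ∧ x a = m + 1 :=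
      ex (.and (ih _) (succ _ _))
    refine this.congr fun g x _ hx => ⟨fun h => ⟨n, by have := hx a; omega, rfl, h⟩, ?_⟩
    rintro ⟨_, -, rfl, h⟩
    exact h

/-- Counting in parallel leads from `(0, x a)` to `(x b, x s)`. Intermediate values do not exceed
the final ones, so the bound on the numbers excludes nothing. Multiplication below is iterated
addition in the same way. -/
theorem add (a b s : α) : NDef c fun _ x => x s = x a + x b := by
  have : NDef c fun g (x : α → ℕ) => ∃ o < g.bound c, o = 0 ∧ Relation.ReflTransGen
      (fun u v : ℕ × ℕ => (v.1 < g.bound c ∧ v.2 < g.bound c) ∧ v.1 = u.1 + 1 ∧ v.2 = u.2 + 1)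
      (o, x a) (x b, x s) := ex (.and (zero _) (tc₂ (.and (succ _ _) (succ _ _)) _ _ _ _))
  refine this.congr fun g x _ hx => ?_
  have hB : 0 < g.bound c := (Nat.zero_le _).trans_lt (hx a)
  constructor
  · intro h
    refine ⟨0, hB, rfl, ?_⟩
    have key : ∀ n, x a + n < g.bound c → Relation.ReflTransGen
        (fun u v : ℕ × ℕ => (v.1 < g.bound c ∧ v.2 < g.bound c) ∧ v.1 = u.1 + 1 ∧ v.2 = u.2 + 1)
        (0, x a) (n, x a + n) := by
      intro n hn
      induction n with
      | zero => exact .refl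
      | succ n ih => exact (ih (by omega)).tail ⟨⟨by simp only; omega, hn⟩, rfl, rfl⟩
    rw [h]
    exact key _ (h ▸ hx s)
  · rintro ⟨_, -, rfl, h⟩
    have key : ∀ p : ℕ × ℕ, Relation.ReflTransGen
        (fun u v : ℕ × ℕ => (v.1 < g.bound c ∧ v.2 < g.bound c) ∧ v.1 = u.1 + 1 ∧ v.2 = u.2 + 1)
        (0, x a) p → p.2 = x a + p.1 := by
      intro p hp
      induction hp with
      | refl => rfl
      | tail _ h ih => omega
    exact key _ h

theorem mul (a b s : α) : NDef c fun _ x => x s = x a * x b := by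
  have : NDef c fun g (x : α → ℕ) => ∃ o < g.bound c, o = 0 ∧ Relation.ReflTransGen
      (fun u v : ℕ × ℕ => (v.1 < g.bound c ∧ v.2 < g.bound c) ∧ v.1 = u.1 + 1 ∧ v.2 = u.2 + x a)
      (o, o) (x b, x s) := ex (.and (zero _) (tc₂ (.and (succ _ _) (add _ _ _)) _ _ _ _))
  refine this.congr fun g x _ hx => ?_
  have hB : 0 < g.bound c := (Nat.zero_le _).trans_lt (hx a)
  constructor
  · intro h
    refine ⟨0, hB, rfl, ?_⟩
    have key : ∀ n, n ≤ x b → Relation.ReflTransGen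
        (fun u v : ℕ × ℕ => (v.1 < g.bound c ∧ v.2 < g.bound c) ∧ v.1 = u.1 + 1 ∧ v.2 = u.2 + x a)
        (0, 0) (n, x a * n) := by
      intro n hn
      induction n with
      | zero => exact .refl
      | succ n ih =>
        refine (ih (by omega)).tail ⟨⟨?_, ?_⟩, rfl, Nat.mul_succ _ _⟩
        · have := hx b
          simp only
          omega
        · have := hx s
          have := Nat.mul_le_mul_left (x a) hn
          simp only
          omega
    rw [h]
    exact key _ le_rfl
  · rintro ⟨_, -, rfl, h⟩
    have key : ∀ p : ℕ × ℕ, Relation.ReflTransGen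
        (fun u v : ℕ × ℕ => (v.1 < g.bound c ∧ v.2 < g.bound c) ∧ v.1 = u.1 + 1 ∧ v.2 = u.2 + x a)
        (0, 0) p → p.2 = x a * p.1 := by
      intro p hp
      induction hp with
      | refl => rfl
      | tail _ h ih => rw [h.2.1, h.2.2, ih, Nat.mul_succ]
    exact key _ h

theorem le (a b : α) : NDef c fun _ x => x a ≤ x b := by
  have : NDef c fun g (x : α → ℕ) => ∃ k < g.bound c, x b = x a + k := ex (add _ _ _)
  refine this.congr fun g x _ hx => ⟨fun h => ⟨x b - x a, ?_, by omega⟩, ?_⟩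
  · exact (Nat.sub_le _ _).trans_lt (hx b)
  · rintro ⟨k, -, h⟩
    omega

theorem lt (a b : α) : NDef c fun _ x => x a < x b := by
  have : NDef c fun g (x : α → ℕ) => ∃ k < g.bound c, k = x a + 1 ∧ k ≤ x b :=
    ex (.and (succ _ _) (le _ _))
  refine this.congr fun g x _ hx => ⟨fun h => ⟨x a + 1, by have := hx b; omega, rfl, h⟩, ?_⟩
  rintro ⟨_, -, rfl, h⟩
  exact h

end NDef

end NDJag

namespace NDJag

/-! ### The parameters and the edges of a grid, as relations on numbers -/

variable {g : GridIx}

/-- The number of the target of the edge labelled `j` out of the node with number `v`. -/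
noncomputable def edgeIdx (g : GridIx) (v j : ℕ) : ℕ :=
  if h : v < g.ℓ ^ g.d ∧ j < g.d then
    nodeIdx ((exists_nodeIdx_eq (d := g.d) h.1).choose + Pi.single ⟨j, h.2⟩ 1)
  else 0

theorem edgeIdx_nodeIdx (v : Fin g.d → ZMod g.ℓ) (j : Fin g.d) :
    edgeIdx g (nodeIdx v) j = nodeIdx (v + Pi.single j 1) := by
  have h : nodeIdx v < g.ℓ ^ g.d ∧ (j : ℕ) < g.d := ⟨nodeIdx_lt v, j.isLt⟩
  rw [edgeIdx, dif_pos h, nodeIdx_injective (exists_nodeIdx_eq (d := g.d) h.1).choose_spec]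

theorem edgeIdx_lt (v j : ℕ) : edgeIdx g v j < g.ℓ ^ g.d := by
  unfold edgeIdx
  split_ifs
  · exact nodeIdx_lt _
  · exact pow_pos (NeZero.pos _) _

theorem GridIx.size_lt_bound {c : ℕ} (hg : 2 ≤ g.size) : g.size < g.bound (c + 1) := by
  rw [GridIx.bound, pow_succ, pow_succ]
  calc g.size < g.size * g.size := by nlinarith
    _ ≤ g.size ^ c * g.size * g.size := by
      rw [mul_assoc]
      exact Nat.le_mul_of_pos_left _ (pow_pos g.size_pos _)

theorem GridIx.nodes_le_size : g.ℓ ^ g.d ≤ g.size := Nat.le_mul_of_pos_right _ (NeZero.pos _)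

theorem GridIx.degree_le_size : g.d ≤ g.size :=
  Nat.le_mul_of_pos_left _ (pow_pos (NeZero.pos _) _)


namespace NDef

variable {c : ℕ} {α : Type}

/-- The last label at the start node has position number `d - 1`, and `next` leads from it to the
origin. The predecessor is used because for `c = 0` the degree itself may fail to be below the
bound. -/
theorem pred_degree [Finite α] (a : α) : NDef c fun g x => x a + 1 = g.d := by
  refine ⟨_, .and (.ex (R := fun g x y => y = (0, 0) ∧ ((x (a, 0)).1, (x (a, 0)).2 + 1) = y)
    (.and (.eq_base none) (.next (some (a, 0)) none)))
    (.forall_finite fun i : Fin c => .eq_base (a, i.succ)), fun g _ x => ?_⟩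
  have hz : (-1 : Fin g.d) + 1 = 0 := by simp
  have e : g.d = posIdx ((0, -1) : g.Pos) + 1 := by
    rcases Fin.add_one_cases (-1 : Fin g.d) with ⟨-, h⟩ | ⟨h, -⟩
    · simpa [posIdx, nodeIdx_zero] using h.symm
    · exact absurd hz h
  have e' : num (c + 1) (fun i => x (a, i)) + 1 = g.d ↔
      num (c + 1) (fun i => x (a, i)) = posIdx ((0, -1) : g.Pos) := by
    omega
  refine Iff.trans ?_ (e'.trans num_eq_posIdx_iff).symm
  refine and_congr_left fun _ => ?_
  rw [exists_eq_left, Prod.ext_iff, Prod.ext_iff, ← eq_neg_iff_add_eq_zero]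

theorem pred_size [Finite α] (a : α) : NDef c fun g x => x a + 1 = g.size := by
  refine ⟨_, .and (.pos_last (a, 0)) (.forall_finite fun i : Fin c => .eq_base (a, i.succ)),
    fun g _ x => ?_⟩
  obtain ⟨u, hu⟩ := exists_posIdx_eq (Nat.pred_lt g.size_pos.ne')
  have h0 := g.size_pos
  rw [Nat.pred_eq_sub_one] at hu
  have e' : num (c + 1) (fun i => x (a, i)) + 1 = g.size ↔
      num (c + 1) (fun i => x (a, i)) = posIdx u := by
    omega
  refine Iff.trans ?_ (e'.trans num_eq_posIdx_iff).symm
  refine and_congr_left fun _ => ?_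
  rw [← posIdx_injective.eq_iff, hu]
  omega

theorem first_edge (a b : α) : NDef c fun g x => ∃ u : g.Pos, x a = posIdx u ∧
    x b = posIdx ((u.1 + Pi.single u.2 1, 0) : g.Pos) := by
  refine ⟨_, .and (.first (a, 0) (b, 0)) (.and
    (.forall_finite fun i : Fin c => .eq_base (a, i.succ))
    (.forall_finite fun i : Fin c => .eq_base (b, i.succ))), fun g _ x => ?_⟩
  simp only [num_eq_posIdx_iff]
  constructor
  · rintro ⟨h₁, h₂, h₃⟩
    exact ⟨_, ⟨rfl, h₂⟩, h₁.symm, h₃⟩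
  · rintro ⟨u, ⟨rfl, h₂⟩, h₁, h₃⟩
    exact ⟨h₁.symm, h₂, h₃⟩

variable [Finite α]

theorem degree (a : α) : NDef (c + 1) fun g x => x a = g.d := by
  have : NDef (c + 1) fun g (x : α → ℕ) => ∃ m < g.bound (c + 1), m + 1 = g.d ∧ x a = m + 1 :=
    ex (.and (pred_degree _) (succ _ _))
  refine this.congr fun g x _ hx => ⟨fun h => ⟨g.d - 1, ?_, ?_, ?_⟩, ?_⟩
  · have := hx a
    omega
  · exact Nat.succ_pred (NeZero.ne g.d)
  · rw [h]
    exact (Nat.succ_pred (NeZero.ne g.d)).symm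
  · rintro ⟨m, -, h₁, h₂⟩
    exact h₂.trans h₁

/-- The number of nodes is the only solution of `size = x a * d`; in this way division is replaced
by a test. -/
theorem node_count (a : α) : NDef (c + 1) fun g x => x a = g.ℓ ^ g.d := by
  have : NDef (c + 1) fun g (x : α → ℕ) => ∃ m < g.bound (c + 1), m + 1 = g.size ∧
      ∃ e < g.bound (c + 1), e = m + 1 ∧ ∃ d < g.bound (c + 1), d = g.d ∧ e = x a * d :=
    ex (.and (pred_size _) (ex (.and (succ _ _) (ex (.and (degree _) (mul _ _ _))))))
  refine this.congr fun g x hg _ => ⟨fun h => ?_, ?_⟩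
  · have h₀ := g.size_pos
    have h₁ := GridIx.size_lt_bound (c := c) hg
    have h₂ := g.degree_le_size
    refine ⟨g.size - 1, by omega, by omega, g.size, h₁, by omega, g.d, by omega, rfl, ?_⟩
    rw [h]
    rfl
  · rintro ⟨m, -, h₁, _, -, rfl, _, -, rfl, h₂⟩
    rw [h₁, GridIx.size] at h₂
    exact (Nat.eq_of_mul_eq_mul_right (NeZero.pos _) h₂).symm

/-- The edge `j` out of node `v` is position `v * d + j`, and `first` leads from it to the first
edge out of the target `u`, which is position `u * d`. The first alternative accounts for the
default value `0` outside the range. -/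
theorem edge (v j u : α) : NDef (c + 1) fun g x => x u = edgeIdx g (x v) (x j) := by
  have : NDef (c + 1) fun g (x : α → ℕ) => ∃ n < g.bound (c + 1), n = g.ℓ ^ g.d ∧
      ∃ d < g.bound (c + 1), d = g.d ∧ (((n ≤ x v ∨ d ≤ x j) ∧ x u = 0) ∨
        (x v < n ∧ x j < d ∧ ∃ m < g.bound (c + 1), m = x v * d ∧
          ∃ p < g.bound (c + 1), p = m + x j ∧ ∃ q < g.bound (c + 1), q = x u * d ∧
            ∃ w : g.Pos, p = posIdx w ∧ q = posIdx ((w.1 + Pi.single w.2 1, 0) : g.Pos))) :=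
    ex (.and (node_count _) (ex (.and (degree _) (.or (.and (.or (le _ _) (le _ _)) (zero _))
      (.and (lt _ _) (.and (lt _ _) (ex (.and (mul _ _ _) (ex (.and (add _ _ _)
      (ex (.and (mul _ _ _) (first_edge _ _)))))))))))))
  refine this.congr fun g x hg _ => ?_
  have h₁ := GridIx.size_lt_bound (c := c) hg
  have h₂ := g.degree_le_size
  have h₃ := g.nodes_le_size
  generalize x v = v
  generalize x j = j
  generalize x u = u
  by_cases h : v < g.ℓ ^ g.d ∧ j < g.d
  · obtain ⟨hv, hj⟩ := h
    obtain ⟨v, rfl⟩ := exists_nodeIdx_eq hv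
    obtain ⟨j, rfl⟩ : ∃ i : Fin g.d, j = i := ⟨⟨j, hj⟩, rfl⟩
    have hq := posIdx_lt ((v + Pi.single j 1, 0) : g.Pos)
    have hp := posIdx_lt ((v, j) : g.Pos)
    rw [edgeIdx_nodeIdx]
    constructor
    · rintro rfl
      refine ⟨_, by omega, rfl, _, by omega, rfl, .inr ⟨hv, hj, nodeIdx v * g.d, ?_, rfl,
        nodeIdx v * g.d + j, ?_, rfl, nodeIdx (v + Pi.single j 1) * g.d, ?_, rfl, (v, j), rfl, ?_⟩⟩
      · refine lt_of_le_of_lt ?_ (hp.trans h₁)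
        simp [posIdx]
      · exact hp.trans h₁
      · simp only [posIdx, Fin.val_zero, add_zero] at hq
        exact hq.trans h₁
      · simp [posIdx]
    · rintro ⟨_, -, rfl, _, -, rfl, ⟨h | h, -⟩ | ⟨-, -, _, -, rfl, _, -, rfl, _, -, rfl, w, hw, h⟩⟩
      · omega
      · omega
      · obtain rfl : (v, j) = w := posIdx_injective hw
        simp only [posIdx, Fin.val_zero, add_zero] at h
        exact Nat.eq_of_mul_eq_mul_right (NeZero.pos _) h
  · rw [edgeIdx, dif_neg h]
    constructor
    · rintro rfl
      exact ⟨_, by omega, rfl, _, by omega, rfl, .inl ⟨by omega, rfl⟩⟩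
    · rintro ⟨_, -, rfl, _, -, rfl, ⟨-, h'⟩ | ⟨h₁, h₂, -⟩⟩
      · exact h'
      · exact absurd ⟨h₁, h₂⟩ h

end NDef

/-! ### Words with recognisable letters -/

/-- The words `W` depending on numbers are recognisable: the relations `b = a + |W|` and
"`k = a + r`, and `W` has the letter `β` at position `r`" are. -/
def WDef (c : ℕ) {α : Type} (W : ∀ _ : GridIx, (α → ℕ) → List Bool) : Prop :=
  (NDef c (α := Option (Option α)) fun g x =>
    x none = x (some none) + (W g fun a => x (some (some a))).length) ∧
  ∀ β : Bool, NDef c (α := Option (Option α)) fun g x =>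
    ∃ r, x none = x (some none) + r ∧ (W g fun a => x (some (some a)))[r]? = some β

namespace WDef

variable {c : ℕ} {α γ : Type} {W W₁ W₂ : ∀ _ : GridIx, (α → ℕ) → List Bool}

theorem length (h : WDef c W) (f : α → γ) (a b : γ) :
    NDef c fun g x => x b = x a + (W g fun i => x (f i)).length :=
  h.1.rename fun o => o.elim b fun o => o.elim a f

theorem letter (h : WDef c W) (β : Bool) (f : α → γ) (a k : γ) :
    NDef c fun g x => ∃ r, x k = x a + r ∧ (W g fun i => x (f i))[r]? = some β :=
  (h.2 β).rename fun o => o.elim k fun o => o.elim a f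

variable [Finite α]

theorem append (h₁ : WDef c W₁) (h₂ : WDef c W₂) : WDef c fun g x => W₁ g x ++ W₂ g x := by
  constructor
  · have : NDef c fun g (x : Option (Option α) → ℕ) => ∃ m < g.bound c,
        m = x (some none) + (W₁ g fun a => x (some (some a))).length ∧
        x none = m + (W₂ g fun a => x (some (some a))).length :=
      .ex (.and (h₁.length (fun a => some (some (some a))) _ _)
        (h₂.length (fun a => some (some (some a))) _ _))
    refine this.congr fun g x _ hx => ?_
    rw [List.length_append, ← add_assoc]
    constructor
    · intro h
      exact ⟨_, by have := hx none; omega, rfl, h⟩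
    · rintro ⟨_, -, rfl, h⟩
      exact h
  · intro β
    have : NDef c fun g (x : Option (Option α) → ℕ) =>
        (∃ r, x none = x (some none) + r ∧ (W₁ g fun a => x (some (some a)))[r]? = some β) ∨
        ∃ m < g.bound c, m = x (some none) + (W₁ g fun a => x (some (some a))).length ∧
        ∃ r, x none = m + r ∧ (W₂ g fun a => x (some (some a)))[r]? = some β :=
      .or (h₁.2 β) (.ex (.and (h₁.length (fun a => some (some (some a))) _ _)
        (h₂.letter β (fun a => some (some (some a))) _ _)))
    refine this.congr fun g x _ hx => ?_
    constructor
    · rintro ⟨r, h, h'⟩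
      rw [List.getElem?_append] at h'
      split_ifs at h' with hr
      · exact .inl ⟨r, h, h'⟩
      · exact .inr ⟨_, by have := hx none; omega, rfl, _, by omega, h'⟩
    · rintro (⟨r, h, h'⟩ | ⟨_, -, rfl, r, h, h'⟩)
      · refine ⟨r, h, ?_⟩
        rw [List.getElem?_append_left, h']
        exact (List.getElem?_eq_some_iff.1 h').1
      · refine ⟨_, by rw [h, add_assoc], ?_⟩
        rw [List.getElem?_append_right (Nat.le_add_right _ _), Nat.add_sub_cancel_left, h']

theorem _root_.NDJag.unary_getElem?_true (n r : ℕ) : (unary n)[r]? = some true ↔ r < n := by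
  rw [unary, List.getElem?_append]
  split_ifs with h
  · rw [List.getElem?_replicate]
    simp only [List.length_replicate] at h
    simp [h]
  · simp only [List.length_replicate] at h ⊢
    rw [List.getElem?_singleton]
    split_ifs <;> simp [h]

theorem _root_.NDJag.length_unary (n : ℕ) : (unary n).length = n + 1 := by
  simp [unary]

theorem _root_.NDJag.unary_getElem?_false (n r : ℕ) : (unary n)[r]? = some false ↔ r = n := by
  rw [unary, List.getElem?_append]
  split_ifs with h
  · rw [List.getElem?_replicate]
    simp only [List.length_replicate] at h
    simp [h, h.ne]
  · simp only [List.length_replicate] at h ⊢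
    rw [List.getElem?_singleton]
    split_ifs with h' <;> simp <;> omega

theorem unary_of {F : ∀ _ : GridIx, (α → ℕ) → ℕ}
    (hF : NDef c fun g (z : Option α → ℕ) => z none = F g fun a => z (some a))
    (hB : ∀ g x, 2 ≤ g.size → (∀ a, x a < g.bound c) → F g x < g.bound c) :
    WDef c fun g x => unary (F g x) := by
  have hF' : NDef c fun g (z : Option (Option (Option α)) → ℕ) =>
    z none = F g fun a => z (some (some (some a))) :=
    hF.rename fun o => o.elim none fun a => some (some (some a))
  constructor
  · have : NDef c fun g (x : Option (Option α) → ℕ) => ∃ n < g.bound c,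
        (n = F g fun a => x (some (some a))) ∧ ∃ m < g.bound c, m = x (some none) + n ∧
        x none = m + 1 :=
      .ex (.and hF' (.ex (.and (.add _ _ _) (.succ _ _))))
    refine this.congr fun g x _ hx => ?_
    rw [length_unary]
    constructor
    · intro h
      have := hx none
      exact ⟨_, by omega, rfl, _, by omega, rfl, h⟩
    · rintro ⟨_, -, rfl, _, -, rfl, h⟩
      exact h
  · rintro (_ | _)
    · have : NDef c fun g (x : Option (Option α) → ℕ) => ∃ n < g.bound c,
          (n = F g fun a => x (some (some a))) ∧ x none = x (some none) + n :=
        .ex (.and hF' (.add _ _ _))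
      refine this.congr fun g x hg hx => ?_
      simp only [unary_getElem?_false]
      constructor
      · rintro ⟨_, h, rfl⟩
        exact ⟨_, hB _ _ hg fun a => hx _, rfl, h⟩
      · rintro ⟨_, -, rfl, h⟩
        exact ⟨_, h, rfl⟩
    · have : NDef c fun g (x : Option (Option α) → ℕ) => ∃ n < g.bound c,
          (n = F g fun a => x (some (some a))) ∧ ∃ r < g.bound c, r < n ∧
            x none = x (some none) + r :=
        .ex (.and hF' (.ex (.and (.lt _ _) (.add _ _ _))))
      refine this.congr fun g x hg hx => ?_
      simp only [unary_getElem?_true]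
      constructor
      · rintro ⟨r, h, h'⟩
        have := hx none
        exact ⟨_, hB _ _ hg fun a => hx _, rfl, r, by omega, h', h⟩
      · rintro ⟨_, -, rfl, r, -, h', h⟩
        exact ⟨r, h, h'⟩

theorem _root_.NDJag.flatMap_range_add (f : ℕ → List Bool) (n k : ℕ) :
    ∃ l, (List.range (n + k)).flatMap f = (List.range n).flatMap f ++ l := by
  rw [List.range_add, List.flatMap_append]
  exact ⟨_, rfl⟩

theorem _root_.NDJag.flatMap_range_succ (f : ℕ → List Bool) (n : ℕ) :
    (List.range (n + 1)).flatMap f = (List.range n).flatMap f ++ f n := by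
  rw [List.range_succ, List.flatMap_append, List.flatMap_singleton]

theorem _root_.NDJag.getElem?_flatMap_range (f : ℕ → List Bool) (n r : ℕ) (β : Bool) :
    ((List.range n).flatMap f)[r]? = some β ↔ ∃ v < n, ∃ r',
      r = ((List.range v).flatMap f).length + r' ∧ (f v)[r']? = some β := by
  constructor
  · intro h
    induction n with
    | zero => simp at h
    | succ n ih =>
      rw [flatMap_range_succ, List.getElem?_append] at h
      split_ifs at h with hr
      · obtain ⟨v, hv, h⟩ := ih h
        exact ⟨v, by omega, h⟩
      · exact ⟨n, by omega, _, by omega, h⟩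
  · rintro ⟨v, hv, r', rfl, h⟩
    obtain ⟨k, rfl⟩ := Nat.exists_eq_add_of_le (Nat.succ_le_of_lt hv)
    obtain ⟨l, hl⟩ := flatMap_range_add f (v + 1) k
    have h' := (List.getElem?_eq_some_iff.1 h).1
    rw [Nat.succ_eq_add_one, hl, flatMap_range_succ, List.append_assoc,
      List.getElem?_append_right (Nat.le_add_right _ _), Nat.add_sub_cancel_left,
      List.getElem?_append_left h', h]

/-- The offset at which block `v` begins is found by running through the blocks and adding their
lengths. A letter of the concatenation is a letter of a guessed block, counted from the offset of
that block. -/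
theorem flatMap_range {F : ∀ _ : GridIx, (α → ℕ) → ℕ}
    {W : ∀ _ : GridIx, (α → ℕ) → ℕ → List Bool}
    (hF : NDef c fun g (z : Option α → ℕ) => z none = F g fun a => z (some a))
    (hB : ∀ g x, 2 ≤ g.size → (∀ a, x a < g.bound c) → F g x < g.bound c)
    (h : WDef c fun g (z : Option α → ℕ) => W g (fun a => z (some a)) (z none)) :
    WDef c fun g x => (List.range (F g x)).flatMap (W g x) := by
  have hF' : NDef c fun g (z : Option (Option (Option α)) → ℕ) =>
    z none = F g fun a => z (some (some (some a))) :=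
    hF.rename fun o => o.elim none fun a => some (some (some a))
  -- Pairs (number of a block, its offset), starting with `(0, x a)`.
  have step : ∀ {γ : Type} [Finite γ] (f : α → γ) (a v p : γ), NDef c fun g (x : γ → ℕ) =>
      ∃ o < g.bound c, o = 0 ∧ Relation.ReflTransGen (fun s t : ℕ × ℕ =>
        (t.1 < g.bound c ∧ t.2 < g.bound c) ∧ t.1 = s.1 + 1 ∧
          t.2 = s.2 + (W g (fun i => x (f i)) s.1).length) (o, x a) (x v, x p) := by
    intro γ _ f a v p
    refine .ex (.and (.zero _) (.tc₂ (.and (.succ _ _) ?_) _ _ _ _))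
    exact h.length (fun o : Option α => o.elim (some (some (some none)))
      fun i => some (some (some (some (some (f i)))))) _ _
  have step_iff : ∀ (g : GridIx) (y : α → ℕ) (a v p : ℕ), a < g.bound c → v < g.bound c →
      p < g.bound c → ((∃ o < g.bound c, o = 0 ∧ Relation.ReflTransGen (fun s t : ℕ × ℕ =>
        (t.1 < g.bound c ∧ t.2 < g.bound c) ∧ t.1 = s.1 + 1 ∧
          t.2 = s.2 + (W g y s.1).length) (o, a) (v, p)) ↔
      p = a + ((List.range v).flatMap (W g y)).length) := by
    intro g y a v p ha hv hp
    constructor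
    · rintro ⟨_, -, rfl, h⟩
      have key : ∀ q : ℕ × ℕ, Relation.ReflTransGen (fun s t : ℕ × ℕ =>
          (t.1 < g.bound c ∧ t.2 < g.bound c) ∧ t.1 = s.1 + 1 ∧
            t.2 = s.2 + (W g y s.1).length) (0, a) q →
          q.2 = a + ((List.range q.1).flatMap (W g y)).length := by
        intro q hq
        induction hq with
        | refl => simp
        | tail _ h ih =>
          rw [h.2.2, h.2.1, ih, List.range_succ, List.flatMap_append, List.length_append]
          simp [add_assoc]
      exact key _ h
    · intro h
      refine ⟨0, by omega, rfl, ?_⟩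
      have key : ∀ n, n ≤ v → Relation.ReflTransGen (fun s t : ℕ × ℕ =>
          (t.1 < g.bound c ∧ t.2 < g.bound c) ∧ t.1 = s.1 + 1 ∧
            t.2 = s.2 + (W g y s.1).length) (0, a)
          (n, a + ((List.range n).flatMap (W g y)).length) := by
        intro n hn
        induction n with
        | zero => simpa using .refl
        | succ n ih =>
          have hle : ((List.range (n + 1)).flatMap (W g y)).length ≤
              ((List.range v).flatMap (W g y)).length := by
            obtain ⟨k, rfl⟩ := Nat.exists_eq_add_of_le hn
            obtain ⟨l, hl⟩ := flatMap_range_add (W g y) (n + 1) k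
            rw [hl, List.length_append]
            exact Nat.le_add_right _ _
          refine (ih (by omega)).tail ⟨⟨by simp only; omega, by simp only; omega⟩, rfl, ?_⟩
          simp [List.range_succ, List.flatMap_append, add_assoc]
      rw [h]
      exact key v le_rfl
  constructor
  · have : NDef c fun g (x : Option (Option α) → ℕ) => ∃ n < g.bound c,
        (n = F g fun a => x (some (some a))) ∧ ∃ o < g.bound c, o = 0 ∧
          Relation.ReflTransGen (fun s t : ℕ × ℕ =>
            (t.1 < g.bound c ∧ t.2 < g.bound c) ∧ t.1 = s.1 + 1 ∧
              t.2 = s.2 + (W g (fun i => x (some (some i))) s.1).length)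
            (o, x (some none)) (n, x none) :=
      .ex (.and hF' (step (fun i => some (some (some i))) _ _ _))
    refine this.congr fun g x hg hx => ?_
    have hB' := hB g (fun a => x (some (some a))) hg fun a => hx _
    constructor
    · intro h
      exact ⟨_, hB', rfl, (step_iff _ _ _ _ _ (hx _) hB' (hx _)).2 h⟩
    · rintro ⟨_, hn, rfl, h⟩
      exact (step_iff _ _ _ _ _ (hx _) hn (hx _)).1 h
  · intro β
    have : NDef c fun g (x : Option (Option α) → ℕ) => ∃ n < g.bound c,
        (n = F g fun a => x (some (some a))) ∧ ∃ v < g.bound c, v < n ∧ ∃ p < g.bound c,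
          (∃ o < g.bound c, o = 0 ∧ Relation.ReflTransGen (fun s t : ℕ × ℕ =>
            (t.1 < g.bound c ∧ t.2 < g.bound c) ∧ t.1 = s.1 + 1 ∧
              t.2 = s.2 + (W g (fun i => x (some (some i))) s.1).length)
            (o, x (some none)) (v, p)) ∧
          ∃ r, x none = p + r ∧ (W g (fun i => x (some (some i))) v)[r]? = some β :=
      .ex (.and hF' (.ex (.and (.lt _ _) (.ex (.and
        (step (fun i => some (some (some (some (some i))))) _ _ _)
        (h.letter β (fun o => o.elim (some none)
          fun i => some (some (some (some (some i))))) _ _))))))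
    refine this.congr fun g x hg hx => ?_
    have hB' := hB g (fun a => x (some (some a))) hg fun a => hx _
    have hx' := hx none
    simp only [getElem?_flatMap_range]
    constructor
    · rintro ⟨_, h, v, hv, r, rfl, h'⟩
      exact ⟨_, hB', rfl, v, by omega, hv, _, by omega,
        (step_iff _ _ _ _ _ (hx _) (by omega) (by omega)).2 rfl, r, by omega, h'⟩
    · rintro ⟨_, hn, rfl, v, hv, hv', p, hp, hs, r, hr, h'⟩
      have := (step_iff _ _ _ _ _ (hx _) hv hp).1 hs
      exact ⟨_, by rw [hr, this, add_assoc], v, hv', r, rfl, h'⟩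

end WDef

/-- The encoding of a grid, when the number of the target node is `t`. -/
noncomputable def gridWord (g : GridIx) (t : ℕ) : List Bool :=
  unary (g.ℓ ^ g.d) ++ unary g.d ++ unary 0 ++ unary t ++
    (List.range (g.ℓ ^ g.d)).flatMap fun v => (List.range g.d).flatMap fun j =>
      unary (edgeIdx g v j)

theorem wdef_gridWord (c : ℕ) {α : Type} [Finite α] (t : α) :
    WDef (c + 1) fun g x => gridWord g (x t) := by
  have hn : ∀ g : GridIx, 2 ≤ g.size → g.ℓ ^ g.d < g.bound (c + 1) := fun g hg =>
    g.nodes_le_size.trans_lt (GridIx.size_lt_bound hg)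
  have hd : ∀ g : GridIx, 2 ≤ g.size → g.d < g.bound (c + 1) := fun g hg =>
    g.degree_le_size.trans_lt (GridIx.size_lt_bound hg)
  refine .append (.append (.append (.append (.unary_of (.node_count _) fun g _ hg _ => hn g hg)
    (.unary_of (.degree _) fun g _ hg _ => hd g hg)) (.unary_of (.zero _) fun g _ hg _ => ?_))
    (.unary_of (F := fun _ x => x t) (.eq _ _) fun g _ _ hx => hx _))
    (.flatMap_range (.node_count _) (fun g _ hg _ => hn g hg)
      (.flatMap_range (.degree _) (fun g _ hg _ => hd g hg)
        (.unary_of (.edge _ _ _) fun g _ hg _ => (edgeIdx_lt _ _).trans (hn g hg))))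
  exact (Nat.zero_le _).trans_lt (hn g hg)

end NDJag

namespace NDJag

/-! ### Tapes as numbers -/

/-- The number with digits `a 0, …, a (n - 1)` in base `G`, the least significant digit first. -/
def digitSum (G : ℕ) (n : ℕ) (a : ℕ → ℕ) : ℕ := ∑ i ∈ Finset.range n, a i * G ^ i

theorem digitSum_succ (G n : ℕ) (a : ℕ → ℕ) :
    digitSum G (n + 1) a = digitSum G n a + a n * G ^ n := Finset.sum_range_succ _ _

theorem digitSum_lt {G n : ℕ} {a : ℕ → ℕ} (ha : ∀ i, a i < G) : digitSum G n a < G ^ n := by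
  induction n with
  | zero => simp [digitSum]
  | succ n ih =>
    rw [digitSum_succ, pow_succ']
    have := Nat.mul_le_mul_right (G ^ n) (Nat.succ_le_of_lt (ha n))
    rw [Nat.succ_mul] at this
    omega

theorem digitSum_div_mod {G n : ℕ} {a : ℕ → ℕ} (ha : ∀ i, a i < G) {p : ℕ} (hp : p < n) :
    digitSum G n a / G ^ p % G = a p := by
  have hG : 0 < G := (Nat.zero_le _).trans_lt (ha 0)
  induction n with
  | zero => omega
  | succ n ih =>
    rw [digitSum_succ]
    rcases Nat.lt_succ_iff_lt_or_eq.1 hp with h | rfl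
    · obtain ⟨k, rfl⟩ := Nat.exists_eq_add_of_lt h
      rw [show a (p + k + 1) * G ^ (p + k + 1) = G ^ p * (G * (a (p + k + 1) * G ^ k)) by ring,
        Nat.add_mul_div_left _ _ (pow_pos hG _), Nat.add_mul_mod_self_left, ih h]
    · rw [mul_comm, Nat.add_mul_div_left _ _ (pow_pos hG _), Nat.div_eq_of_lt (digitSum_lt ha),
        zero_add, Nat.mod_eq_of_lt (ha _)]

theorem digitSum_update {G n p : ℕ} (hp : p < n) (a : ℕ → ℕ) (b : ℕ) :
    digitSum G n (Function.update a p b) + a p * G ^ p = digitSum G n a + b * G ^ p := by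
  have hp' : p ∈ Finset.range n := Finset.mem_range.2 hp
  rw [digitSum, digitSum, ← Finset.add_sum_erase _ _ hp', ← Finset.add_sum_erase _ _ hp',
    Function.update_self]
  rw [Finset.sum_congr rfl fun i hi => by rw [Function.update_of_ne (Finset.ne_of_mem_erase hi)]]
  omega

theorem length_gridWord_le {g : GridIx} (hg : 2 ≤ g.size) {t : ℕ} (ht : t ≤ g.ℓ ^ g.d) :
    (gridWord g t).length ≤ g.size ^ 5 := by
  have h₁ := g.degree_le_size
  have h₂ := g.nodes_le_size
  have h₃ : ((List.range (g.ℓ ^ g.d)).flatMap fun v => (List.range g.d).flatMap fun j =>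
      unary (edgeIdx g v j)).length ≤ g.size * g.size := by
    rw [List.length_flatMap]
    have : ∀ v, ((List.range g.d).flatMap fun j => unary (edgeIdx g v j)).length ≤
        g.d * g.ℓ ^ g.d := by
      intro v
      rw [List.length_flatMap]
      refine (List.sum_le_card_nsmul _ (g.ℓ ^ g.d) fun x hx => ?_).trans (by simp)
      obtain ⟨j, -, rfl⟩ := List.mem_map.1 hx
      rw [length_unary]
      exact edgeIdx_lt _ _
    refine (List.sum_le_card_nsmul _ (g.d * g.ℓ ^ g.d) fun x hx => ?_).trans ?_
    · obtain ⟨v, -, rfl⟩ := List.mem_map.1 hx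
      exact this v
    · simp only [List.length_map, List.length_range, smul_eq_mul]
      rw [← mul_assoc]
      exact Nat.mul_le_mul_left _ h₂
  simp only [gridWord, List.length_append, length_unary]
  generalize g.size = E at *
  have h₄ : 8 * (E * E) ≤ E ^ 5 := by
    have h8 : 2 ^ 3 ≤ E ^ 3 := Nat.pow_le_pow_left hg 3
    calc 8 * (E * E) ≤ E ^ 3 * (E * E) := Nat.mul_le_mul_right _ h8
      _ = E ^ 5 := by ring
  nlinarith

namespace NDef

variable {c : ℕ} {α : Type} [Finite α]

theorem mul_const (n : ℕ) (a b : α) : NDef c fun _ x => x b = n * x a := by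
  induction n generalizing α with
  | zero => exact (zero b).congr fun g x _ _ => by rw [zero_mul]
  | succ n ih =>
    have : NDef c fun g (x : α → ℕ) => ∃ m < g.bound c, m = n * x a ∧ x b = m + x a :=
      ex (.and (ih _ _) (add _ _ _))
    refine this.congr fun g x _ hx => ?_
    rw [Nat.succ_mul]
    constructor
    · intro h
      have := hx b
      exact ⟨_, by omega, rfl, h⟩
    · rintro ⟨_, -, rfl, h⟩
      exact h

theorem digit (G n : ℕ) (hn : n < G) (a b : α) :
    NDef c fun _ x => 0 < x b ∧ x a / x b % G = n := by
  have : NDef c fun g (x : α → ℕ) => ∃ hi < g.bound c, ∃ lo < g.bound c, lo < x b ∧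
      ∃ p < g.bound c, p = G * hi ∧ ∃ k < g.bound c, k = n ∧ ∃ q < g.bound c, q = p + k ∧
      ∃ r < g.bound c, r = q * x b ∧ x a = r + lo :=
    ex (ex (.and (lt _ _) (ex (.and (mul_const _ _ _) (ex (.and (nat_const _ _)
      (ex (.and (add _ _ _) (ex (.and (mul _ _ _) (add _ _ _)))))))))))
  refine this.congr fun g x _ hx => ?_
  have ha := hx a
  generalize x a = T at *
  generalize x b = X at *
  constructor
  · rintro ⟨hX, rfl⟩
    have e₁ := Nat.div_add_mod (T / X) G
    have e₂ := Nat.div_add_mod T X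
    have e₃ := Nat.mod_lt T hX
    have e₄ := Nat.div_le_self T X
    have e₅ := Nat.div_le_self (T / X) G
    have e₆ := Nat.mod_le T X
    refine ⟨T / X / G, by omega, T % X, by omega, e₃, _, by omega, rfl, _, by omega, rfl, _,
      by omega, rfl, _, ?_, rfl, ?_⟩
    · rw [e₁, mul_comm]
      omega
    · rw [e₁, mul_comm]
      exact e₂.symm
  · rintro ⟨hi, -, lo, -, hlo, _, -, rfl, _, -, rfl, _, -, rfl, _, -, rfl, rfl⟩
    have hX : 0 < X := (Nat.zero_le _).trans_lt hlo
    refine ⟨hX, ?_⟩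
    rw [mul_comm, Nat.mul_add_div hX, Nat.div_eq_of_lt hlo, add_zero, Nat.mul_add_mod,
      Nat.mod_eq_of_lt hn]

end NDef

/-! ### Simulation of Turing machines -/

instance : Finite InSym :=
  Finite.of_surjective (fun o : Option (Option Bool) =>
    o.elim InSym.left fun o => o.elim InSym.right InSym.bit) (by
      rintro (_ | _ | b)
      exacts [⟨none, rfl⟩, ⟨some none, rfl⟩, ⟨some (some b), rfl⟩])

instance : Finite Dir :=
  Finite.of_surjective (fun o : Option Bool => o.elim Dir.left fun b =>
    bif b then Dir.stay else Dir.right) (by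
      rintro (_ | _ | _)
      exacts [⟨none, rfl⟩, ⟨some true, rfl⟩, ⟨some false, rfl⟩])

namespace NTM

variable (M : NTM)

attribute [instance] NTM.finQ NTM.finΓ

/-- A number for each state. -/
noncomputable def stateCode (q : M.Q) : ℕ := Finite.equivFin M.Q q

open Classical in
/-- A number for each tape symbol; the number of the blank is `0`. -/
noncomputable def symCode (a : M.Γ) : ℕ := if a = M.blank then 0 else Finite.equivFin M.Γ a + 1

/-- The base for coding tapes. -/
noncomputable def base : ℕ := Nat.card M.Γ + 1

theorem stateCode_injective : M.stateCode.Injective := fun _ _ h =>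
  (Finite.equivFin M.Q).injective (Fin.ext h)

theorem stateCode_lt (q : M.Q) : M.stateCode q < Nat.card M.Q := Fin.isLt _

theorem symCode_injective : M.symCode.Injective := by
  intro a b h
  unfold symCode at h
  split_ifs at h with ha hb
  · rw [ha, hb]
  · exact (Finite.equivFin M.Γ).injective (Fin.ext (Nat.succ_injective h))

theorem symCode_lt (a : M.Γ) : M.symCode a < M.base := by
  unfold symCode base
  have := (Finite.equivFin M.Γ a).isLt
  split_ifs <;> omega

theorem symCode_blank : M.symCode M.blank = 0 := if_pos rfl

theorem two_le_base : 2 ≤ M.base := by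
  have : Nonempty M.Γ := ⟨M.blank⟩
  have : 0 < Nat.card M.Γ := Nat.card_pos
  unfold base
  omega

/-- The numbers that represent a configuration: state, input position, work tape, and the power of
the base for the position on the work tape. -/
noncomputable def code (n : ℕ) (x : M.Config) : Fin 4 → ℕ :=
  ![M.stateCode x.state, x.inPos, digitSum M.base n fun i => M.symCode (x.work i),
    M.base ^ x.workPos]

/-- The effect of a movement of the work head on the power of the base for its position. -/
def MovePow (G : ℕ) : Dir → ℕ → ℕ → Prop
  | .left, X, Y => (X = 1 ∧ Y = 1) ∨ X = G * Y
  | .stay, X, Y => Y = X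
  | .right, X, Y => Y = G * X

/-- A base of at least `2` makes the head position readable from its power. In particular `1` is no
multiple of the base, so the two cases of a left move, at the left end and elsewhere, exclude each
other. -/
theorem movePow_iff {G : ℕ} (hG : 2 ≤ G) (D : Dir) (p Y : ℕ) :
    MovePow G D (G ^ p) Y ↔ Y = G ^ D.apply p := by
  cases D with
  | left =>
    rcases p with _ | p
    · simp only [MovePow, pow_zero, true_and, Dir.apply, Nat.zero_sub, or_iff_left_iff_imp]
      intro h
      exact absurd (Nat.dvd_one.1 ⟨Y, h⟩) (by omega)
    · simp only [MovePow, Dir.apply, Nat.add_sub_cancel]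
      constructor
      · rintro (⟨h, -⟩ | h)
        · have := Nat.one_lt_pow (Nat.succ_ne_zero p) hG
          exact absurd h (by rw [Nat.succ_eq_add_one] at this; omega)
        · rw [pow_succ'] at h
          exact (Nat.eq_of_mul_eq_mul_left (by omega) h).symm
      · rintro rfl
        exact .inr (pow_succ' _ _)
  | stay => rfl
  | right =>
    simp only [MovePow, Dir.apply, pow_succ']

/-- One step of `M` on numbers that represent configurations, with the input word `w`. -/
def NumStep (B : ℕ) (w : List Bool) (u v : Fin 4 → ℕ) : Prop :=
  ∃ (q : M.Q) (a : InSym) (γ : M.Γ) (m : M.Q × M.Γ × Dir × Dir), m ∈ M.δ q a γ ∧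
    u 0 = M.stateCode q ∧ v 0 = M.stateCode m.1 ∧ inputSymbol w (u 1) = a ∧
    v 1 = min (m.2.2.1.apply (u 1)) (w.length + 1) ∧
    (0 < u 3 ∧ u 2 / u 3 % M.base = M.symCode γ) ∧
    (v 2 + M.symCode γ * u 3 = u 2 + M.symCode m.2.1 * u 3 ∧
      u 2 + M.symCode m.2.1 * u 3 < B) ∧
    MovePow M.base m.2.2.2 (u 3) (v 3)

variable {M}

/-- The head stands on one of the `n` coded cells, so the symbol read is a digit of the tape number
and writing changes only this digit. The additional factor in `hB` is needed for the sum `T + b *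
base ^ workPos`, in which the new digit is added before the old one is removed: it is less than `2 *
base ^ n`. -/
theorem numStep_code {B n : ℕ} {w : List Bool} (hB : M.base ^ (n + 1) ≤ B) {x : M.Config}
    (hx : x.workPos < n) {v : Fin 4 → ℕ} :
    M.NumStep B w (M.code n x) v ↔ ∃ y, M.Step w x y ∧ v = M.code n y := by
  have hG := M.two_le_base
  set T := digitSum M.base n fun i => M.symCode (x.work i) with hT
  have hdig : T / M.base ^ x.workPos % M.base = M.symCode (x.work x.workPos) :=
    digitSum_div_mod (fun i => M.symCode_lt _) hx
  have hpos : 0 < M.base ^ x.workPos := pow_pos (by omega) _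
  have hcode : M.code n x = ![M.stateCode x.state, x.inPos, T, M.base ^ x.workPos] := rfl
  have hupd : ∀ b : M.Γ, digitSum M.base n (fun i => M.symCode
      (Function.update x.work x.workPos b i)) + M.symCode (x.work x.workPos) * M.base ^ x.workPos =
      T + M.symCode b * M.base ^ x.workPos := by
    intro b
    rw [hT, ← digitSum_update hx (fun i => M.symCode (x.work i)) (M.symCode b)]
    congr 2
    funext i
    by_cases hi : i = x.workPos
    · subst hi
      simp
    · simp [hi]
  have hlt : ∀ b : M.Γ, T + M.symCode b * M.base ^ x.workPos < B := by
    intro b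
    refine lt_of_lt_of_le ?_ hB
    have h₁ : T < M.base ^ n := digitSum_lt fun i => M.symCode_lt _
    have h₂ : M.symCode b * M.base ^ x.workPos < M.base ^ n := by
      calc M.symCode b * M.base ^ x.workPos < M.base * M.base ^ x.workPos :=
            Nat.mul_lt_mul_of_pos_right (M.symCode_lt b) hpos
        _ = M.base ^ (x.workPos + 1) := (pow_succ' _ _).symm
        _ ≤ M.base ^ n := Nat.pow_le_pow_right (by omega) hx
    have h₃ : 2 * M.base ^ n ≤ M.base ^ (n + 1) := by
      rw [pow_succ']
      exact Nat.mul_le_mul_right _ hG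
    omega
  constructor
  · rintro ⟨q, a, γ, m, hm, h₁, h₂, h₃, h₄, h₅, h₆, h₇⟩
    simp only [hcode, Matrix.cons_val] at h₁ h₃ h₄ h₅ h₆ h₇
    obtain rfl := M.stateCode_injective h₁
    subst h₃
    obtain rfl : x.work x.workPos = γ := M.symCode_injective (hdig.symm.trans h₅.2)
    refine ⟨_, ⟨m, hm, rfl⟩, ?_⟩
    rw [movePow_iff hG] at h₇
    have h₈ := hupd m.2.1
    funext k
    fin_cases k
    · exact h₂
    · exact h₄
    · change v 2 = digitSum M.base n (fun i => M.symCode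
        (Function.update x.work x.workPos m.2.1 i))
      omega
    · exact h₇
  · rintro ⟨_, ⟨m, hm, rfl⟩, rfl⟩
    refine ⟨_, _, _, m, hm, rfl, rfl, rfl, rfl, ⟨hpos, hdig⟩, ⟨hupd _, hlt _⟩, ?_⟩
    exact (movePow_iff hG _ _ _).2 rfl

theorem ReachableConfig.inPos_le {w : List Bool} {x : M.Config} (h : M.ReachableConfig w x) :
    x.inPos ≤ w.length + 1 := by
  induction h with
  | refl => simp [initial]
  | tail _ h _ =>
    obtain ⟨m, -, rfl⟩ := h
    exact min_le_right _ _

theorem accepts_iff_num {B n : ℕ} {w : List Bool} (hB : M.base ^ (n + 1) ≤ B)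
    (hw : w.length + 1 < B) (hQ : ∀ q, M.stateCode q < B)
    (hn : ∀ x, M.ReachableConfig w x → x.workPos < n) :
    M.Accepts w ↔ ∃ v : Fin 4 → ℕ, (∀ k, v k < B) ∧ v 0 = M.stateCode M.qₐ ∧
      Relation.ReflTransGen (fun u v => (∀ k, v k < B) ∧ M.NumStep B w u v)
        ![M.stateCode M.q₀, 1, 0, 1] v := by
  have hG := M.two_le_base
  have hinit : M.code n M.initial = ![M.stateCode M.q₀, 1, 0, 1] := by
    funext k
    fin_cases k
    · rfl
    · rfl
    · change digitSum M.base n (fun _ => M.symCode M.blank) = 0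
      rw [symCode_blank]
      simp [digitSum]
    · rfl
  have hbd : ∀ x, M.ReachableConfig w x → ∀ k, M.code n x k < B := by
    intro x hx k
    have hp : M.base ^ n ≤ B := (Nat.pow_le_pow_right (by omega) (Nat.le_succ n)).trans hB
    fin_cases k
    · exact hQ _
    · exact (hx.inPos_le).trans_lt hw
    · exact (digitSum_lt fun i => M.symCode_lt _).trans_le hp
    · exact (Nat.pow_lt_pow_right (by omega) (hn x hx)).trans_le hp
  rw [← hinit]
  constructor
  · rintro ⟨x, hx, hq⟩
    refine ⟨M.code n x, hbd x hx, congrArg M.stateCode hq, ?_⟩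
    clear hq
    induction hx with
    | refl => exact .refl
    | @tail y z hy hz ih =>
      exact ih.tail ⟨hbd _ (hy.tail hz), (numStep_code hB (hn _ hy)).2 ⟨z, hz, rfl⟩⟩
  · rintro ⟨v, -, hq, hv⟩
    have key : ∀ v, Relation.ReflTransGen (fun u v => (∀ k, v k < B) ∧ M.NumStep B w u v)
        (M.code n M.initial) v → ∃ x, M.ReachableConfig w x ∧ v = M.code n x := by
      intro v hv
      induction hv with
      | refl => exact ⟨_, .refl, rfl⟩
      | tail _ h ih =>
        obtain ⟨x, hx, rfl⟩ := ih
        obtain ⟨y, hy, rfl⟩ := (numStep_code hB (hn _ hx)).1 h.2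
        exact ⟨y, hx.tail hy, rfl⟩
    obtain ⟨x, hx, rfl⟩ := key v hv
    exact ⟨x, hx, M.stateCode_injective hq⟩

end NTM

end NDJag

/-! ### Acceptance by a machine as a recognisable relation -/

namespace NDJag

/-- Acceptance of the encoding of the grid `g` with target number `t`, when the numbers below
`g.bound (c + 1)` suffice. -/
def NTM.NumAccepts (M : NTM) (c : ℕ) (g : GridIx) (t : ℕ) : Prop :=
  (∀ k, (![M.stateCode M.q₀, 1, 0, 1] : Fin 4 → ℕ) k < g.bound (c + 1)) ∧
  ∃ v : Fin 4 → ℕ, (∀ k, v k < g.bound (c + 1)) ∧ v 0 = M.stateCode M.qₐ ∧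
    Relation.ReflTransGen (fun u v => (∀ k, v k < g.bound (c + 1)) ∧
      (gridWord g t).length + 1 < g.bound (c + 1) ∧
      M.NumStep (g.bound (c + 1)) (gridWord g t) u v) ![M.stateCode M.q₀, 1, 0, 1] v

namespace NDef

variable {c : ℕ} {α : Type} [Finite α]

/-- `x b = 1 + |w|`, where `w` is the encoding of the grid with target number `x t`. -/
theorem length_gridWord (t b : α) :
    NDef (c + 1) fun g x => x b = (gridWord g (x t)).length + 1 := by
  have : NDef (c + 1) fun g (x : α → ℕ) => ∃ o < g.bound (c + 1), o = 1 ∧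
      x b = o + (gridWord g (x t)).length :=
    ex (.and (nat_const 1 _) ((wdef_gridWord c (α := α) t).length some _ _))
  refine this.congr fun g x _ hx => ?_
  have := hx b
  constructor
  · intro h
    exact ⟨1, by omega, rfl, by omega⟩
  · rintro ⟨_, -, rfl, h⟩
    omega

theorem inputSymbol (a : InSym) (t p : α) : NDef (c + 1) fun g x =>
    (gridWord g (x t)).length + 1 < g.bound (c + 1) ∧
      NTM.inputSymbol (gridWord g (x t)) (x p) = a := by
  cases a with
  | left =>
    have : NDef (c + 1) fun g (x : α → ℕ) => ∃ l < g.bound (c + 1),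
        l = (gridWord g (x t)).length + 1 ∧ x p = 0 :=
      ex (.and (length_gridWord _ _) (zero _))
    refine this.congr fun g x _ _ => ?_
    have e : NTM.inputSymbol (gridWord g (x t)) (x p) = .left ↔ x p = 0 := by
      unfold NTM.inputSymbol
      split_ifs with h
      · simp [h]
      · simp only [h, iff_false]
        cases (gridWord g (x t))[x p - 1]? <;> simp
    rw [e]
    constructor
    · exact fun h => ⟨_, h.1, rfl, h.2⟩
    · rintro ⟨_, h, rfl, h'⟩
      exact ⟨h, h'⟩
  | right =>
    have : NDef (c + 1) fun g (x : α → ℕ) => ∃ l < g.bound (c + 1),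
        l = (gridWord g (x t)).length + 1 ∧ l ≤ x p :=
      ex (.and (length_gridWord _ _) (le _ _))
    refine this.congr fun g x _ _ => ?_
    have e : NTM.inputSymbol (gridWord g (x t)) (x p) = .right ↔
        (gridWord g (x t)).length + 1 ≤ x p := by
      unfold NTM.inputSymbol
      split_ifs with h
      · simp [h]
      · rw [show (gridWord g (x t)).length + 1 ≤ x p ↔ (gridWord g (x t)).length ≤ x p - 1 by omega,
          ← List.getElem?_eq_none_iff]
        cases (gridWord g (x t))[x p - 1]? <;> simp
    rw [e]
    constructor
    · exact fun h => ⟨_, h.1, rfl, h.2⟩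
    · rintro ⟨_, h, rfl, h'⟩
      exact ⟨h, h'⟩
  | bit β =>
    -- The offset is `1` because the left end marker occupies cell `0` of the input tape.
    have : NDef (c + 1) fun g (x : α → ℕ) => ∃ l < g.bound (c + 1),
        l = (gridWord g (x t)).length + 1 ∧ ∃ o < g.bound (c + 1), o = 1 ∧
          ∃ r, x p = o + r ∧ (gridWord g (x t))[r]? = some β :=
      ex (.and (length_gridWord _ _) (ex (.and (nat_const 1 _)
        ((wdef_gridWord c (α := α) t).letter β (fun a => some (some a)) _ _))))
    refine this.congr fun g x _ _ => ?_
    have e : NTM.inputSymbol (gridWord g (x t)) (x p) = .bit β ↔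
        ∃ r, x p = 1 + r ∧ (gridWord g (x t))[r]? = some β := by
      unfold NTM.inputSymbol
      split_ifs with h
      · simp only [h, false_iff]
        rintro ⟨r, h, -⟩
        omega
      · constructor
        · intro h'
          refine ⟨x p - 1, by omega, ?_⟩
          revert h'
          cases (gridWord g (x t))[x p - 1]? <;> simp
        · rintro ⟨r, hr, h'⟩
          rw [show x p - 1 = r by omega, h']
          rfl
    rw [e]
    constructor
    · exact fun h => ⟨_, h.1, rfl, 1, by omega, rfl, h.2⟩
    · rintro ⟨_, h, rfl, _, -, rfl, h'⟩
      exact ⟨h, h'⟩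

theorem min_apply (D : Dir) (l p p' : α) : NDef c fun _ x => x p' = min (D.apply (x p)) (x l) := by
  cases D with
  | left =>
    have : NDef c fun g (x : α → ℕ) => (x p = 0 ∧ x p' = 0) ∨ ∃ q < g.bound c, x p = q + 1 ∧
        ((q ≤ x l ∧ x p' = q) ∨ (x l ≤ q ∧ x p' = x l)) :=
      .or (.and (zero _) (zero _)) (ex (.and (succ _ _) (.or (.and (le _ _) (eq _ _))
        (.and (le _ _) (eq _ _)))))
    refine this.congr fun g x _ hx => ?_
    have := hx p
    simp only [Dir.apply]
    constructor
    · intro h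
      rcases Nat.eq_zero_or_pos (x p) with h0 | h0
      · exact .inl ⟨h0, by omega⟩
      · exact .inr ⟨x p - 1, by omega, by omega, by omega⟩
    · rintro (h | ⟨q, -, h, h'⟩) <;> omega
  | stay =>
    have : NDef c fun g (x : α → ℕ) => (x p ≤ x l ∧ x p' = x p) ∨ (x l ≤ x p ∧ x p' = x l) :=
      .or (.and (le _ _) (eq _ _)) (.and (le _ _) (eq _ _))
    refine this.congr fun g x _ _ => ?_
    simp only [Dir.apply]
    omega
  | right =>
    have : NDef c fun g (x : α → ℕ) => (x p < x l ∧ x p' = x p + 1) ∨ (x l ≤ x p ∧ x p' = x l) :=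
      .or (.and (lt _ _) (succ _ _)) (.and (le _ _) (eq _ _))
    refine this.congr fun g x _ _ => ?_
    simp only [Dir.apply]
    omega

theorem movePow (G : ℕ) (D : Dir) (a b : α) : NDef c fun _ x => NTM.MovePow G D (x a) (x b) := by
  cases D with
  | left => exact .or (.and (nat_const 1 _) (nat_const 1 _)) (mul_const _ _ _)
  | stay => exact eq _ _
  | right => exact mul_const _ _ _

theorem write (m n : ℕ) (T X T' : α) : NDef c fun g x =>
    x T' + m * x X = x T + n * x X ∧ x T + n * x X < g.bound c := by
  have : NDef c fun g (x : α → ℕ) => ∃ y < g.bound c, y = m * x X ∧ ∃ z < g.bound c, z = n * x X ∧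
      ∃ s < g.bound c, s = x T' + y ∧ s = x T + z :=
    ex (.and (mul_const _ _ _) (ex (.and (mul_const _ _ _) (ex (.and (add _ _ _) (add _ _ _))))))
  refine this.congr fun g x _ hx => ?_
  constructor
  · rintro ⟨h₁, h₂⟩
    exact ⟨_, by omega, rfl, _, by omega, rfl, _, h₂, h₁.symm, rfl⟩
  · rintro ⟨_, -, rfl, _, -, rfl, _, hs, rfl, h⟩
    exact ⟨h, h ▸ hs⟩

/-- States, symbols and directions are finite in number, so a step is a finite disjunction over
possible transitions, each an arithmetical condition. The clause on the length is part of the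
relation because the length is quantified as a number below the bound. -/
theorem numStep (M : NTM) (t : α) (f f' : Fin 4 → α) : NDef (c + 1) fun g x =>
    (gridWord g (x t)).length + 1 < g.bound (c + 1) ∧
      M.NumStep (g.bound (c + 1)) (gridWord g (x t)) (fun k => x (f k)) (fun k => x (f' k)) := by
  have : NDef (c + 1) fun g (x : α → ℕ) =>
      ∃ (q : M.Q) (a : InSym) (γ : M.Γ) (m : M.Q × M.Γ × Dir × Dir), m ∈ M.δ q a γ ∧
      x (f 0) = M.stateCode q ∧ x (f' 0) = M.stateCode m.1 ∧
      ((gridWord g (x t)).length + 1 < g.bound (c + 1) ∧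
        NTM.inputSymbol (gridWord g (x t)) (x (f 1)) = a) ∧
      (∃ l < g.bound (c + 1), l = (gridWord g (x t)).length + 1 ∧
        x (f' 1) = min (m.2.2.1.apply (x (f 1))) l) ∧
      (0 < x (f 3) ∧ x (f 2) / x (f 3) % M.base = M.symCode γ) ∧
      (x (f' 2) + M.symCode γ * x (f 3) = x (f 2) + M.symCode m.2.1 * x (f 3) ∧
        x (f 2) + M.symCode m.2.1 * x (f 3) < g.bound (c + 1)) ∧
      NTM.MovePow M.base m.2.2.2 (x (f 3)) (x (f' 3)) :=
    exists_finite fun q => exists_finite fun a => exists_finite fun γ => exists_finite fun m =>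
      .and (const _) (.and (nat_const _ _) (.and (nat_const _ _) (.and (inputSymbol _ _ _)
      (.and (ex (.and (length_gridWord _ _) (min_apply _ _ _ _))) (.and
      (digit _ _ (M.symCode_lt _) _ _) (.and (write _ _ _ _ _) (movePow _ _ _ _)))))))
  refine this.congr fun g x _ _ => ?_
  constructor
  · rintro ⟨hw, q, a, γ, m, hm, h₁, h₂, h₃, h₄, h⟩
    exact ⟨q, a, γ, m, hm, h₁, h₂, ⟨hw, h₃⟩, ⟨_, hw, rfl, h₄⟩, h⟩
  · rintro ⟨q, a, γ, m, hm, h₁, h₂, ⟨hw, h₃⟩, ⟨_, -, rfl, h₄⟩, h⟩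
    exact ⟨hw, q, a, γ, m, hm, h₁, h₂, h₃, h₄, h⟩

theorem numAccepts (M : NTM) (t : α) : NDef (c + 1) fun g x => M.NumAccepts c g (x t) := by
  have : NDef (c + 1) fun g (x : α → ℕ) => ∃ u₀ < g.bound (c + 1), ∃ u₁ < g.bound (c + 1),
      ∃ u₂ < g.bound (c + 1), ∃ u₃ < g.bound (c + 1), ∃ v₀ < g.bound (c + 1),
      ∃ v₁ < g.bound (c + 1), ∃ v₂ < g.bound (c + 1), ∃ v₃ < g.bound (c + 1),
      u₀ = M.stateCode M.q₀ ∧ u₁ = 1 ∧ u₂ = 0 ∧ u₃ = 1 ∧ v₀ = M.stateCode M.qₐ ∧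
      Relation.ReflTransGen (fun u v => (∀ k, v k < g.bound (c + 1)) ∧
        (gridWord g (x t)).length + 1 < g.bound (c + 1) ∧
        M.NumStep (g.bound (c + 1)) (gridWord g (x t)) u v) ![u₀, u₁, u₂, u₃] ![v₀, v₁, v₂, v₃] := by
    refine ex (ex (ex (ex (ex (ex (ex (ex (.and (nat_const _ _) (.and (nat_const _ _)
      (.and (zero _) (.and (nat_const _ _) (.and (nat_const _ _) ?_))))))))))))
    have := tcT (κ := Fin 4) (c := c + 1)
      (R := fun g (x : Option (Option (Option (Option (Option (Option (Option (Option α))))))) → ℕ)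
          (u v : Fin 4 → ℕ) =>
        (gridWord g (x (some (some (some (some (some (some (some (some t))))))))) ).length + 1 <
          g.bound (c + 1) ∧ M.NumStep (g.bound (c + 1))
          (gridWord g (x (some (some (some (some (some (some (some (some t)))))))))) u v)
      (numStep M (Sum.inl (some (some (some (some (some (some (some (some t)))))))))
        (fun k => Sum.inr (Sum.inl k)) (fun k => Sum.inr (Sum.inr k)))
      ![some (some (some (some (some (some (some none)))))),
        some (some (some (some (some (some none))))), some (some (some (some (some none)))),
        some (some (some (some none)))]
      ![some (some (some none)), some (some none), some none, none]
    refine this.congr fun g x _ _ => ?_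
    refine iff_of_eq (congrArg₂ _ (funext fun k => ?_) (funext fun k => ?_)) <;>
    fin_cases k <;> rfl
  refine this.congr fun g x _ _ => ?_
  constructor
  · rintro ⟨hu, v, hv, h, hR⟩
    refine ⟨_, hu 0, _, hu 1, _, hu 2, _, hu 3, _, hv 0, _, hv 1, _, hv 2, _, hv 3, rfl, rfl, rfl,
      rfl, h, ?_⟩
    have hv' : ![v 0, v 1, v 2, v 3] = v := funext fun k => by fin_cases k <;> rfl
    rwa [hv']
  · rintro ⟨_, h₀, _, h₁, _, h₂, _, h₃, v₀, h₄, v₁, h₅, v₂, h₆, v₃, h₇, rfl, rfl, rfl, rfl, h, hR⟩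
    refine ⟨fun k => ?_, _, fun k => ?_, h, hR⟩ <;> fin_cases k <;> assumption

end NDef

/-- The numbers that suffice for the simulation of a machine in logarithmic space. -/
theorem exists_bound (G k Q : ℕ) : ∃ c, ∀ (g : GridIx) (w : List Bool), 2 ≤ g.size → 1 ≤ w.length →
    w.length ≤ g.size ^ 5 → G ^ (k * (Nat.log 2 w.length + 1) + 1) ≤ g.bound (c + 1) ∧
      w.length + 1 < g.bound (c + 1) ∧ Q < g.bound (c + 1) := by
  -- With `E` the number of positions, `G ≤ 2 ^ G` and `2 * 2 ^ log |w| ≤ E * E ^ 5` bound the power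
  -- of `G` by `E ^ (6 * G * k + G)`. Moreover `|w| + 1 < E ^ 7` and `Q < E ^ Q`. The chosen
  -- exponent dominates all three.
  refine ⟨G + 6 * (G * k) + Q + 6, fun g w hg hw₁ hw => ?_⟩
  unfold GridIx.bound
  generalize g.size = E at *
  have hpow : ∀ n, n < E ^ n := fun n => n.lt_pow_self (by omega)
  have hE : 1 ≤ E := by omega
  have hlog : 2 ^ Nat.log 2 w.length ≤ w.length := Nat.pow_log_le_self 2 (by omega)
  refine ⟨?_, ?_, ?_⟩
  · calc G ^ (k * (Nat.log 2 w.length + 1) + 1)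
        ≤ (2 ^ G) ^ (k * (Nat.log 2 w.length + 1) + 1) :=
          Nat.pow_le_pow_left (Nat.lt_two_pow_self).le _
      _ = (2 * 2 ^ Nat.log 2 w.length) ^ (G * k) * 2 ^ G := by
          rw [← pow_succ', ← pow_mul, ← pow_mul, ← pow_add]
          congr 1
          ring
      _ ≤ (E * E ^ 5) ^ (G * k) * E ^ G :=
          Nat.mul_le_mul (Nat.pow_le_pow_left (Nat.mul_le_mul hg (hlog.trans hw)) _)
            (Nat.pow_le_pow_left hg _)
      _ = E ^ (6 * (G * k) + G) := by
          rw [← pow_succ', ← pow_mul, ← pow_add]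
      _ ≤ _ := Nat.pow_le_pow_right hE (by omega)
  · calc w.length + 1 < 2 * (E ^ 5) + 2 := by omega
      _ ≤ 4 * E ^ 5 := by
          have := Nat.one_le_pow 5 E hE
          omega
      _ ≤ (E * E) * E ^ 5 := Nat.mul_le_mul_right _ (Nat.mul_le_mul hg hg)
      _ = E ^ 7 := by ring
      _ ≤ _ := Nat.pow_le_pow_right hE (by omega)
  · exact (hpow Q).trans_le (Nat.pow_le_pow_right hE (by omega))

theorem exists_ndef_accepts (M : NTM) (hM : M.IsLogSpace) : ∃ c,
    ∃ A : GridIx → ℕ → Prop, (∀ {α : Type} [Finite α] (t : α), NDef (c + 1) fun g x => A g (x t)) ∧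
      ∀ g t, 2 ≤ g.size → t ≤ g.ℓ ^ g.d → (A g t ↔ M.Accepts (gridWord g t)) := by
  obtain ⟨k, hk⟩ := hM
  obtain ⟨c, hc⟩ := exists_bound M.base k (Nat.card M.Q)
  refine ⟨c, M.NumAccepts c, fun t => NDef.numAccepts M t, fun g t hg ht => ?_⟩
  obtain ⟨h₁, h₂, h₃⟩ := hc g (gridWord g t) hg
    (by simp only [gridWord, List.length_append, length_unary]; omega) (length_gridWord_le hg ht)
  have hQ : ∀ q, M.stateCode q < g.bound (c + 1) := fun q => (M.stateCode_lt q).trans h₃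
  rw [NTM.accepts_iff_num h₁ h₂ hQ (hk _), NTM.NumAccepts]
  simp only [h₂, true_and]
  refine and_iff_right fun i => ?_
  fin_cases i
  · exact hQ _
  · change 1 < _
    omega
  · change 0 < _
    omega
  · change 1 < _
    omega

/-- The only grid with a single position has `d = ℓ = 1`. -/
theorem GridIx.ext_of_size {g g' : GridIx} (h : ¬2 ≤ g.size) (h' : ¬2 ≤ g'.size) : g = g' := by
  have key : ∀ g : GridIx, ¬2 ≤ g.size → g.d = 1 ∧ g.ℓ = 1 := by
    intro g h
    have h₁ := g.degree_le_size
    have h₂ := g.nodes_le_size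
    have h₃ := NeZero.pos g.d
    have h₄ := Nat.le_self_pow h₃.ne' g.ℓ
    have h₅ := NeZero.pos g.ℓ
    omega
  obtain ⟨d, ℓ⟩ := g
  obtain ⟨d', ℓ'⟩ := g'
  obtain ⟨h₁, h₂⟩ := key _ h
  obtain ⟨h₃, h₄⟩ := key _ h'
  simp only at h₁ h₂ h₃ h₄
  subst h₁ h₂ h₃ h₄
  rfl

/-! ### The one-point grid, and the return from numbers to positions -/

namespace Def

variable {α : Type} [Finite α]

/-- The degree is `1` if `next` fixes the first edge out of the start node, and there is one node if
the start node is the last one. -/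
theorem not_two_le_size : Def fun g (_ : α → g.Pos) => ¬2 ≤ g.size := by
  have : Def fun g (_ : α → g.Pos) => ∃ y : g.Pos, y = (0, 0) ∧ (y.1, y.2 + 1) = y ∧
      nodeIdx y.1 + 1 = g.ℓ ^ g.d :=
    ex (.and (eq_base _) (.and (next _ _) (node_last _)))
  refine this.congr fun g x => ?_
  simp only [exists_eq_left, nodeIdx_zero, zero_add, Prod.mk.injEq, true_and]
  have h₁ := Fin.add_one_cases (0 : Fin g.d)
  rw [zero_add, Fin.val_zero, zero_add] at h₁
  constructor
  · intro h
    have h₂ := g.size_pos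
    have h₃ := g.degree_le_size
    have h₄ := g.nodes_le_size
    have h₅ := NeZero.pos g.d
    have h₆ : 0 < g.ℓ ^ g.d := pow_pos (NeZero.pos _) _
    refine ⟨?_, by omega⟩
    rcases h₁ with h | h
    · exact h.1
    · omega
  · rintro ⟨h₂, h₃⟩
    rcases h₁ with h | h
    · rw [GridIx.size, ← h₃, ← h.2]
      decide
    · exact absurd h₂ h.1

/-- Only one grid is left out by numbers, so on it every property is a constant that can be built
into the program. -/
theorem of_two_le_size {R : ∀ g : GridIx, (α → g.Pos) → Prop} (h : Def R) (p : GridIx → Prop) :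
    Def fun g x => (2 ≤ g.size ∧ R g x) ∨ (¬2 ≤ g.size ∧ p g) := by
  have : Def fun g (x : α → g.Pos) => (2 ≤ g.size ∧ R g x) ∨ (¬2 ≤ g.size ∧ p ⟨1, 1⟩) :=
    .or (.and two_le_size h) (.and not_two_le_size (const _))
  refine this.congr fun g x => or_congr_right (and_congr_right fun hg => ?_)
  rw [GridIx.ext_of_size hg (g' := ⟨1, 1⟩) (by simp [GridIx.size])]

end Def

/-- The number `ℓ ^ d` of all nodes is the code of a target outside the component. -/
theorem def_accepts_outside (M : NTM) (hM : M.IsLogSpace) :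
    Def (α := Empty) fun g _ => M.Accepts (gridWord g (g.ℓ ^ g.d)) := by
  obtain ⟨c, A, hA, h⟩ := exists_ndef_accepts M hM
  obtain ⟨R, hR, hR'⟩ : NDef (c + 1) fun g (_ : Empty → ℕ) => ∃ n < g.bound (c + 1),
      n = g.ℓ ^ g.d ∧ A g n := .ex (.and (.node_count _) (hA _))
  refine ((hR.rename (β := Empty) Prod.fst).of_two_le_size fun g =>
    M.Accepts (gridWord g (g.ℓ ^ g.d))).congr fun g x => ?_
  by_cases hg : 2 ≤ g.size
  · have h₁ := GridIx.size_lt_bound (c := c) hg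
    have h₂ := g.nodes_le_size
    simp only [hg, true_and, not_true, false_and, or_false, hR' g hg]
    rw [← h g _ hg le_rfl]
    exact ⟨fun h => ⟨_, by omega, rfl, h⟩, fun ⟨_, _, e, h⟩ => e ▸ h⟩
  · simp [hg]

/-- A target pebble with label `0` has position number `n * d`, where `n` is the number of its node;
`n` is recovered as the factor. The pebble is turned into a tuple by filling the higher digits with
the origin. -/
theorem def_accepts_inside (M : NTM) (hM : M.IsLogSpace) : ∃ R : ∀ g : GridIx, (Unit → g.Pos) → Prop, Def R ∧
    ∀ g x, (x ()).2 = 0 → (R g x ↔ M.Accepts (gridWord g (nodeIdx (x ()).1))) := by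
  obtain ⟨c, A, hA, h⟩ := exists_ndef_accepts M hM
  obtain ⟨R, hR, hR'⟩ : NDef (c + 1) fun g (x : Unit → ℕ) => ∃ n < g.bound (c + 1),
      ∃ d < g.bound (c + 1), d = g.d ∧ x () = n * d ∧ A g n :=
    .ex (.ex (.and (.degree _) (.and (.mul _ _ _) (hA _))))
  have hR₂ : Def fun g (x : Unit → g.Pos) => ∃ y : Fin (c + 2) → g.Pos,
      y 0 = x () ∧ (∀ i : Fin (c + 1), y i.succ = (0, 0)) ∧ R g fun p => y p.2 :=
    .exT (.and (.eq (Sum.inr 0) (Sum.inl ())) (.and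
      (.forall_finite fun i => .eq_base (Sum.inr i.succ)) (hR.rename fun p => Sum.inr p.2)))
  refine ⟨_, hR₂.of_two_le_size fun g => M.Accepts (gridWord g 0), fun g x hx => ?_⟩
  by_cases hg : 2 ≤ g.size
  · have h₁ := GridIx.size_lt_bound (c := c) hg
    have h₂ := g.nodes_le_size
    have h₃ := g.degree_le_size
    have h₄ := nodeIdx_lt (x ()).1
    simp only [hg, true_and, not_true, false_and, or_false, hR' g hg]
    have e : posIdx (x ()) = nodeIdx (x ()).1 * g.d := by
      rw [posIdx, hx, Fin.val_zero, add_zero]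
    rw [← h g _ hg (nodeIdx_lt _).le]
    constructor
    · rintro ⟨y, h₁, h₂, n, -, _, -, rfl, hn, hA⟩
      rw [num_eq_posIdx_iff.2 ⟨h₁, h₂⟩, e] at hn
      rwa [Nat.eq_of_mul_eq_mul_right (NeZero.pos _) hn]
    · intro hA
      refine ⟨Fin.cons (x ()) fun _ => (0, 0), rfl, fun i => rfl, _, by omega, _, by omega, rfl,
        ?_, hA⟩
      rw [← e]
      exact num_eq_posIdx_iff.2 ⟨rfl, fun i => rfl⟩
  · have h₂ := g.nodes_le_size
    have h₄ := nodeIdx_lt (x ()).1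
    simp only [hg, false_and, not_false_eq_true, true_and, false_or]
    rw [show nodeIdx (x ()).1 = 0 by omega]

end NDJag

namespace NDJag

/-! ### Inputs whose relevant part is a grid -/

section nodeAt

variable {d ℓ : ℕ} [NeZero ℓ]

/-- The node with number `n`. -/
noncomputable def nodeAt (d ℓ : ℕ) [NeZero ℓ] (n : ℕ) : Fin d → ZMod ℓ :=
  if h : n < ℓ ^ d then (exists_nodeIdx_eq h).choose else 0

theorem nodeIdx_nodeAt {n : ℕ} (hn : n < ℓ ^ d) : nodeIdx (nodeAt d ℓ n) = n := by
  rw [nodeAt, dif_pos hn]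
  exact (exists_nodeIdx_eq hn).choose_spec

theorem nodeAt_nodeIdx (v : Fin d → ZMod ℓ) : nodeAt d ℓ (nodeIdx v) = v :=
  nodeIdx_injective (nodeIdx_nodeAt (nodeIdx_lt v))

theorem nodeAt_eq (n : Fin (ℓ ^ d)) :
    nodeAt d ℓ n = fun k => (((ofLex (lexIso d ℓ n) k : Fin ℓ) : ℕ) : ZMod ℓ) := by
  apply nodeIdx_injective
  rw [nodeIdx_nodeAt n.isLt, nodeIdx, exponents_natCast]
  simp

end nodeAt

theorem count_canonicalPath {d ℓ : ℕ} (e : Fin d → Fin ℓ) (k : Fin d) :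
    (canonicalPath e).count k = e k := by
  rw [canonicalPath, List.count_flatMap, List.sum_map_eq_nsmul_single k]
  · simp [List.count_eq_one_of_mem (List.nodup_finRange d) (List.mem_finRange k)]
  · intro j hj _
    simp [List.count_replicate, hj]

/-- `φ` identifies the grid with the part of `G` that is reachable from the start node. -/
structure IsGridMap {ℓ : ℕ} (G : Input) (φ : (Fin G.d → ZMod ℓ) → G.V) : Prop where
  injective : φ.Injective
  zero : φ 0 = G.start
  edge : ∀ v i, φ (v + Pi.single i 1) = G.graph.edge (φ v) i

theorem IsGridInput.exists_isGridMap {ℓ : ℕ} {G : Input} (h : IsGridInput ℓ G) :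
    ∃ φ : (Fin G.d → ZMod ℓ) → G.V, IsGridMap G φ := by
  obtain ⟨φ, h₁, h₂, h₃⟩ := h
  refine ⟨φ ∘ Multiplicative.ofAdd, h₁.comp Multiplicative.ofAdd.injective, h₂, fun v i => ?_⟩
  rw [add_comm]
  exact h₃ (Multiplicative.ofAdd v) i

/-- The parameters of the grid in the input. -/
abbrev Input.ix (G : Input) (ℓ : ℕ) [NeZero ℓ] : GridIx := ⟨G.d, ℓ⟩

namespace IsGridMap

variable {ℓ : ℕ} {G : Input} {φ : (Fin G.d → ZMod ℓ) → G.V} (h : IsGridMap G φ)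
include h

/-- The group is abelian, so only the number of occurrences of each label matters. -/
theorem walk (v : Fin G.d → ZMod ℓ) (w : List (Fin G.d)) :
    G.graph.walk (φ v) w = φ (v + fun k => (w.count k : ZMod ℓ)) := by
  induction w generalizing v with
  | nil => simp [LabelledGraph.walk, ← Pi.zero_def]
  | cons i w ih =>
    rw [LabelledGraph.walk, List.foldl_cons, ← h.edge]
    refine (ih _).trans (congrArg φ ?_)
    ext k
    by_cases hk : k = i
    · subst hk
      simp
      ring
    · simp [Ne.symm hk, hk]

theorem canonicalNode (e : Fin G.d → Fin ℓ) :
    NDJag.canonicalNode G e = φ fun k => ((e k : ℕ) : ZMod ℓ) := by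
  rw [NDJag.canonicalNode, ← h.zero, h.walk, zero_add]
  simp only [count_canonicalPath]

variable [NeZero ℓ]

theorem reachable_iff {u : G.V} : G.graph.Reachable G.start u ↔ ∃ v, φ v = u := by
  constructor
  · rintro ⟨w, rfl⟩
    exact ⟨_, (h.walk 0 w).symm.trans (by rw [h.zero])⟩
  · rintro ⟨v, rfl⟩
    induction v using pi_induction with
    | zero => rw [h.zero]; exact .refl _
    | add v i ih => rw [h.edge]; exact ih.edge i

theorem existsUnique_canonicalNode {u : G.V} (hu : G.graph.Reachable G.start u) :
    ∃! e : Fin G.d → Fin ℓ, NDJag.canonicalNode G e = u := by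
  obtain ⟨v, rfl⟩ := h.reachable_iff.1 hu
  refine ⟨exponents v, ?_, fun e he => ?_⟩
  · refine (h.canonicalNode _).trans (congrArg φ ?_)
    ext k
    simp [exponents]
  · have he := (h.canonicalNode e).symm.trans he
    rw [← h.injective he, exponents_natCast]

theorem lexNodes_eq : lexNodes G ℓ = (List.range (ℓ ^ G.d)).map fun n => φ (nodeAt G.d ℓ n) := by
  rw [lexNodes, sort_exponents, List.map_map, ← List.map_coe_finRange_eq_range, List.map_map]
  refine List.map_congr_left fun n _ => ?_
  simp only [Function.comp]
  rw [h.canonicalNode, nodeAt_eq]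

theorem length_lexNodes : (lexNodes G ℓ).length = ℓ ^ G.d := by simp [h.lexNodes_eq]

theorem mem_lexNodes {u : G.V} : u ∈ lexNodes G ℓ ↔ ∃ v, φ v = u := by
  rw [h.lexNodes_eq, List.mem_map]
  constructor
  · rintro ⟨n, -, rfl⟩
    exact ⟨_, rfl⟩
  · rintro ⟨v, rfl⟩
    exact ⟨nodeIdx v, List.mem_range.2 (nodeIdx_lt v), by rw [nodeAt_nodeIdx]⟩

theorem nodup_lexNodes : (lexNodes G ℓ).Nodup := by
  rw [h.lexNodes_eq]
  refine List.Nodup.map_on (fun m hm n hn e => ?_) List.nodup_range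
  have := congrArg nodeIdx (h.injective e)
  rwa [nodeIdx_nodeAt (List.mem_range.1 hm), nodeIdx_nodeAt (List.mem_range.1 hn)] at this

theorem idxOf_lexNodes [DecidableEq G.V] (v : Fin G.d → ZMod ℓ) :
    (lexNodes G ℓ).idxOf (φ v) = nodeIdx v := by
  have hn : nodeIdx v < (lexNodes G ℓ).length := by
    rw [h.length_lexNodes]
    exact nodeIdx_lt v
  have := h.nodup_lexNodes.idxOf_getElem (nodeIdx v) hn
  simpa [h.lexNodes_eq, nodeAt_nodeIdx] using this

theorem encode_eq {t : ℕ}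
    (ht : ∀ [DecidableEq G.V], (lexNodes G ℓ).idxOf G.target = t) :
    encode G (lexNodes G ℓ) = gridWord (G.ix ℓ) t := by
  classical
  rw [encode, gridWord, h.length_lexNodes, ht, ← h.zero, h.idxOf_lexNodes, nodeIdx_zero]
  congr 1
  refine (congrArg (List.flatMap _) h.lexNodes_eq).trans ?_
  rw [List.flatMap_map]
  refine List.flatMap_congr fun n hn => ?_
  rw [← List.map_coe_finRange_eq_range, List.flatMap_map]
  refine List.flatMap_congr fun i _ => ?_
  rw [← h.edge, h.idxOf_lexNodes, ← edgeIdx_nodeIdx (g := G.ix ℓ),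
    nodeIdx_nodeAt (List.mem_range.1 hn)]

theorem encode_of_eq {v : Fin G.d → ZMod ℓ} (hv : φ v = G.target) :
    encode G (lexNodes G ℓ) = gridWord (G.ix ℓ) (nodeIdx v) :=
  h.encode_eq (hv ▸ h.idxOf_lexNodes v)

theorem encode_of_not_reachable (ht : ¬G.graph.Reachable G.start G.target) :
    encode G (lexNodes G ℓ) = gridWord (G.ix ℓ) (ℓ ^ G.d) := by
  refine h.encode_eq ?_
  intro _
  rw [List.idxOf_of_notMem, h.length_lexNodes]
  rwa [h.mem_lexNodes, ← h.reachable_iff]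

end IsGridMap

/-- The position in `G` that corresponds to a position on the grid. -/
def posMap {ℓ : ℕ} [NeZero ℓ] {G : Input} (φ : (Fin G.d → ZMod ℓ) → G.V) (p : (G.ix ℓ).Pos) :
    G.V × Fin G.d := (φ p.1, p.2)

namespace IsGridMap

variable {ℓ : ℕ} [NeZero ℓ] {G : Input} {φ : (Fin G.d → ZMod ℓ) → G.V} (h : IsGridMap G φ)
include h

theorem posMap_injective : (posMap φ).Injective := fun p q e => by
  simp only [posMap, Prod.mk.injEq] at e
  exact Prod.ext (h.injective e.1) e.2

theorem posMap_edge (p : (G.ix ℓ).Pos) (a : Fin 2) :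
    posMap φ ((gridEdges (G.ix ℓ)).edge p a) = G.graph.edgeGraph.edge (posMap φ p) a := by
  match a with
  | 0 => rfl
  | 1 => exact Prod.ext (h.edge _ _) rfl

theorem posMap_zero : posMap φ (0, 0) = (G.start, 0) := Prod.ext h.zero rfl

end IsGridMap

end NDJag

namespace NDJag

/-! ### Sweeping over all nodes -/

namespace Atom

variable {U P : Type} {H : LabelledGraph U 2}

theorem apply_of_mem_trace {w : List (Atom P)} {p : P} (hw : ∀ a ∈ w, a.2 p = .jump p)
    {x z : P → U} (hz : z ∈ trace H w x) : z p = x p := by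
  induction w generalizing x with
  | nil => simp [trace] at hz
  | cons a w ih =>
    rw [trace, List.mem_cons] at hz
    rcases hz with rfl | hz
    · rfl
    · rw [ih (fun b hb => hw b (by simp [hb])) hz, step, hw a (by simp), Move.apply]

/-- Add the condition `g` to the guard. -/
def restrict (g : Setoid P → Prop) (a : Atom P) : Atom P := (fun π => a.1 π ∧ g π, a.2)

/-- The added condition is tested before every letter, but not at the final positions, which no
letter follows. -/
theorem ok_restrict {g : Setoid P → Prop} (w : List (Atom P)) (x : P → U) :
    ok H (w.map (restrict g)) x ↔ ok H w x ∧ ∀ z ∈ trace H w x, g (Setoid.ker z) := by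
  induction w generalizing x with
  | nil => simp [ok, trace]
  | cons a w ih =>
    rw [List.map_cons, ok, ok, trace, List.forall_mem_cons,
      show step H (restrict g a) x = step H a x from rfl, ih]
    simp only [restrict]
    tauto

/-- The positions of `p` before each move and at the end. -/
def track (H : LabelledGraph U 2) (p : P) (w : List (Atom P)) (x : P → U) : List U :=
  (trace H w x).map (· p) ++ [exec H w x p]

theorem track_append (p : P) (u v : List (Atom P)) (x : P → U) :
    track H p (u ++ v) x = (trace H u x).map (· p) ++ track H p v (exec H u x) := by
  simp [track]

theorem head?_track (p : P) (w : List (Atom P)) (x : P → U) :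
    (track H p w x).head? = some (x p) := by
  cases w <;> rfl

theorem isChain_track_append {S : U → U → Prop} {p : P} {u v : List (Atom P)} {x : P → U}
    (hu : (track H p u x).IsChain S) (hv : (track H p v (exec H u x)).IsChain S) :
    (track H p (u ++ v) x).IsChain S := by
  rw [track, List.isChain_append] at hu
  rw [track_append, List.isChain_append]
  refine ⟨hu.1, hv, fun a ha b hb => ?_⟩
  rw [head?_track] at hb
  exact hu.2.2 a ha b hb

theorem track_eq_replicate {w : List (Atom P)} {p : P} (hw : ∀ a ∈ w, a.2 p = .jump p)
    (x : P → U) : track H p w x = List.replicate (w.length + 1) (x p) := by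
  induction w generalizing x with
  | nil => rfl
  | cons a w ih =>
    change x p :: track H p w (step H a x) = _
    rw [ih fun b hb => hw b (by simp [hb]), step, hw a (by simp), Move.apply]
    rfl

end Atom

open Atom

theorem isAcceptingComputation_iff {P U : Type} [Finite P] {L : Language (Atom P)}
    (hL : L.IsRegular) {s t : P} {hst : s ≠ t} {H : LabelledGraph U 2} {start target : U} :
    (∃ c, (jagOf hL s t hst).IsAcceptingComputation H start target c) ↔
      ∃ y, Sem H L ((jagOf hL s t hst).initial start target).2 y := by
  constructor
  · rintro ⟨c, hc⟩
    obtain ⟨w, hw, h, -⟩ := exists_word_of_isAcceptingComputation hL hc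
    exact ⟨_, w, hw, h, rfl⟩
  · rintro ⟨_, w, hw, h, -⟩
    exact exists_isAcceptingComputation hL hw h

/-- The list `l` of positions passes through the first edges out of all nodes, in the lexicographic
order. -/
structure IsSweep (g : GridIx) (l : List g.Pos) : Prop where
  label : ∀ p ∈ l, p.2 = 0
  head : l.head? = some (0, 0)
  isChain : l.IsChain fun p q => q = p ∨ nodeIdx q.1 = nodeIdx p.1 + 1
  last : ∃ p ∈ l.getLast?, nodeIdx p.1 + 1 = g.ℓ ^ g.d

open Classical in
theorem destutter'_eq_range' (a : ℕ) (l : List ℕ) (h : (a :: l).IsChain fun m n => n = m ∨ n = m + 1) :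
    ∃ k, l.destutter' (· ≠ ·) a = List.range' a (k + 1) ∧
      (a :: l).getLast (List.cons_ne_nil _ _) = a + k := by
  induction l generalizing a with
  | nil => exact ⟨0, by simp⟩
  | cons b l ih =>
    rw [List.isChain_cons_cons] at h
    obtain ⟨k, h₁, h₂⟩ := ih b h.2
    rw [List.getLast_cons (List.cons_ne_nil _ _), h₂, List.destutter'_cons]
    rcases h.1 with rfl | rfl
    · exact ⟨k, by simpa using h₁, rfl⟩
    · refine ⟨k + 1, ?_, by omega⟩
      rw [if_pos (by omega), h₁, ← List.range'_succ]

-- In terms of node numbers, the sequence starts with `0`, increases by at most one at a time and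
-- ends with `ℓ ^ d - 1`; removing repetitions leaves an interval. The numbering is injective, so it
-- commutes with this removal.
open Classical in
theorem IsSweep.destutter_eq {g : GridIx} {l : List g.Pos} (h : IsSweep g l) :
    (l.map Prod.fst).destutter (· ≠ ·) = (List.range (g.ℓ ^ g.d)).map (nodeAt g.d g.ℓ) := by
  obtain ⟨-, h₁, h₂, p, hp, h₃⟩ := h
  rcases l with _ | ⟨a, l⟩
  · simp at h₁
  obtain rfl : a = (0, 0) := Option.some.inj h₁
  have hc : (((0, 0) :: l : List g.Pos).map fun q => nodeIdx q.1).IsChain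
      fun m n => n = m ∨ n = m + 1 := by
    rw [List.isChain_map]
    refine h₂.imp fun p q h => ?_
    rcases h with rfl | h
    exacts [.inl rfl, .inr h]
  rw [List.map_cons] at hc
  obtain ⟨k, hk₁, hk₂⟩ := destutter'_eq_range' _ _ hc
  have hk₃ : nodeIdx p.1 = k := by
    have hp' : p = ((0, 0) :: l : List g.Pos).getLast (List.cons_ne_nil _ _) := by
      rw [List.getLast?_eq_getLast_of_ne_nil (List.cons_ne_nil _ _)] at hp
      exact (Option.mem_some_iff.1 hp).symm
    rw [hp', ← List.getLast_map (f := fun q : g.Pos => nodeIdx q.1) (by simp)]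
    refine Eq.trans ?_ (hk₂.trans (by rw [nodeIdx_zero, zero_add]))
    rfl
  refine List.map_injective_iff.2 (nodeIdx_injective (d := g.d) (ℓ := g.ℓ)) ?_
  refine (List.map_destutter_ne _ (nodeIdx_injective (d := g.d) (ℓ := g.ℓ))).trans ?_
  rw [List.map_map, List.map_map]
  have e : (List.range (g.ℓ ^ g.d)).map (nodeIdx ∘ nodeAt g.d g.ℓ) = List.range (g.ℓ ^ g.d) := by
    conv_rhs => rw [← List.map_id (List.range (g.ℓ ^ g.d))]
    exact List.map_congr_left fun n hn => nodeIdx_nodeAt (List.mem_range.1 hn)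
  rw [e, ← h₃, hk₃, List.range_eq_range', ← nodeIdx_zero (d := g.d) (ℓ := g.ℓ)]
  exact hk₁

theorem IsSweep.mem {g : GridIx} {l : List g.Pos} (h : IsSweep g l) (v : Fin g.d → ZMod g.ℓ) :
    (v, 0) ∈ l := by
  classical
  have hv : v ∈ (l.map Prod.fst).destutter (· ≠ ·) := by
    rw [h.destutter_eq, List.mem_map]
    exact ⟨_, List.mem_range.2 (nodeIdx_lt v), nodeAt_nodeIdx v⟩
  obtain ⟨⟨_, i⟩, hp, rfl⟩ := List.mem_map.1 ((List.destutter_sublist _ _).subset hv)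
  obtain rfl : i = 0 := h.label _ hp
  exact hp

open Computability in
/-- There is a program that makes the pebble `curr` sweep over all nodes. -/
theorem exists_sweep : ∃ (P : Type) (_ : Finite P) (base curr : P) (L : Language (Atom P)),
    L.IsRegular ∧ ∀ g (x : P → (g : GridIx).Pos), x base = (0, 0) → x curr = (0, 0) →
      (∃ y, Sem (gridEdges g) L x y) ∧ ∀ w ∈ L, ok (gridEdges g) w x →
        IsSweep g ((trace (gridEdges g) w x).map (· curr)) ∧
        ∃ p ∈ ((trace (gridEdges g) w x).map (· curr)).getLast?, p = exec (gridEdges g) w x curr := by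
  classical
  have hS : Def (α := Fin 2) fun g x => (x 1).2 = 0 ∧ NodeSucc (x 0).1 (x 1).1 :=
    .and (.lab_zero _) (.node_succ _ _)
  have hE : Def (α := Fin 2) fun g x => nodeIdx (x 0).1 + 1 = g.ℓ ^ g.d := .node_last _
  obtain ⟨T₁, _, hS⟩ := Recog.exists_embed hS
  obtain ⟨T₂, _, hE⟩ := Recog.exists_embed hE
  let P := Option (Fin 2) ⊕ (T₁ ⊕ T₂)
  obtain ⟨L₁, r₁, f₁, h₁⟩ := hS (P := P) Sum.inl (Sum.inr ∘ Sum.inl)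
    (Sum.inr_injective.comp Sum.inl_injective) (by simp)
  obtain ⟨L₂, r₂, f₂, h₂⟩ := hE (P := P) Sum.inl (Sum.inr ∘ Sum.inr)
    (Sum.inr_injective.comp Sum.inr_injective) (by simp)
  let base : P := .inl none
  let curr : P := .inl (some 0)
  let new : P := .inl (some 1)
  let commit : P → P := fun p => if p = curr then new else p
  have hne : ∀ p q : Option (Fin 2), p ≠ q → (.inl p : P) ≠ .inl q :=
    fun p q h => Sum.inl_injective.ne h
  have hbc : base ≠ curr := hne _ _ (by simp)
  have hbn : base ≠ new := hne _ _ (by simp)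
  have hcn : curr ≠ new := hne _ _ (by simp)
  have fL₁ : ∀ p, Fixes L₁ {.inl p} := fun p => f₁.mono (by simp)
  have fL₂ : ∀ p, Fixes L₂ {.inl p} := fun p => f₂.mono (by simp)
  have fg : ∀ p ≠ new, Fixes (guess base {new}) {p} := fun p hp =>
    (fixes_guess _ _).mono (Set.singleton_subset_iff.2 hp)
  set body := guess base {new} * L₁
  have fbody : ∀ p ≠ some 1, Fixes body {.inl p} := fun p hp =>
    (fg _ (hne _ _ hp)).mul (fL₁ p)
  have hcommit : commit base = base := if_neg hbc
  -- A last letter that does nothing makes the final position of `curr` part of the trace, so that a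
  -- guard added to all letters is tested on the last node too.
  set fin : Language (Atom P) := test fun _ => True
  refine ⟨P, inferInstance, base, curr, (body * assign commit)∗ * (L₂ * fin),
    (((isRegular_guess _ _).mul r₁).mul (Language.isRegular_letters _)).kstar.mul
      (r₂.mul (Language.isRegular_letters _)), fun g x hb hc => ⟨?_, ?_⟩⟩
  -- Existence of a run: the right successor is guessed each time.
  · have key : ∀ n < g.ℓ ^ g.d, ∃ z : P → g.Pos,
        Relation.ReflTransGen (Sem (gridEdges g) (body * assign commit)) x z ∧ z base = (0, 0) ∧
          z curr = (nodeAt g.d g.ℓ n, 0) := by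
      intro n hn
      induction n with
      | zero =>
        refine ⟨x, .refl, hb, ?_⟩
        rw [hc, ← nodeIdx_zero (d := g.d) (ℓ := g.ℓ), nodeAt_nodeIdx]
      | succ n ih =>
        obtain ⟨z, hz₁, hz₂, hz₃⟩ := ih (by omega)
        set z' := Function.update z new (nodeAt g.d g.ℓ (n + 1), 0) with hz'
        have hg : Sem (gridEdges g) (guess base {new}) z z' := by
          refine sem_guess (fun u => by rw [hz₂]; exact reachable_gridEdges u) fun p hp => ?_
          rw [hz', Function.update_of_ne (by simpa using hp)]
        have e₁ : z' base = (0, 0) := by rw [hz', Function.update_of_ne hbn, hz₂]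
        have e₂ : z' curr = (nodeAt g.d g.ℓ n, 0) := by rw [hz', Function.update_of_ne hcn, hz₃]
        have e₃ : z' new = (nodeAt g.d g.ℓ (n + 1), 0) := Function.update_self ..
        obtain ⟨y, hy⟩ := (h₁ g z' e₁).1 (by
          change (z' new).2 = 0 ∧ NodeSucc (z' curr).1 (z' new).1
          rw [e₂, e₃, nodeSucc_iff, nodeIdx_nodeAt hn, nodeIdx_nodeAt (by omega)]
          exact ⟨rfl, rfl⟩)
        refine ⟨y ∘ commit, hz₁.tail ((sem_mul _).2 ⟨y, (sem_mul _).2 ⟨z', hg, hy⟩,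
          sem_assign.2 rfl⟩), ?_, ?_⟩
        · rw [Function.comp, hcommit, (fL₁ _).sem hy rfl, e₁]
        · rw [Function.comp, show commit curr = new from if_pos rfl, (fL₁ _).sem hy rfl, e₃]
    have hpos : 0 < g.ℓ ^ g.d := pow_pos (NeZero.pos _) _
    obtain ⟨z, hz₁, hz₂, hz₃⟩ := key (g.ℓ ^ g.d - 1) (by omega)
    obtain ⟨y, hy⟩ := (h₂ g z hz₂).1 (by
      change nodeIdx (z curr).1 + 1 = _
      rw [hz₃, nodeIdx_nodeAt (by omega)]
      omega)
    exact ⟨y, (sem_mul _).2 ⟨z, (sem_kstar _).2 hz₁, (sem_mul _).2 ⟨y, hy,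
      sem_test.2 ⟨trivial, rfl⟩⟩⟩⟩
  -- All runs: `curr` moves only when it jumps to `new`, and by then `new` has been verified to be
  -- the first edge out of the successor node.
  · set S : g.Pos → g.Pos → Prop := fun p q => (p.2 = 0 ∧ q.2 = 0) ∧
      (q = p ∨ nodeIdx q.1 = nodeIdx p.1 + 1)
    have hrep : ∀ (w : List (Atom P)) p (y : P → g.Pos), (y p).2 = 0 → (∀ a ∈ w, a.2 p = .jump p) →
        (track (gridEdges g) p w y).IsChain S := by
      intro w p y hy hw
      rw [track_eq_replicate hw]
      exact List.isChain_replicate_of_rel _ ⟨⟨hy, hy⟩, .inl rfl⟩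
    have key : ∀ w ∈ (body * assign commit)∗, ∀ y : P → g.Pos, y base = (0, 0) → (y curr).2 = 0 →
        ok (gridEdges g) w y → exec (gridEdges g) w y base = (0, 0) ∧
          (exec (gridEdges g) w y curr).2 = 0 ∧ (track (gridEdges g) curr w y).IsChain S := by
      intro w hw
      refine Language.kstar_induction (p := fun w => ∀ y : P → g.Pos, y base = (0, 0) →
        (y curr).2 = 0 → ok (gridEdges g) w y → exec (gridEdges g) w y base = (0, 0) ∧
          (exec (gridEdges g) w y curr).2 = 0 ∧ (track (gridEdges g) curr w y).IsChain S) ?_ ?_ hw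
      · exact fun y h₁ h₂ _ => ⟨h₁, h₂, List.isChain_singleton _⟩
      · intro u v hu _ ih y hy₁ hy₂ hok
        rw [ok_append] at hok
        obtain ⟨w, hw, c, hcm, rfl⟩ := Language.mem_mul.1 hu
        obtain ⟨a, ha, rfl⟩ := hcm
        rw [Set.mem_singleton_iff] at ha
        rw [ok_append] at hok
        have hexec : exec (gridEdges g) (w ++ [a]) y = exec (gridEdges g) w y ∘ commit := by
          rw [exec_append, ha]
          rfl
        have hfix : ∀ p ≠ some 1, exec (gridEdges g) w y (.inl p) = y (.inl p) := fun p hp =>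
          (fbody p hp).sem ⟨w, hw, hok.1.1, rfl⟩ rfl
        obtain ⟨z, hz, hz'⟩ := (sem_mul _).1 ⟨w, hw, hok.1.1, rfl⟩
        have hR := (h₁ g z ((((fg base hbn).sem hz rfl)).trans hy₁)).2 ⟨_, hz'⟩
        change (z new).2 = 0 ∧ NodeSucc (z curr).1 (z new).1 at hR
        rw [nodeSucc_iff, (fg curr hcn).sem hz rfl,
          ← (fL₁ (some 1)).sem hz' (p := new) rfl] at hR
        have e₁ : exec (gridEdges g) (w ++ [a]) y base = (0, 0) := by
          rw [hexec, Function.comp, hcommit, hfix none (by simp)]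
          exact hy₁
        have e₂ : exec (gridEdges g) (w ++ [a]) y curr = exec (gridEdges g) w y new := by
          rw [hexec, Function.comp, show commit curr = new from if_pos rfl]
        obtain ⟨i₁, i₂, i₃⟩ := ih _ e₁ (by rw [e₂]; exact hR.1) hok.2
        rw [exec_append]
        refine ⟨i₁, i₂, isChain_track_append (isChain_track_append ?_ ?_) i₃⟩
        · exact hrep _ _ _ hy₂ fun a ha => fbody (some 0) (by simp) w hw a ha _ rfl
        · rw [exec_append] at e₂
          change List.IsChain S [exec (gridEdges g) w y curr, exec (gridEdges g) [a] _ curr]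
          rw [e₂, hfix (some 0) (by simp), List.isChain_pair]
          exact ⟨⟨hy₂, hR.1⟩, .inr hR.2⟩
    intro w hw hok
    obtain ⟨u, hu, v', hv', rfl⟩ := Language.mem_mul.1 hw
    obtain ⟨v, hv, _, ⟨a, ha, rfl⟩, rfl⟩ := Language.mem_mul.1 hv'
    rw [Set.mem_singleton_iff] at ha
    rw [ok_append, ok_append] at hok
    obtain ⟨k₁, k₂, k₃⟩ := key u hu x hb (by rw [hc]) hok.1
    set z := exec (gridEdges g) u x with hz
    have hlast : nodeIdx (z curr).1 + 1 = g.ℓ ^ g.d := (h₂ g z k₁).2 ⟨_, v, hv, hok.2.1, rfl⟩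
    have hzv : exec (gridEdges g) v z curr = z curr := (fL₂ (some 0)).sem ⟨v, hv, hok.2.1, rfl⟩ rfl
    have htr : (trace (gridEdges g) (u ++ (v ++ [a])) x).map (· curr) =
        track (gridEdges g) curr (u ++ v) x := by
      rw [← List.append_assoc, trace_append, List.map_append]
      rfl
    have hchain : (track (gridEdges g) curr (u ++ v) x).IsChain S :=
      isChain_track_append k₃ (hrep _ _ _ k₂ fun a ha => fL₂ (some 0) v hv a ha _ rfl)
    have hex : exec (gridEdges g) (u ++ v) x curr = z curr := by rw [exec_append]; exact hzv
    have hgl : (track (gridEdges g) curr (u ++ v) x).getLast? = some (z curr) := by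
      rw [track, hex, List.getLast?_concat]
    rw [htr]
    refine ⟨⟨?_, ?_, hchain.imp fun _ _ h => h.2, z curr, hgl, hlast⟩, z curr, hgl, ?_⟩
    · intro p hp
      have : (track (gridEdges g) curr (u ++ v) x).IsChain fun p q => p.2 = 0 → q.2 = 0 :=
        hchain.imp fun _ _ h _ => h.1.2
      refine List.IsChain.induction (p := fun p : g.Pos => p.2 = 0) _ this (fun _ _ h h' => h h') ?_ p hp
      intro hne
      have := head?_track (H := gridEdges g) curr (u ++ v) x
      rw [List.head?_eq_some_head hne] at this
      rw [Option.some.inj this, hc]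
    · rw [head?_track, hc]
    · rw [← List.append_assoc, exec_append, ← hex, ha]
      rfl

end NDJag

namespace NDJag

/-! ### Programs on inputs -/

open Atom

theorem IsSweep.concat {g : GridIx} {l : List g.Pos} (h : IsSweep g l) {p : g.Pos}
    (hp : p ∈ l.getLast?) : IsSweep g (l ++ [p]) := by
  refine ⟨fun q hq => ?_, ?_, ?_, p, by simp, ?_⟩
  · rcases List.mem_append.1 hq with hq | hq
    · exact h.label q hq
    · rw [List.mem_singleton.1 hq]
      exact h.label p (List.mem_of_getLast? hp)
  · rw [List.head?_append, h.head, Option.some_or]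
  · refine List.isChain_append.2 ⟨h.isChain, List.isChain_singleton _, fun a ha b hb => ?_⟩
    rw [Option.mem_unique ha hp]
    exact .inl (Option.mem_some_iff.1 hb).symm
  · obtain ⟨q, hq, hl⟩ := h.last
    rwa [Option.mem_unique hp hq]

namespace LabelledGraph

variable {U W : Type} {d : ℕ} {H : LabelledGraph U d} {H' : LabelledGraph W d} {ψ : U → W}

theorem walk_hom (hψ : ∀ u a, ψ (H.edge u a) = H'.edge (ψ u) a) (u : U) (w : List (Fin d)) :
    H'.walk (ψ u) w = ψ (H.walk u w) := by
  induction w generalizing u with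
  | nil => rfl
  | cons a w ih =>
    change H'.walk (H'.edge (ψ u) a) w = ψ (H.walk (H.edge u a) w)
    rw [← hψ, ih]

end LabelledGraph

/-- An input together with an identification of its relevant part with a grid. -/
structure GridIn where
  ℓ : ℕ
  [ℓ_ne : NeZero ℓ]
  G : Input
  φ : (Fin G.d → ZMod ℓ) → G.V
  isGridMap : IsGridMap G φ

namespace GridIn

attribute [instance] ℓ_ne

variable (j : GridIn)

/-- The parameters of the grid. -/
abbrev g : GridIx := j.G.ix j.ℓ

/-- The positions of pebbles. -/
abbrev Pos : Type := j.G.V × Fin j.G.d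

/-- The graph on which the pebbles travel. -/
abbrev edges : LabelledGraph j.Pos 2 := j.G.graph.edgeGraph

/-- The target node can be reached. -/
def TargetReachable : Prop := j.G.graph.Reachable j.G.start j.G.target

/-- The first pebble is on the start node, the second one on the target node. -/
def Marked (x : Bool → j.Pos) : Prop := x false = (j.G.start, 0) ∧ x true = (j.G.target, 0)

theorem reachable_iff {j : GridIn} {p : j.Pos} :
    j.edges.Reachable (j.G.start, 0) p ↔ ∃ q, posMap j.φ q = p := by
  rw [← j.isGridMap.posMap_zero]
  constructor
  · rintro ⟨w, rfl⟩
    exact ⟨_, (LabelledGraph.walk_hom j.isGridMap.posMap_edge _ _).symm⟩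
  · rintro ⟨q, rfl⟩
    obtain ⟨w, rfl⟩ := reachable_gridEdges q
    exact ⟨w, LabelledGraph.walk_hom j.isGridMap.posMap_edge _ _⟩

theorem targetReachable_iff {j : GridIn} :
    j.TargetReachable ↔ ∃ v, posMap j.φ (v, 0) = (j.G.target, 0) := by
  simp [TargetReachable, j.isGridMap.reachable_iff, posMap]

end GridIn

/-- The property `K` of inputs can be recognised. -/
def Decides (K : GridIn → Prop) : Prop := Recog GridIn.edges GridIn.Marked fun j _ => K j

-- A pebble walks from `a` at random and is tested against `b`. In contrast to `Recog.ex`, the graph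
-- need not be reachable from one pebble, so this applies to a target in another component.
open Computability in
theorem Recog.reachable {J : Type*} {U : J → Type} {H : ∀ j, LabelledGraph (U j) 2} {β : Type}
    {D : ∀ j, (β → U j) → Prop} (a b : β) :
    Recog H D fun j x => (H j).Reachable (x a) (x b) := by
  classical
  refine ⟨Unit, inferInstance, assign (fun p => if p = .inr () then .inl a else p) *
    ((Language.letters {m | ∃ p ∈ ({.inr ()} : Set (β ⊕ Unit)), ∃ i, m = moveOne p i})∗ *
      test fun π => π (.inr ()) (.inl b)),
    (Language.isRegular_letters _).mul ((Language.isRegular_letters _).kstar.mul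
      (Language.isRegular_letters _)), (fixes_assign ?_).mul ((fixes_letters ?_).kstar.mul
      fixes_test), fun j x _ => ?_⟩
  · rintro _ ⟨c, rfl⟩
    simp
  · rintro _ ⟨_, rfl, i, rfl⟩ _ ⟨c, rfl⟩
    simp [moveOne]
  · simp only [sem_mul, sem_assign, exists_eq_left, sem_kstar, sem_test]
    set x' := x ∘ fun p => if p = .inr () then .inl a else p with hx'
    have h₁ : x' (.inr ()) = x (.inl a) := by simp [hx']
    have h₂ : x' (.inl b) = x (.inl b) := by simp [hx']
    constructor
    · rintro ⟨w, hw⟩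
      refine ⟨_, _, reflTransGen_moves_walk (H := H j) (Set.mem_singleton (.inr ())) w x', ?_, rfl⟩
      simp only [Setoid.ker_def, Function.update_self, h₁]
      exact Eq.trans hw (h₂.symm.trans (Function.update_of_ne (by simp) _ _).symm)
    · rintro ⟨z, _, hz, hk, rfl⟩
      have : (H j).Reachable (x' (.inr ())) (z (.inr ())) ∧ z (.inl b) = x' (.inl b) := by
        clear hk
        induction hz with
        | refl => exact ⟨.refl _, rfl⟩
        | tail _ hs ih =>
          obtain ⟨_, ⟨_, rfl, i, rfl⟩, -, rfl⟩ := (sem_letters _).1 hs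
          rw [step_moveOne, Function.update_self, Function.update_of_ne (by simp)]
          exact ⟨ih.1.edge i, ih.2⟩
      rw [h₁, h₂, Setoid.ker_def.1 hk] at this
      rw [this.2] at this
      exact this.1

theorem decides_targetReachable : Decides GridIn.TargetReachable := by
  refine (Recog.reachable (J := GridIn) (D := GridIn.Marked) false true).congr fun j x hx => ?_
  rw [hx.1, hx.2, GridIn.reachable_iff, GridIn.targetReachable_iff]
  exact ⟨fun ⟨v, hv⟩ => ⟨_, hv⟩, fun ⟨q, hq⟩ => ⟨q.1, hq ▸ congrArg (posMap j.φ)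
    (Prod.ext rfl (congrArg Prod.snd hq).symm)⟩⟩

/-- The program `L` for grids, executed by the pebbles `P` in addition to the marking pebbles. -/
noncomputable def onInputs {P : Type} (L : Language (Atom P)) : Language (Atom (Bool ⊕ P)) :=
  Language.map (relabel Sum.inr Set.univ) L

section onInputs

variable {P : Type} {j : GridIn} {x : Bool ⊕ P → j.Pos} {w : List (Atom P)}

theorem trace_onInputs (p : P) (hx : x ∘ Sum.inr = fun _ => (j.G.start, 0)) :
    (trace j.edges (w.map (relabel Sum.inr Set.univ)) x).map (· (Sum.inr p)) =
      ((trace (gridEdges j.g) w fun _ => (0, 0)).map (· p)).map (posMap j.φ) := by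
  have h := trace_relabel (H := j.edges) (e := (Sum.inr : P → Bool ⊕ P)) (M := Set.univ)
    (fun _ _ _ h => Sum.inr_injective h) (w := w) (fun a _ q hq => (hq trivial).elim) x
  rw [hx, show (fun _ : P => (j.G.start, (0 : Fin j.G.d))) = posMap j.φ ∘ fun _ => (0, 0) from
    funext fun _ => j.isGridMap.posMap_zero.symm, trace_hom j.isGridMap.posMap_edge] at h
  have := congrArg (List.map (· p)) h
  simpa [List.map_map, Function.comp_def] using this

theorem exec_onInputs (p : P) (hx : x ∘ Sum.inr = fun _ => (j.G.start, 0)) :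
    exec j.edges (w.map (relabel Sum.inr Set.univ)) x (Sum.inr p) =
      posMap j.φ (exec (gridEdges j.g) w (fun _ => (0, 0)) p) := by
  have h := exec_relabel_comp (H := j.edges) (e := (Sum.inr : P → Bool ⊕ P)) (M := Set.univ)
    (fun _ _ _ h => Sum.inr_injective h) (w := w) (fun a _ q hq => (hq trivial).elim) x
  rw [hx, show (fun _ : P => (j.G.start, (0 : Fin j.G.d))) = posMap j.φ ∘ fun _ => (0, 0) from
    funext fun _ => j.isGridMap.posMap_zero.symm, exec_hom j.isGridMap.posMap_edge] at h
  exact congrFun h p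

theorem ok_onInputs (hx : x ∘ Sum.inr = fun _ => (j.G.start, 0)) :
    ok j.edges (w.map (relabel Sum.inr Set.univ)) x ↔ ok (gridEdges j.g) w fun _ => (0, 0) := by
  have h := ok_relabel (H := j.edges) (e := (Sum.inr : P → Bool ⊕ P)) (M := Set.univ)
    (fun _ _ _ h => Sum.inr_injective h) (w := w) (fun a _ q hq => (hq trivial).elim) x
  rw [hx, show (fun _ : P => (j.G.start, (0 : Fin j.G.d))) = posMap j.φ ∘ fun _ => (0, 0) from
    funext fun _ => j.isGridMap.posMap_zero.symm, ok_hom j.isGridMap.posMap_edge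
    j.isGridMap.posMap_injective] at h
  exact h

end onInputs

/-- Every successful sweep puts `curr` on the first edge out of every node of the component and on
no other edges. With the additional guard that `curr` does not meet the target pebble, a run can
succeed exactly if the target is outside the component. -/
theorem decides_not_targetReachable : Decides fun j => ¬j.TargetReachable := by
  obtain ⟨P, _, base, curr, L, hL, hsweep⟩ := exists_sweep
  -- Auxiliary pebbles may be anywhere at first, so those of the sweep are gathered on the start
  -- node.
  let σ : Bool ⊕ P → Bool ⊕ P := Sum.elim .inl fun _ => .inl false
  let c : Setoid (Bool ⊕ P) → Prop := fun π => ¬π (.inr curr) (.inl true)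
  have hfix : ∀ w ∈ onInputs L, ∀ a ∈ w, ∀ p ∈ Set.range Sum.inl, a.2 p = .jump p := by
    rintro _ ⟨w, hw, rfl⟩ a ha _ ⟨b, rfl⟩
    obtain ⟨a, -, rfl⟩ := List.mem_map.1 ha
    simp [relabel]
  refine ⟨P, inferInstance, assign σ * Language.map (restrict c) (onInputs L),
    (Language.isRegular_letters _).mul ((hL.map _).map _), (fixes_assign ?_).mul ?_,
    fun j x hx => ?_⟩
  · rintro _ ⟨b, rfl⟩
    rfl
  · rintro _ ⟨w, hw, rfl⟩ a ha p hp
    obtain ⟨b, hb, rfl⟩ := List.mem_map.1 ha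
    exact hfix w hw b hb p hp
  · simp only [sem_mul, sem_assign, exists_eq_left]
    have hx' : (x ∘ σ) ∘ Sum.inr = fun _ => (j.G.start, 0) := funext fun _ => hx.1
    obtain ⟨⟨_, w, hw, hok, -⟩, hs⟩ := hsweep j.g (fun _ => (0, 0)) rfl rfl
    have key : ∀ w ∈ L, ok (gridEdges j.g) w (fun _ => (0, 0)) →
        ((∀ z ∈ trace j.edges (w.map (relabel Sum.inr Set.univ)) (x ∘ σ), c (Setoid.ker z)) ↔
          ¬j.TargetReachable) := by
      intro w hw hok
      have h₁ : ∀ z ∈ trace j.edges (w.map (relabel Sum.inr Set.univ)) (x ∘ σ),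
          z (.inl true) = (j.G.target, 0) := fun z hz =>
        (apply_of_mem_trace (fun a ha => hfix _ ⟨w, hw, rfl⟩ a ha _ ⟨true, rfl⟩) hz).trans hx.2
      have h₂ := trace_onInputs (w := w) curr hx'
      rw [GridIn.targetReachable_iff]
      constructor
      · rintro h ⟨v, hv⟩
        have := List.mem_map_of_mem (f := posMap j.φ) ((hs w hw hok).1.mem v)
        rw [← h₂, hv] at this
        obtain ⟨z, hz, hzc⟩ := List.mem_map.1 this
        exact h z hz (hzc.trans (h₁ z hz).symm)
      · intro h z hz hzc
        have : z (.inr curr) ∈ (trace j.edges (w.map (relabel Sum.inr Set.univ)) (x ∘ σ)).map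
            (· (Sum.inr curr)) := List.mem_map.2 ⟨z, hz, rfl⟩
        rw [h₂] at this
        obtain ⟨⟨v, i⟩, hv, e⟩ := List.mem_map.1 this
        obtain rfl : i = 0 := (hs w hw hok).1.label _ hv
        exact h ⟨v, e.trans ((Setoid.ker_def.1 hzc).trans (h₁ z hz))⟩
    constructor
    · intro h
      exact ⟨_, _, ⟨_, ⟨w, hw, rfl⟩, rfl⟩,
        (ok_restrict _ _).2 ⟨(ok_onInputs hx').2 hok, (key w hw hok).2 h⟩, rfl⟩
    · rintro ⟨_, _, ⟨_, ⟨w, hw, rfl⟩, rfl⟩, hok, -⟩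
      rw [ok_restrict, ok_onInputs hx'] at hok
      exact (key w hw hok.1).1 hok.2

/-- The component of the start node is an embedded grid, and programs behave the same on it. The
arguments have to lie in the component; the auxiliary pebbles are brought there before the program
starts. -/
theorem Def.onInputs {α : Type} {R : ∀ g : GridIx, (α → g.Pos) → Prop} (h : Def R) :
    Recog GridIn.edges (β := Option α)
      (fun j y => y none = (j.G.start, 0) ∧ ∀ a, ∃ z, posMap j.φ z = y (some a))
      fun j y => ∃ z : α → j.g.Pos, posMap j.φ ∘ z = y ∘ some ∧ R j.g z := by
  obtain ⟨T, _, L, hL, hF, h⟩ := h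
  let σ : Option α ⊕ T → Option α ⊕ T := Sum.elim .inl fun _ => .inl none
  refine ⟨T, inferInstance, assign σ * L, (Language.isRegular_letters _).mul hL,
    (fixes_assign ?_).mul hF, fun j x hx => ?_⟩
  · rintro _ ⟨b, rfl⟩
    rfl
  obtain ⟨h₁, h₂⟩ := hx
  choose z hz using h₂
  let x' : Option α ⊕ T → j.g.Pos :=
    Sum.elim (fun a => a.elim (0, 0) z) fun _ => (0, 0)
  have hx' : x ∘ σ = posMap j.φ ∘ x' := by
    funext p
    rcases p with (_ | a) | t
    · exact h₁.trans j.isGridMap.posMap_zero.symm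
    · exact (hz a).symm
    · exact h₁.trans j.isGridMap.posMap_zero.symm
  have hR : (∃ z : α → j.g.Pos, posMap j.φ ∘ z = (x ∘ Sum.inl) ∘ some ∧ R j.g z) ↔ R j.g z := by
    constructor
    · rintro ⟨z', hz', hR⟩
      convert hR
      funext a
      exact j.isGridMap.posMap_injective ((hz a).trans (congrFun hz' a).symm)
    · exact fun h => ⟨z, funext hz, h⟩
  simp only [sem_mul, sem_assign, exists_eq_left]
  rw [hR, hx']
  refine (h j.g x' rfl).trans ?_
  constructor
  · rintro ⟨_, w, hw, hok, -⟩
    exact ⟨_, w, hw, (ok_hom j.isGridMap.posMap_edge j.isGridMap.posMap_injective _ _).2 hok, rfl⟩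
  · rintro ⟨_, w, hw, hok, -⟩
    exact ⟨_, w, hw, (ok_hom j.isGridMap.posMap_edge j.isGridMap.posMap_injective _ _).1 hok, rfl⟩

/-- The encoding depends on whether the target can be reached, and both cases can be recognised. The
program for a reachable target is correct only if the target pebble lies in the component, which is
why `Recog.and_of` is used. -/
theorem decides_accepts (M : NTM) (hM : M.IsLogSpace) :
    Decides fun j => M.Accepts (encode j.G (lexNodes j.G j.ℓ)) := by
  have hout : Decides fun j => ¬j.TargetReachable ∧ M.Accepts (gridWord j.g (j.ℓ ^ j.G.d)) := by
    refine decides_not_targetReachable.and ?_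
    have := (def_accepts_outside M hM).onInputs.rename (D' := GridIn.Marked)
      (fun _ => false) fun j x hx => ⟨hx.1, nofun⟩
    refine this.congr fun j x _ => ?_
    exact ⟨fun h => ⟨nofun, funext nofun, h⟩, fun ⟨_, _, h⟩ => h⟩
  obtain ⟨R, hR, hR'⟩ := def_accepts_inside M hM
  have hin : Decides fun j => j.TargetReachable ∧
      ∃ v, posMap j.φ (v, 0) = (j.G.target, 0) ∧ M.Accepts (gridWord j.g (nodeIdx v)) := by
    refine decides_targetReachable.and_of ?_
    have := hR.onInputs.rename (D' := fun j x => j.Marked x ∧ j.TargetReachable)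
      (fun a => a.elim false fun _ => true) fun j x hx => ⟨hx.1.1, fun _ => by
        obtain ⟨v, hv⟩ := GridIn.targetReachable_iff.1 hx.2
        exact ⟨_, hv.trans hx.1.2.symm⟩⟩
    refine this.congr fun j x hx => ?_
    constructor
    · rintro ⟨v, hv, h⟩
      exact ⟨fun _ => (v, 0), funext fun _ => hv.trans hx.1.2.symm, (hR' _ _ rfl).2 h⟩
    · rintro ⟨z, hz, h⟩
      have e : posMap j.φ (z ()) = (j.G.target, 0) := (congrFun hz ()).trans hx.1.2
      have e₂ : (z ()).2 = 0 := congrArg Prod.snd e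
      refine ⟨(z ()).1, ?_, (hR' _ _ e₂).1 h⟩
      rw [← e]
      exact congrArg (posMap j.φ) (Prod.ext rfl e₂.symm)
  refine (hout.or hin).congr fun j x _ => ?_
  beta_reduce
  by_cases ht : j.TargetReachable
  · obtain ⟨v, hv⟩ := GridIn.targetReachable_iff.1 ht
    have hv' : j.φ v = j.G.target := congrArg Prod.fst hv
    rw [j.isGridMap.encode_of_eq hv']
    simp only [ht, not_true, false_and, true_and, false_or]
    constructor
    · exact fun h => ⟨v, hv, h⟩
    · rintro ⟨u, hu, h⟩
      rwa [j.isGridMap.injective (hv'.trans (congrArg Prod.fst hu).symm)]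
  · rw [j.isGridMap.encode_of_not_reachable ht]
    simp [ht]

theorem Decides.exists_jag {K : GridIn → Prop} (h : Decides K) :
    ∃ J : EdgeJAG, ∀ j : GridIn, EdgeJAG.Accepts J j.G ↔ K j := by
  obtain ⟨T, _, L, hL, -, h⟩ := h
  refine ⟨jagOf hL (.inl false) (.inl true) (by simp), fun j => ?_⟩
  refine (isAcceptingComputation_iff hL).trans (h j _ ⟨?_, ?_⟩).symm
  · simp [JAG.initial, jagOf]
  · simp [JAG.initial, jagOf]

/-- There is an automaton that visits the nodes in the lexicographic order. -/
theorem exists_ordering_jag : ∃ (J : EdgeJAG) (curr : J.P), ∀ j : GridIn,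
    EdgeJAG.Accepts J j.G ∧ ∀ c, EdgeJAG.IsAcceptingComputation J j.G c →
      EdgeJAG.visits curr c = lexNodes j.G j.ℓ := by
  classical
  obtain ⟨P, _, base, curr, L, hL, hsweep⟩ := exists_sweep
  refine ⟨jagOf (hL.map (relabel Sum.inr Set.univ)) (.inl false) (.inl true) (by simp), .inr curr,
    fun j => ?_⟩
  set J := jagOf (hL.map (relabel (Sum.inr : P → Bool ⊕ P) Set.univ)) (.inl false) (.inl true)
    (by simp)
  have hx : (J.initial (j.G.start, (0 : Fin j.G.d)) (j.G.target, 0)).2 ∘ Sum.inr =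
      fun _ => (j.G.start, 0) := by
    funext p
    simp [JAG.initial, J, jagOf]
  obtain ⟨⟨_, w, hw, hok, -⟩, hs⟩ := hsweep j.g (fun _ => (0, 0)) rfl rfl
  refine ⟨exists_isAcceptingComputation _ ⟨w, hw, rfl⟩ ((ok_onInputs hx).2 hok), fun c hc => ?_⟩
  obtain ⟨_, ⟨w, hw, rfl⟩, hok, hc⟩ := exists_word_of_isAcceptingComputation _ hc
  rw [ok_onInputs hx] at hok
  obtain ⟨h₁, p, hp, hpe⟩ := hs w hw hok
  -- A computation lists the final positions twice after the trace; these repetitions do not disturb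
  -- the sweep.
  have h₂ := (h₁.concat hp).concat (p := p) (by simp)
  have e : (c.map fun x => (x.2 (Sum.inr curr)).1) = (((((trace (gridEdges j.g) w
      fun _ => (0, 0)).map (· curr)) ++ [p]) ++ [p]).map Prod.fst).map j.φ := by
    have := congrArg (List.map fun x : Bool ⊕ P → j.Pos => (x (Sum.inr curr)).1) hc
    refine (List.map_map.symm.trans this).trans ?_
    have h₃ := trace_onInputs (w := w) curr hx
    have h₄ := exec_onInputs (w := w) curr hx
    have h₅ := congrArg (List.map Prod.fst) h₃
    rw [← hpe] at h₄
    simp only [List.map_map, Function.comp_def, List.map_append, List.map_cons, List.map_nil] at h₅ ⊢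
    rw [h₅, h₄]
    simp [posMap]
  have := h₂.destutter_eq
  rw [j.isGridMap.lexNodes_eq]
  refine (congrArg (List.destutter (· ≠ ·)) e).trans ?_
  rw [← List.map_destutter_ne _ j.isGridMap.injective]
  convert congrArg (List.map j.φ) this using 1
  rw [List.map_map]
  rfl

end NDJag

namespace NDJag

/-! ### Deterministic automata do not visit all nodes of a hypercube -/

/-- The function `T` is bounded by a polynomial. -/
def PolyBounded (T : ℕ → ℕ) : Prop := ∃ C, ∀ d, 2 ≤ d → T d ≤ d ^ C

namespace PolyBounded

variable {S T : ℕ → ℕ}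

theorem const (n : ℕ) : PolyBounded fun _ => n :=
  ⟨n, fun d hd => (Nat.lt_pow_self (by omega)).le⟩

theorem id : PolyBounded fun d => d := ⟨1, fun d _ => by simp⟩

theorem mul (hS : PolyBounded S) (hT : PolyBounded T) : PolyBounded fun d => S d * T d := by
  obtain ⟨a, ha⟩ := hS
  obtain ⟨b, hb⟩ := hT
  exact ⟨a + b, fun d hd => by rw [pow_add]; exact Nat.mul_le_mul (ha d hd) (hb d hd)⟩

theorem add (hS : PolyBounded S) (hT : PolyBounded T) : PolyBounded fun d => S d + T d := by
  obtain ⟨a, ha⟩ := hS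
  obtain ⟨b, hb⟩ := hT
  refine ⟨a + b + 1, fun d hd => ?_⟩
  have h₁ : d ^ a ≤ d ^ (a + b) := Nat.pow_le_pow_right (by omega) (by omega)
  have h₂ : d ^ b ≤ d ^ (a + b) := Nat.pow_le_pow_right (by omega) (by omega)
  have h₃ := Nat.mul_le_mul_left (d ^ (a + b)) hd
  change S d + T d ≤ _
  rw [pow_succ]
  have := ha d hd
  have := hb d hd
  omega

theorem pow (hT : PolyBounded T) (n : ℕ) : PolyBounded fun d => T d ^ n := by
  obtain ⟨a, ha⟩ := hT
  exact ⟨a * n, fun d hd => by rw [pow_mul]; exact Nat.pow_le_pow_left (ha d hd) n⟩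

theorem exists_lt_two_pow (hT : PolyBounded T) : ∃ d, 2 ≤ d ∧ T d < 2 ^ d := by
  obtain ⟨a, ha⟩ := hT
  set n := a + 2
  have h₁ : n < 2 ^ n := Nat.lt_two_pow_self
  have h₂ : 4 ≤ 2 ^ n := by
    calc 4 = 2 ^ 2 := rfl
      _ ≤ 2 ^ n := Nat.pow_le_pow_right (by omega) (by omega)
  have h₃ : 3 * n * n < 2 ^ (3 * n) := by
    calc 3 * n * n ≤ 3 * (n * n) := by rw [mul_assoc]
      _ < 2 ^ n * (2 ^ n * 2 ^ n) := by
        have := Nat.mul_lt_mul'' h₁ h₁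
        nlinarith
      _ = 2 ^ (3 * n) := by rw [← pow_add, ← pow_add]; congr 1; omega
  have h₄ : 2 ≤ 2 ^ (3 * n) := by
    calc 2 = 2 ^ 1 := rfl
      _ ≤ _ := Nat.pow_le_pow_right (by omega) (by omega)
  -- For `d = 2 ^ (3 * n)` the power `d ^ a` is `2 ^ (3 * n * a)`, and `3 * n * a ≤ 3 * n * n < d`.
  refine ⟨2 ^ (3 * n), h₄, (ha _ h₄).trans_lt ?_⟩
  rw [← pow_mul]
  refine Nat.pow_lt_pow_right (by omega) (lt_of_le_of_lt ?_ h₃)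
  exact Nat.mul_le_mul_left _ (by omega)

end PolyBounded

/-- The pebble whose position determines the new position of the pebble `p`. -/
def Move.src {P : Type} (p : P) : Move 2 P → P
  | .move _ => p
  | .jump j => j

/-- The parameters of the hypercube. -/
abbrev cube (d : ℕ) [NeZero d] : GridIx := ⟨d, 2⟩

/-- Configurations of a deterministic automaton on the hypercube in which the pebbles are divided
into clusters: the state, the positions of the pebbles, and the cluster of each pebble. -/
abbrev Clustered (Q P : Type) (d : ℕ) [NeZero d] : Type := (Q × (P → (cube d).Pos)) × (P → P)

/-- One step of the automaton with transition function `m`. -/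
def detStep {Q P : Type} (m : Q → Setoid P → Q × (P → Move 2 P)) {U : Type}
    (H : LabelledGraph U 2) (y : Q × (P → U)) : Q × (P → U) :=
  ((m y.1 (Setoid.ker y.2)).1, fun p => ((m y.1 (Setoid.ker y.2)).2 p).apply H y.2 p)

/-! ### Clusters of pebbles and their independent translations -/

namespace Clustered

variable {Q P : Type} {d : ℕ} [NeZero d] (m : Q → Setoid P → Q × (P → Move 2 P))

/-- One step; a pebble that jumps joins the cluster of the other pebble. -/
def step (z : Clustered Q P d) : Clustered Q P d :=
  (detStep m (gridEdges (cube d)) z.1,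
    fun p => z.2 (((m z.1.1 (Setoid.ker z.1.2)).2 p).src p))

/-- Rename the clusters. -/
def mapCl (f : P → P) (z : Clustered Q P d) : Clustered Q P d := (z.1, f ∘ z.2)

/-- Translate each cluster `n` by `h n`. -/
def shift (h : P → Fin d → ZMod 2) (z : Clustered Q P d) : Clustered Q P d :=
  ((z.1.1, fun p => ((z.1.2 p).1 + h (z.2 p), (z.1.2 p).2)), z.2)

/-- Pebbles of different clusters do not coincide. -/
def Separated (z : Clustered Q P d) : Prop := ∀ p q, z.1.2 p = z.1.2 q → z.2 p = z.2 q

/-- The number of clusters. -/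
noncomputable def size (z : Clustered Q P d) : ℕ := (Set.range z.2).ncard

variable {m} {z : Clustered Q P d} {h : P → Fin d → ZMod 2}

theorem iterate_step_mapCl (f : P → P) (t : ℕ) (z : Clustered Q P d) :
    (step m)^[t] (mapCl f z) = mapCl f ((step m)^[t] z) :=
  ((Function.Semiconj.iterate_right (f := mapCl f) (ga := step m) (gb := step m)
    (fun _ => rfl) t) z).symm

theorem apply_shift (z : Clustered Q P d) (h : P → Fin d → ZMod 2) (p : P) (μ : Move 2 P) :
    μ.apply (gridEdges (cube d)) (shift h z).1.2 p =
      ((μ.apply (gridEdges (cube d)) z.1.2 p).1 + h (z.2 (μ.src p)),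
        (μ.apply (gridEdges (cube d)) z.1.2 p).2) := by
  match μ with
  | .jump j => rfl
  | .move 0 => rfl
  | .move 1 => exact Prod.ext (add_right_comm _ _ _) rfl

/-- Translating a cluster does not change coincidences inside it, and between clusters there are
none before or after the translation. The automaton therefore chooses the same transition, and moves
commute with translations because the group is abelian. -/
theorem step_shift (h₁ : Separated z) (h₂ : Separated (shift h z)) :
    step m (shift h z) = shift h (step m z) := by
  have hker : Setoid.ker (shift h z).1.2 = Setoid.ker z.1.2 := by
    ext p q
    rw [Setoid.ker_def, Setoid.ker_def]
    constructor
    · intro e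
      have hc : z.2 p = z.2 q := h₂ p q e
      simp only [shift, Prod.mk.injEq, hc, add_left_inj] at e
      exact Prod.ext e.1 e.2
    · intro e
      simp only [shift, e, h₁ p q e]
  refine Prod.ext (Prod.ext ?_ ?_) ?_
  · change (m z.1.1 (Setoid.ker (shift h z).1.2)).1 = (m z.1.1 (Setoid.ker z.1.2)).1
    rw [hker]
  · funext p
    change ((m z.1.1 (Setoid.ker (shift h z).1.2)).2 p).apply _ _ p = _
    rw [hker, apply_shift]
    rfl
  · funext p
    change z.2 (((m z.1.1 (Setoid.ker (shift h z).1.2)).2 p).src p) = _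
    rw [hker]
    rfl

theorem iterate_step_shift {t : ℕ} (h₁ : ∀ s < t, Separated ((step m)^[s] z))
    (h₂ : ∀ s < t, Separated ((step m)^[s] (shift h z))) :
    (step m)^[t] (shift h z) = shift h ((step m)^[t] z) := by
  induction t with
  | zero => rfl
  | succ t ih =>
    have e := ih (fun s hs => h₁ s (by omega)) fun s hs => h₂ s (by omega)
    rw [Function.iterate_succ_apply', Function.iterate_succ_apply', e]
    exact step_shift (h₁ t (by omega)) (e ▸ h₂ t (by omega))

/-- Here it matters that the modulus is `2`: translations are involutions. -/
theorem shift_shift (h : P → Fin d → ZMod 2) (z : Clustered Q P d) : shift h (shift h z) = z := by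
  refine Prod.ext (Prod.ext rfl (funext fun p => Prod.ext ?_ rfl)) rfl
  funext k
  change (z.1.2 p).1 k + h (z.2 p) k + h (z.2 p) k = _
  rw [add_assoc, CharTwo.add_self_eq_zero, add_zero]

/-- If a configuration is a translate of an earlier one, then some configuration is repeated. -/
theorem exists_repeat {T t₁ t₂ : ℕ} (hz : ∀ t ≤ 2 * T, Separated ((step m)^[t] z)) (ht : t₁ < t₂)
    (hT : t₂ ≤ T) (e : (step m)^[t₂] z = shift h ((step m)^[t₁] z)) :
    ∃ t₁ t₂, t₁ < t₂ ∧ t₂ ≤ 2 * T ∧ (step m)^[t₂] z = (step m)^[t₁] z := by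
  -- Another `t₂ - t₁` steps apply the same translation a second time, and this cancels the first.
  refine ⟨t₁, t₂ - t₁ + t₂, by omega, by omega, ?_⟩
  rw [Function.iterate_add_apply, e, iterate_step_shift, ← Function.iterate_add_apply,
    show t₂ - t₁ + t₁ = t₂ by omega, e, shift_shift]
  · intro s hs
    rw [← Function.iterate_add_apply]
    exact hz _ (by omega)
  · intro s hs
    rw [← e, ← Function.iterate_add_apply]
    exact hz _ (by omega)

open Classical in
/-- Merge the clusters of `p` and `q`. -/
noncomputable def merge (p q : P) (z : Clustered Q P d) : Clustered Q P d :=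
  mapCl (fun n => if n = z.2 q then z.2 p else n) z

theorem merge_self (p : P) (z : Clustered Q P d) : merge p p z = z := by
  refine Prod.ext rfl (funext fun r => ?_)
  simp only [merge, mapCl, Function.comp]
  split_ifs with h
  exacts [h.symm, rfl]

/-- If `p` and `q` coincide both before and after the translation, their clusters are translated by
the same vector, which can then serve the merged cluster. -/
theorem merge_shift {p q : P} (h₁ : z.1.2 p = z.1.2 q)
    (h₂ : (shift h z).1.2 p = (shift h z).1.2 q) :
    merge p q (shift h z) = shift h (merge p q z) := by
  have e : h (z.2 p) = h (z.2 q) := by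
    simpa [shift, h₁] using h₂
  refine Prod.ext (Prod.ext rfl (funext fun r => Prod.ext ?_ rfl)) rfl
  simp only [merge, mapCl, shift, Function.comp]
  split_ifs with hr
  · rw [hr, e]
  · rfl

theorem mapCl_merge {p q : P} {f : P → P} (hf : f (z.2 p) = f (z.2 q)) :
    mapCl f (merge p q z) = mapCl f z := by
  refine Prod.ext rfl (funext fun r => ?_)
  simp only [merge, mapCl, Function.comp]
  split_ifs with hr
  · rw [hr, hf]
  · rfl

section size

variable [Finite P]

theorem size_mapCl_le (f : P → P) (z : Clustered Q P d) : size (mapCl f z) ≤ size z := by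
  unfold size mapCl
  rw [Set.range_comp]
  exact Set.ncard_image_le (Set.toFinite _)

theorem size_step_le (z : Clustered Q P d) : size (step m z) ≤ size z :=
  Set.ncard_le_ncard (by rintro _ ⟨p, rfl⟩; exact ⟨_, rfl⟩) (Set.toFinite _)

theorem size_iterate_step_le (t : ℕ) (z : Clustered Q P d) : size ((step m)^[t] z) ≤ size z := by
  induction t with
  | zero => rfl
  | succ t ih =>
    rw [Function.iterate_succ_apply']
    exact (size_step_le _).trans ih

theorem size_merge_lt {p q : P} (hpq : z.2 p ≠ z.2 q) : size (merge p q z) < size z := by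
  refine Set.ncard_lt_ncard ⟨?_, fun h => ?_⟩ (Set.toFinite _)
  · rintro _ ⟨r, rfl⟩
    simp only [merge, mapCl, Function.comp]
    split_ifs
    exacts [⟨p, rfl⟩, ⟨r, rfl⟩]
  · obtain ⟨r, hr⟩ := h ⟨q, rfl⟩
    simp only [merge, mapCl, Function.comp] at hr
    split_ifs at hr with h'
    exacts [hpq hr, h' hr]

end size

variable (m) in
/-- Alternately run the automaton for some time and merge two clusters. -/
noncomputable def run {B : ℕ} : List (Fin B × P × P) → Clustered Q P d → Clustered Q P d
  | [], z => z
  | (t, p, q) :: σ, z => run σ (merge p q ((step m)^[t] z))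

variable (m) in
/-- Clusters do not meet as long as the automaton runs, and clusters are merged only when they
meet. -/
def Legal {B : ℕ} : List (Fin B × P × P) → Clustered Q P d → Prop
  | [], _ => True
  | (t, p, q) :: σ, z => (∀ s < t.val, Separated ((step m)^[s] z)) ∧
      ((step m)^[t] z).1.2 p = ((step m)^[t] z).1.2 q ∧ Legal σ (merge p q ((step m)^[t] z))

/-- The total running time. -/
def duration {B : ℕ} (σ : List (Fin B × P × P)) : ℕ := (σ.map fun e => e.1.val).sum

theorem run_shift {B : ℕ} {σ : List (Fin B × P × P)} (h₁ : Legal m σ z)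
    (h₂ : Legal m σ (shift h z)) : run m σ (shift h z) = shift h (run m σ z) := by
  induction σ generalizing z with
  | nil => rfl
  | cons e σ ih =>
    obtain ⟨t, p, q⟩ := e
    obtain ⟨a₁, b₁, c₁⟩ := h₁
    obtain ⟨a₂, b₂, c₂⟩ := h₂
    have e := iterate_step_shift a₁ a₂
    rw [e] at b₂ c₂
    rw [merge_shift b₁ b₂] at c₂
    rw [run, run, e, merge_shift b₁ b₂]
    exact ih c₁ c₂

/-- Either a configuration is repeated, or enough clusters meet. -/
theorem exists_legal [Finite P] {B k : ℕ} (hB : ∀ z : Clustered Q P d, k < size z →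
      (∀ t ≤ B, Separated ((step m)^[t] z) ∧ size ((step m)^[t] z) = size z) →
      ∃ t₁ t₂, t₁ < t₂ ∧ t₂ ≤ B ∧ (step m)^[t₂] z = (step m)^[t₁] z)
    (p₀ : P) {f : P → P} (n : ℕ) (z : Clustered Q P d) (hn : size z ≤ k + n)
    (hz : ∀ t ≤ n * B, Separated ((step m)^[t] (mapCl f z)) ∧
      size ((step m)^[t] (mapCl f z)) = k) :
    (∃ t₁ t₂, t₁ < t₂ ∧ t₂ ≤ n * B ∧ (step m)^[t₂] (mapCl f z) = (step m)^[t₁] (mapCl f z)) ∨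
      ∃ σ : List.Vector (Fin (B + 1) × P × P) n, Legal m σ.toList z ∧
        duration σ.toList ≤ n * B ∧ size (run m σ.toList z) = k ∧
        mapCl f (run m σ.toList z) = (step m)^[duration σ.toList] (mapCl f z) := by
  have hk : k ≤ size z := by
    rw [← (hz 0 (Nat.zero_le _)).2]
    exact size_mapCl_le f z
  induction n generalizing z with
  | zero => exact .inr ⟨.nil, trivial, Nat.zero_le _, hn.antisymm hk, rfl⟩
  | succ n ih =>
    -- One round of the history: run for time `t`, then merge the clusters of `p` and `q`. The
    -- induction hypothesis supplies the remaining rounds.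
    have key : ∀ (t : ℕ) (p q : P), t ≤ B → (∀ s < t, Separated ((step m)^[s] z)) →
        ((step m)^[t] z).1.2 p = ((step m)^[t] z).1.2 q →
        size (merge p q ((step m)^[t] z)) ≤ k + n →
        (∃ t₁ t₂, t₁ < t₂ ∧ t₂ ≤ (n + 1) * B ∧
          (step m)^[t₂] (mapCl f z) = (step m)^[t₁] (mapCl f z)) ∨
        ∃ σ : List.Vector (Fin (B + 1) × P × P) (n + 1), Legal m σ.toList z ∧
          duration σ.toList ≤ (n + 1) * B ∧ size (run m σ.toList z) = k ∧
          mapCl f (run m σ.toList z) = (step m)^[duration σ.toList] (mapCl f z) := by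
      intro t p q ht hs hpq hsize
      have hnB : (n + 1) * B = n * B + B := Nat.succ_mul n B
      have hf : mapCl f (merge p q ((step m)^[t] z)) = (step m)^[t] (mapCl f z) := by
        rw [iterate_step_mapCl]
        -- Clusters of the coarse division `mapCl f` stay apart, so pebbles that meet already belong
        -- to the same coarse cluster and the merging is invisible there.
        refine mapCl_merge ?_
        have := (hz t (by omega)).1 p q
        rw [iterate_step_mapCl] at this
        exact this hpq
      have hz' : ∀ s ≤ n * B,
          Separated ((step m)^[s] (mapCl f (merge p q ((step m)^[t] z)))) ∧
          size ((step m)^[s] (mapCl f (merge p q ((step m)^[t] z)))) = k := by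
        intro s hs
        rw [hf, ← Function.iterate_add_apply]
        exact hz _ (by omega)
      have hk' : k ≤ size (merge p q ((step m)^[t] z)) := by
        rw [← (hz' 0 (Nat.zero_le _)).2]
        exact size_mapCl_le f _
      rcases ih _ hsize hz' hk' with ⟨t₁, t₂, h₁, h₂, h₃⟩ | ⟨σ, h₁, h₂, h₃, h₄⟩
      · rw [hf, ← Function.iterate_add_apply, ← Function.iterate_add_apply] at h₃
        exact .inl ⟨t₁ + t, t₂ + t, by omega, by omega, h₃⟩
      · rw [hf, ← Function.iterate_add_apply] at h₄
        have hd : duration (List.Vector.cons (⟨t, Nat.lt_succ_of_le ht⟩, p, q) σ).toList =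
            duration σ.toList + t := by
          simp [duration, add_comm]
        refine .inr ⟨.cons (⟨t, Nat.lt_succ_of_le ht⟩, p, q) σ, ?_, ?_, ?_, ?_⟩
        · rw [List.Vector.toList_cons]
          exact ⟨hs, hpq, h₁⟩
        · rw [hd]
          omega
        · rw [List.Vector.toList_cons]
          exact h₃
        · rw [hd, ← h₄, List.Vector.toList_cons]
          rfl
    -- If only `k` clusters are left, the history is padded by trivial rounds, so that all histories
    -- have the same length.
    by_cases hlt : size z = k
    · refine key 0 p₀ p₀ (Nat.zero_le _) (fun s hs => absurd hs (Nat.not_lt_zero s)) rfl ?_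
      rw [merge_self]
      exact hlt.le.trans (Nat.le_add_right _ _)
    by_cases hall : ∀ t ≤ B, Separated ((step m)^[t] z) ∧ size ((step m)^[t] z) = size z
    · obtain ⟨t₁, t₂, h₁, h₂, h₃⟩ := hB z (by omega) hall
      refine .inl ⟨t₁, t₂, h₁, h₂.trans (Nat.le_mul_of_pos_left _ n.succ_pos), ?_⟩
      rw [iterate_step_mapCl, iterate_step_mapCl, h₃]
    classical
    push Not at hall
    -- The first time at which clusters meet or their number has dropped. In the latter case a
    -- trivial merge records the round.
    have hex : ∃ t, t ≤ B ∧ (Separated ((step m)^[t] z) → size ((step m)^[t] z) ≠ size z) := hall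
    obtain ⟨ht, hfail⟩ := Nat.find_spec hex
    set t := Nat.find hex
    have hs : ∀ s < t, Separated ((step m)^[s] z) := fun s hs => by
      by_contra hsep
      exact Nat.find_min hex hs ⟨hs.le.trans ht, fun h => absurd h hsep⟩
    have hle := size_iterate_step_le (m := m) t z
    by_cases hsep : Separated ((step m)^[t] z)
    · refine key t p₀ p₀ ht hs rfl ?_
      rw [merge_self]
      have := hfail hsep
      omega
    · unfold Separated at hsep
      push Not at hsep
      obtain ⟨p, q, hpq, hne⟩ := hsep
      refine key t p q ht hs hpq ?_
      have := size_merge_lt hne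
      omega

/-- Equal sizes make `f` injective on the clusters that occur, so each translation vector can be
attached to the new name. -/
theorem exists_shift_mapCl [Finite P] {f : P → P} (hf : size (mapCl f z) = size z) (h : P → Fin d → ZMod 2) :
    ∃ h', mapCl f (shift h z) = shift h' (mapCl f z) := by
  classical
  have hinj : Set.InjOn f (Set.range z.2) := by
    refine Set.injOn_of_ncard_image_eq ?_ (Set.toFinite _)
    rw [← Set.range_comp]
    exact hf
  refine ⟨fun n => if hn : ∃ p, f (z.2 p) = n then h (z.2 hn.choose) else 0,
    Prod.ext (Prod.ext rfl (funext fun p => Prod.ext ?_ rfl)) rfl⟩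
  have hn : ∃ q, f (z.2 q) = f (z.2 p) := ⟨p, rfl⟩
  refine congrArg ((z.1.2 p).1 + ·) (Eq.symm ?_)
  exact (dif_pos hn).trans (congrArg h (hinj ⟨_, rfl⟩ ⟨_, rfl⟩ hn.choose_spec))

/-- The clusters of pebbles that coincide. -/
noncomputable def points (y : Q × (P → (cube d).Pos)) : P → P := fun p =>
  (Quotient.mk (Setoid.ker y.2) p).out

theorem apply_points (y : Q × (P → (cube d).Pos)) (p : P) : y.2 (points y p) = y.2 p :=
  Quotient.mk_out (s := Setoid.ker y.2) p

/-- When each group of coinciding pebbles is a cluster of its own, the state, the labels and the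
coincidences determine a configuration up to translation. -/
theorem exists_shift_points {y y' : Q × (P → (cube d).Pos)} (h₁ : y.1 = y'.1)
    (h₂ : ∀ p, (y.2 p).2 = (y'.2 p).2) (h₃ : points y = points y') :
    ∃ h, (y', points y') = shift h (y, points y) := by
  refine ⟨fun n => (y'.2 n).1 - (y.2 n).1, Prod.ext (Prod.ext h₁.symm (funext fun p => Prod.ext ?_
    (h₂ p).symm)) h₃.symm⟩
  have e₁ := apply_points y' p
  have e₂ := apply_points y p
  rw [← h₃] at e₁
  simp [shift, e₁, e₂]

variable (m) in
/-- Within time `T d`, some configuration is a translate of an earlier one, when there are at least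
`k` clusters that do not meet. -/
def RepeatsWithin (k : ℕ) (T : ℕ → ℕ) : Prop :=
  ∀ (d : ℕ) [NeZero d] (z : Clustered Q P d), k ≤ size z →
    (∀ t ≤ T d, Separated ((step m)^[t] z) ∧ size ((step m)^[t] z) = size z) →
    ∃ t₁ t₂ h, t₁ < t₂ ∧ t₂ ≤ T d ∧ (step m)^[t₂] z = shift h ((step m)^[t₁] z)

theorem repeatsWithin_of_succ [Finite Q] [Finite P] [Nonempty P] {k : ℕ} {T : ℕ → ℕ} (hT : PolyBounded T)
    (h : RepeatsWithin m (k + 1) T) : ∃ T', PolyBounded T' ∧ RepeatsWithin m k T' := by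
  obtain ⟨p₀⟩ := ‹Nonempty P›
  set n := Nat.card P
  -- State, labels, coincidences, coarse clusters and history.
  let Code (d : ℕ) : Type :=
    Q × (P → Fin d) × (P → P) × (P → P) × List.Vector (Fin (2 * T d + 1) × P × P) n
  have hfin : ∀ d, Finite (Code d) := fun d => inferInstance
  have hN : PolyBounded fun d => Nat.card (Code d) := by
    have e : ∀ d, Nat.card (Code d) = Nat.card Q * (d ^ n * (n ^ n * (n ^ n *
        ((2 * T d + 1) * (n * n)) ^ n))) := by
      intro d
      have := Fintype.ofFinite P
      simp only [Code, Nat.card_prod, Nat.card_fun, Nat.card_fin]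
      rw [Nat.card_eq_fintype_card (α := List.Vector _ _), card_vector, ← Nat.card_eq_fintype_card]
      simp only [Nat.card_prod, Nat.card_fin]
      rfl
    simp only [e]
    exact (PolyBounded.const _).mul ((PolyBounded.id.pow _).mul ((PolyBounded.const _).mul
      ((PolyBounded.const _).mul (((((PolyBounded.const _).mul hT).add (.const _)).mul
        (.const _)).pow _))))
  -- `T d` serves the case of more than `k` clusters; otherwise the pigeonhole principle takes one
  -- time per code, followed by a history of `n` rounds of length at most `2 * T d`.
  refine ⟨fun d => T d + (Nat.card (Code d) + n * (2 * T d)), hT.add (hN.add ((PolyBounded.const _).mul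
    ((PolyBounded.const _).mul hT))), fun d _ z hk hz => ?_⟩
  beta_reduce at hz ⊢
  rcases hk.lt_or_eq with hk | hk
  · obtain ⟨t₁, t₂, h', h₁, h₂, h₃⟩ := h d z hk fun t ht => hz t (by omega)
    exact ⟨t₁, t₂, h', h₁, by omega, h₃⟩
  by_contra hcon
  have hB : ∀ z : Clustered Q P d, k < size z → (∀ t ≤ 2 * T d, Separated ((step m)^[t] z) ∧
      size ((step m)^[t] z) = size z) →
      ∃ t₁ t₂, t₁ < t₂ ∧ t₂ ≤ 2 * T d ∧ (step m)^[t₂] z = (step m)^[t₁] z := by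
    intro z hk hz
    obtain ⟨t₁, t₂, h', h₁, h₂, h₃⟩ := h d z hk fun t ht => hz t (by omega)
    exact exists_repeat (fun t ht => (hz t ht).1) h₁ h₂ h₃
  -- Coinciding pebbles lie in one coarse cluster, so the coarse division is obtained from the fine
  -- one by renaming.
  have hmap : ∀ i ≤ Nat.card (Code d),
      mapCl ((step m)^[i] z).2 (((step m)^[i] z).1, points ((step m)^[i] z).1) =
        (step m)^[i] z := fun i hi =>
    Prod.ext rfl (funext fun p => (hz i (by omega)).1 _ _ (apply_points ((step m)^[i] z).1 p))
  have hσ : ∀ i ≤ Nat.card (Code d), ∃ σ : List.Vector (Fin (2 * T d + 1) × P × P) n,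
      Legal m σ.toList (((step m)^[i] z).1, points ((step m)^[i] z).1) ∧
      duration σ.toList ≤ n * (2 * T d) ∧
      size (run m σ.toList (((step m)^[i] z).1, points ((step m)^[i] z).1)) = k ∧
      mapCl ((step m)^[i] z).2
        (run m σ.toList (((step m)^[i] z).1, points ((step m)^[i] z).1)) =
        (step m)^[duration σ.toList] ((step m)^[i] z) := by
    intro i hi
    have := exists_legal hB p₀ (f := ((step m)^[i] z).2) n
      (((step m)^[i] z).1, points ((step m)^[i] z).1)
      ((Set.ncard_le_card _).trans (Nat.le_add_left _ _)) (by
        intro t ht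
        rw [hmap i hi, ← Function.iterate_add_apply, hk]
        exact hz _ (by omega))
    rw [hmap i hi] at this
    refine this.resolve_left ?_
    rintro ⟨t₁, t₂, h₁, h₂, h₃⟩
    rw [← Function.iterate_add_apply, ← Function.iterate_add_apply] at h₃
    refine hcon ⟨t₁ + i, t₂ + i, 0, by omega, by omega, h₃.trans ?_⟩
    refine Prod.ext (Prod.ext rfl (funext fun p => Prod.ext ?_ rfl)) rfl
    simp [shift]
  have : Nonempty (List.Vector (Fin (2 * T d + 1) × P × P) n) := ⟨.replicate n (0, p₀, p₀)⟩
  choose! σ hσ using hσ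
  let code (i : Fin (Nat.card (Code d) + 1)) : Code d :=
    (((step m)^[i] z).1.1, fun p => (((step m)^[i] z).1.2 p).2,
      points ((step m)^[i] z).1, ((step m)^[i] z).2, σ i)
  have hni : ¬code.Injective := fun hinj => by
    have := Nat.card_le_card_of_injective code hinj
    simp at this
  rw [Function.not_injective_iff] at hni
  obtain ⟨i, j, hij, hne⟩ := hni
  wlog hlt : i < j generalizing i j
  · exact this j i hij.symm hne.symm (lt_of_le_of_ne (not_lt.1 hlt) hne.symm)
  have e₁ : ((step m)^[i] z).1.1 = ((step m)^[j] z).1.1 :=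
    congrArg (fun c : Code d => c.1) hij
  have e₂ : (fun p => (((step m)^[i] z).1.2 p).2) = fun p => (((step m)^[j] z).1.2 p).2 :=
    congrArg (fun c : Code d => c.2.1) hij
  have e₃ : points ((step m)^[i] z).1 = points ((step m)^[j] z).1 :=
    congrArg (fun c : Code d => c.2.2.1) hij
  have e₄ : ((step m)^[i] z).2 = ((step m)^[j] z).2 := congrArg (fun c : Code d => c.2.2.2.1) hij
  have e₅ : σ i = σ j := congrArg (fun c : Code d => c.2.2.2.2) hij
  obtain ⟨a₁, a₂, a₃, a₄⟩ := hσ i (by omega)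
  obtain ⟨b₁, b₂, b₃, b₄⟩ := hσ j (by omega)
  obtain ⟨h', hs⟩ := exists_shift_points e₁ (congrFun e₂) e₃
  rw [← e₄, ← e₅, hs] at b₄
  rw [← e₅, hs] at b₁
  rw [run_shift a₁ b₁] at b₄
  -- At the end of the history both divisions have `k` clusters.
  obtain ⟨h'', hs'⟩ := exists_shift_mapCl (z := run m (σ i).toList _) (by
    rw [a₃, a₄, ← Function.iterate_add_apply]
    exact (hz _ (by omega)).2.trans hk.symm) h'
  rw [hs', a₄, ← Function.iterate_add_apply, ← Function.iterate_add_apply] at b₄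
  refine hcon ⟨_, _, h'', ?_, ?_, b₄.symm⟩ <;> omega

/-- Downward induction starting with one cluster more than there are pebbles, where nothing has to
be shown. -/
theorem exists_repeatsWithin [Finite Q] [Finite P] [Nonempty P] :
    ∃ T, PolyBounded T ∧ RepeatsWithin m 1 T := by
  have key : ∀ n k, k + n = Nat.card P + 1 → ∃ T, PolyBounded T ∧ RepeatsWithin m k T := by
    intro n
    induction n with
    | zero =>
      intro k hk
      refine ⟨fun _ => 0, .const 0, fun d _ z hz _ => ?_⟩
      have : size z ≤ Nat.card P := Set.ncard_le_card _
      omega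
    | succ n ih =>
      intro k hk
      obtain ⟨T, hT, h⟩ := ih (k + 1) (by omega)
      exact repeatsWithin_of_succ hT h
  exact key (Nat.card P) 1 (by omega)

end Clustered

/-- On a hypercube of large dimension, the positions of a pebble miss some node, from any initial
configuration. -/
theorem exists_unvisited {Q P : Type} [Finite Q] [Finite P] [Nonempty P]
    (m : Q → Setoid P → Q × (P → Move 2 P)) : ∃ (d : ℕ) (_ : NeZero d),
      ∀ (y : Q × (P → (cube d).Pos)) (p : P), ∃ v : Fin d → ZMod 2,
        ∀ t, (((detStep m (gridEdges (cube d)))^[t] y).2 p).1 ≠ v := by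
  obtain ⟨T, hT, h⟩ := Clustered.exists_repeatsWithin (m := m)
  obtain ⟨d, hd, hlt⟩ := (((PolyBounded.const 2).mul hT).add (.const 1)).exists_lt_two_pow
  have : NeZero d := ⟨by omega⟩
  refine ⟨d, this, fun y p => ?_⟩
  obtain ⟨p₀⟩ := ‹Nonempty P›
  -- With all pebbles in one cluster, the division never changes and no clusters can meet.
  have hz : ∀ t, ((Clustered.step m)^[t] (y, fun _ => p₀)).1 =
      (detStep m (gridEdges (cube d)))^[t] y ∧
      ((Clustered.step m)^[t] (y, fun _ => p₀)).2 = fun _ => p₀ := by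
    intro t
    induction t with
    | zero => exact ⟨rfl, rfl⟩
    | succ t ih =>
      rw [Function.iterate_succ_apply', Function.iterate_succ_apply']
      refine ⟨congrArg (detStep m _) ih.1, ?_⟩
      change (fun _ => ((Clustered.step m)^[t] (y, fun _ => p₀)).2 _) = _
      rw [ih.2]
  have hsep : ∀ t, Clustered.Separated ((Clustered.step m)^[t] (y, fun _ => p₀)) := by
    intro t p q _
    rw [(hz t).2]
  have hone : Clustered.size ((y, fun _ => p₀) : Clustered Q P d) = 1 := by
    simp [Clustered.size, Set.range_const]
  have hsize : ∀ t, Clustered.size ((Clustered.step m)^[t] (y, fun _ => p₀)) = 1 := by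
    intro t
    rw [Clustered.size, (hz t).2]
    exact hone
  obtain ⟨t₁, t₂, h', ht, hT', e⟩ := h d (y, fun _ => p₀) hone.ge
    fun t _ => ⟨hsep t, (hsize t).trans hone.symm⟩
  obtain ⟨t₁, t₂, ht, hT', e⟩ := Clustered.exists_repeat (fun t _ => hsep t) ht hT' e
  have e : (detStep m (gridEdges (cube d)))^[t₂] y = (detStep m (gridEdges (cube d)))^[t₁] y := by
    rw [← (hz t₁).1, ← (hz t₂).1, e]
  -- After the repetition the computation is periodic, so no new configurations appear.
  have hmem : ∀ t, ∃ s < 2 * T d + 1, (detStep m (gridEdges (cube d)))^[t] y =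
      (detStep m (gridEdges (cube d)))^[s] y := by
    intro t
    induction t using Nat.strong_induction_on with
    | _ t ih =>
      by_cases hlt : t < 2 * T d + 1
      · exact ⟨t, hlt, rfl⟩
      · obtain ⟨s, hs, hs'⟩ := ih (t - t₂ + t₁) (by omega)
        refine ⟨s, hs, ?_⟩
        rw [← hs', Function.iterate_add_apply, ← e, ← Function.iterate_add_apply,
          show t - t₂ + t₂ = t by omega]
  classical
  set S := (Finset.range (2 * T d + 1)).image fun s =>
    (((detStep m (gridEdges (cube d)))^[s] y).2 p).1 with hS
  have hcard : S.card < Fintype.card (Fin d → ZMod 2) := by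
    have h₁ : Fintype.card (Fin d → ZMod 2) = 2 ^ d := by simp
    have h₂ : S.card ≤ 2 * T d + 1 := Finset.card_image_le.trans (by simp)
    rw [h₁]
    exact h₂.trans_lt hlt
  obtain ⟨v, hv⟩ : ∃ v, v ∉ S := by
    by_contra! hall
    rw [Finset.eq_univ_of_forall hall, Finset.card_univ] at hcard
    exact lt_irrefl _ hcard
  refine ⟨v, fun t ht => hv ?_⟩
  obtain ⟨s, hs, hs'⟩ := hmem t
  rw [hS, Finset.mem_image]
  exact ⟨s, Finset.mem_range.2 hs, by rw [← hs', ht]⟩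

theorem detStep_hom {Q P U W : Type} (m : Q → Setoid P → Q × (P → Move 2 P))
    {H : LabelledGraph U 2} {H' : LabelledGraph W 2} {ψ : U → W} (hinj : ψ.Injective)
    (hψ : ∀ u a, ψ (H.edge u a) = H'.edge (ψ u) a) (y : Q × (P → U)) :
    detStep m H' (y.1, ψ ∘ y.2) = ((detStep m H y).1, ψ ∘ (detStep m H y).2) := by
  have hker : Setoid.ker (ψ ∘ y.2) = Setoid.ker y.2 := by
    ext p q
    simp [Setoid.ker_def, hinj.eq_iff]
  simp only [detStep, hker]
  refine Prod.ext rfl (funext fun p => ?_)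
  simp only [Function.comp]
  cases (m y.1 (Setoid.ker y.2)).2 p
  · exact (hψ _ _).symm
  · rfl

theorem EdgeJAG.exists_of_mem_visits {J : EdgeJAG} {G : Input} {curr : J.P} {c : List (IdOn J G)}
    {v : G.V} (h : v ∈ visits curr c) : ∃ x ∈ c, (x.2 curr).1 = v := by
  classical
  exact List.mem_map.1 ((List.destutter_sublist (· ≠ ·) _).subset h)

/-- The bound on the number of visited nodes does not depend on the initial configuration or on the
pebble, so the dimension can be fixed before `curr` and the target. Any computation follows the
unique transition function. -/
theorem exists_unvisited_of_isDeterministic (J : EdgeJAG) (hJ : J.IsDeterministic) :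
    ∃ (d ℓ : ℕ) (_ : NeZero d), 1 ≤ ℓ ∧ ∀ (curr : J.P) (target : Grid d ℓ), ∃ v : Grid d ℓ,
      ∀ c, EdgeJAG.IsComputation J (gridInput d ℓ target) c → v ∉ EdgeJAG.visits curr c := by
  have := J.finQ
  have := J.finP
  have : Nonempty J.P := ⟨J.s⟩
  choose m hm hm' using hJ
  obtain ⟨d, _, h⟩ := exists_unvisited m
  refine ⟨d, 2, inferInstance, by omega, fun curr target => ?_⟩
  have hφ : IsGridMap (ℓ := 2) (gridInput d 2 target) Multiplicative.ofAdd :=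
    ⟨Multiplicative.ofAdd.injective, rfl, fun v i => congrArg Multiplicative.ofAdd (add_comm _ _)⟩
  classical
  let y₀ : J.Q × (J.P → (cube d).Pos) :=
    (J.q₀, fun p => if p = J.t then (Multiplicative.toAdd target, 0) else (0, 0))
  obtain ⟨v, hv⟩ := h y₀ curr
  refine ⟨Multiplicative.ofAdd v, fun c hc hmem => ?_⟩
  let ψ : (cube d).Pos → Grid d 2 × Fin d := posMap (G := gridInput d 2 target) Multiplicative.ofAdd
  have key : ∀ x ∈ c, ∃ t, x = (((detStep m (gridEdges (cube d)))^[t] y₀).1,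
      ψ ∘ ((detStep m (gridEdges (cube d)))^[t] y₀).2) := by
    refine List.IsChain.induction (p := fun x => ∃ t, x = (((detStep m (gridEdges (cube d)))^[t] y₀).1,
      ψ ∘ ((detStep m (gridEdges (cube d)))^[t] y₀).2)) c hc.2 ?_ ?_
    · rintro _ x ⟨μ, hμ, rfl⟩ ⟨t, rfl⟩
      refine ⟨t + 1, ?_⟩
      rw [hm' _ _ _ hμ, Function.iterate_succ_apply']
      exact detStep_hom m hφ.posMap_injective hφ.posMap_edge _
    · intro hne
      refine ⟨0, ?_⟩
      have := hc.1
      rw [List.head?_eq_some_head hne] at this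
      refine (Option.some.inj this).trans ?_
      refine Prod.ext rfl (funext fun p => ?_)
      simp only [JAG.initial, Function.iterate_zero, id, y₀, Function.comp]
      split_ifs <;> rfl
  obtain ⟨x, hx, e⟩ := EdgeJAG.exists_of_mem_visits hmem
  obtain ⟨t, rfl⟩ := key x hx
  exact hv t (Multiplicative.ofAdd.injective e)

theorem not_traverses_of_isDeterministic (J : EdgeJAG) (hJ : J.IsDeterministic) (curr : J.P) :
    ¬EdgeJAG.Traverses J curr gridCayleyGraphs := by
  intro h
  obtain ⟨d, ℓ, _, hℓ, hv⟩ := exists_unvisited_of_isDeterministic J hJ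
  obtain ⟨v, hv⟩ := hv curr 1
  have : NeZero ℓ := ⟨by omega⟩
  obtain ⟨⟨c, hc⟩, htr⟩ := h (gridInput d ℓ 1) ⟨d, ℓ, inferInstance, 1, hℓ, rfl⟩
  refine hv c hc.1 (htr c hc v ?_)
  have hφ : IsGridMap (ℓ := ℓ) (gridInput d ℓ 1) Multiplicative.ofAdd :=
    ⟨Multiplicative.ofAdd.injective, rfl, fun v i => congrArg Multiplicative.ofAdd (add_comm _ _)⟩
  exact hφ.reachable_iff.2 ⟨Multiplicative.toAdd v, rfl⟩

end NDJag

theorem mainTheorem6 :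
    -- canonical paths: every node in the component of the start node has exactly one
    (∀ (ℓ : ℕ) (G : Input), 1 ≤ ℓ → IsGridInput ℓ G → ∀ v, G.graph.Reachable G.start v →
      ∃! e : Fin G.d → Fin ℓ, canonicalNode G e = v) ∧
    -- orderability, in the lexicographic order of the canonical paths
    (∃ (J : EdgeJAG) (curr : J.P), EdgeJAG.Orders J curr gridInputs ∧
      ∀ (ℓ : ℕ) (G : Input), 1 ≤ ℓ → IsGridInput ℓ G →
        ∀ c, EdgeJAG.IsAcceptingComputation J G c → EdgeJAG.visits curr c = lexNodes G ℓ) ∧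
    -- every nondeterministic logspace algorithm can be simulated
    (∀ M : NTM, M.IsLogSpace → ∃ J : EdgeJAG, ∀ (ℓ : ℕ) (G : Input), 1 ≤ ℓ → IsGridInput ℓ G →
      (EdgeJAG.Accepts J G ↔ M.Accepts (encode G (lexNodes G ℓ)))) ∧
    -- co-st-connectivity can be decided
    (∃ J : EdgeJAG, ∀ G ∈ gridInputs,
      (EdgeJAG.Accepts J G ↔ ¬ G.graph.Reachable G.start G.target)) ∧
    -- no deterministic automaton traverses the Cayley graphs
    (¬ ∃ (J : EdgeJAG) (curr : J.P), J.IsDeterministic ∧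
      EdgeJAG.Traverses J curr gridCayleyGraphs) ∧
    -- indeed each one fails to visit all the nodes of some of them, whether it accepts or not
    (∀ J : EdgeJAG, J.IsDeterministic → ∃ (d ℓ : ℕ) (_ : NeZero d), 1 ≤ ℓ ∧
      ∀ (curr : J.P) (target : Grid d ℓ), ∃ v : Grid d ℓ,
        ∀ c, EdgeJAG.IsComputation J (gridInput d ℓ target) c → v ∉ EdgeJAG.visits curr c) := by
  have hin : ∀ (ℓ : ℕ) (G : Input), 1 ≤ ℓ → IsGridInput ℓ G →
      ∃ j : GridIn, j.ℓ = ℓ ∧ j.G = G := fun ℓ G hℓ h => by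
    have : NeZero ℓ := ⟨by omega⟩
    obtain ⟨φ, hφ⟩ := h.exists_isGridMap
    exact ⟨⟨ℓ, G, φ, hφ⟩, rfl, rfl⟩
  refine ⟨fun ℓ G hℓ h v hv => ?_, ?_, fun M hM => ?_, ?_, ?_,
    exists_unvisited_of_isDeterministic⟩
  · obtain ⟨j, rfl, rfl⟩ := hin ℓ G hℓ h
    exact j.isGridMap.existsUnique_canonicalNode hv
  · obtain ⟨J, curr, hJ⟩ := exists_ordering_jag
    refine ⟨J, curr, ⟨fun G ⟨ℓ, hℓ, h⟩ => ?_, fun G ⟨ℓ, hℓ, h⟩ => ?_⟩, fun ℓ G hℓ h => ?_⟩ <;>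
      obtain ⟨j, rfl, rfl⟩ := hin ℓ G hℓ h
    · refine ⟨(hJ j).1, fun c hc v hv => ?_⟩
      rw [(hJ j).2 c hc, j.isGridMap.mem_lexNodes, ← j.isGridMap.reachable_iff]
      exact hv
    · exact ⟨_, (hJ j).2⟩
    · exact (hJ j).2
  · obtain ⟨J, hJ⟩ := (decides_accepts M hM).exists_jag
    refine ⟨J, fun ℓ G hℓ h => ?_⟩
    obtain ⟨j, rfl, rfl⟩ := hin ℓ G hℓ h
    exact hJ j
  · obtain ⟨J, hJ⟩ := decides_not_targetReachable.exists_jag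
    refine ⟨J, fun G ⟨ℓ, hℓ, h⟩ => ?_⟩
    obtain ⟨j, rfl, rfl⟩ := hin ℓ G hℓ h
    exact hJ j
  · rintro ⟨J, curr, hJ, h⟩
    exact not_traverses_of_isDeterministic J hJ curr h
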